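/- Let $K\subset\mathbb{C}$ be the closed regular pentagon with vertices the fifth roots of unity. The \emph{double pentagon} is the translation surface obtained from $K$ and $-K$ by identifying opposite parallel edges by translation. The \emph{necklace} is the translation surface obtained by unfolding the billiard table $K$: for each $g$ in the group $D_5$ of order ten generated by the linear reflections $r_e$ in the directions of the edges $e$ of $K$, take a copy $gK$, and for each edge $e$ identify the edge $g(e)$ of the copy $g$ with the edge $gr_e(e)$ of the copy $gr_e$ by translation. There is a natural projection of the necklace to the double pentagon, which translates each $gK$ to $K$ or $-K$ and is five-to-one, and a folding map from the necklace to the table $K$, given by $g^{-1}$ on $gK$. A trajectory is a bi-infinite unit speed straight line path that avoids the vertices; the length of a periodic trajectory, or of a periodic billiard path of unit speed, is its smallest period. A cylinder is a maximal parallel family of periodic trajectories, and its core curve is its central member. Let $p$ be a periodic trajectory in direction $v$ on the double pentagon that is the core curve of a cylinder. Then $p$ passes through the midpoint of an edge, and one of the following two possibilities holds. 1. The preimage of $p$ on the necklace is the union of five pairwise disjoint periodic trajectories, each of which projects one-to-one onto $p$ and has the same length as $p$. Each of them folds to a billiard path in $K$ that has the same length as $p$ and only reflection symmetry: its image is invariant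 under the reflection in the perpendicular bisector of exactly one edge of $K$, and under no non-trivial rotation of $K$. 2. The preimage of $p$ on the necklace is a single periodic trajectory, whose length is five times that of $p$. It folds to a billiard path in $K$ whose image is invariant under all rotations of $K$ and under the reflections in the perpendicular bisectors of all five edges. The length of this billiard path is five times the length of $p$ if $v$ is not parallel to an edge of $K$, and $5/2$ times the length of $p$ if $v$ is parallel to an edge of $K$. -/

import Mathlib

open Complex Set

noncomputable section

/-! ### Surfaces glued from plane polygons -/

/-- Polygons in the plane `ℂ`, indexed by `Piece`, together with identifications `Glue i z j w`
of a boundary point `z` of the polygon `i` with a boundary point `w` of the polygon `j`. -/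
structure GluedSurface where
  Piece : Type
  poly : Piece → Set ℂ
  vertex : Piece → Set ℂ
  Glue : Piece → ℂ → Piece → ℂ → Prop

namespace GluedSurface

/-- The disjoint union of the polygons. -/
def Pre (S : GluedSurface) : Type := {x : S.Piece × ℂ // x.2 ∈ S.poly x.1}

/-- The points of the surface: the quotient by the equivalence relation that is generated by
the identifications. -/
def Point (S : GluedSurface) : Type :=
  Quot (fun x y : S.Pre => S.Glue x.1.1 x.1.2 y.1.1 y.1.2)

/-- The point of the surface that is represented by `z` in the polygon `i`. -/
def toPoint (S : GluedSurface) (i : S.Piece) (z : ℂ) (h : z ∈ S.poly i) : S.Point :=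
  Quot.mk _ ⟨(i, z), h⟩

/-- The points of the surface that come from vertices of the polygons. -/
def singular (S : GluedSurface) : Set S.Point :=
  {x | ∃ (i : S.Piece) (z : ℂ) (h : z ∈ S.poly i), z ∈ S.vertex i ∧ x = S.toPoint i z h}

/-- On the times `t + s`, `s ∈ A`, the curve `γ` runs inside one polygon, along a straight line
with velocity `u`. -/
def RunsStraight (S : GluedSurface) (u : ℂ) (γ : ℝ → S.Point) (t : ℝ) (A : Set ℝ) : Prop :=
  ∃ (i : S.Piece) (z : ℂ), ∀ s ∈ A, ∃ h : z + (s : ℂ) * u ∈ S.poly i,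
    γ (t + s) = S.toPoint i (z + (s : ℂ) * u) h

/-- On the open set `J` of times, `γ` avoids the vertices and moves along the surface with
constant velocity `u`: for a short time before and for a short time after each `t ∈ J` it runs
with velocity `u` inside a polygon (not necessarily the same one before and after). -/
def IsStraightOn (S : GluedSurface) (u : ℂ) (γ : ℝ → S.Point) (J : Set ℝ) : Prop :=
  ∀ t ∈ J, γ t ∉ S.singular ∧ ∃ ε : ℝ, 0 < ε ∧
    S.RunsStraight u γ t (Icc (-ε) 0) ∧ S.RunsStraight u γ t (Icc 0 ε)

/-- Trajectories of the linear flow with velocity `v` (bi-infinite, so never hitting a vertex)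
that are periodic. -/
def IsPeriodicTrajectory (S : GluedSurface) (v : ℂ) (γ : ℝ → S.Point) : Prop :=
  S.IsStraightOn v γ univ ∧ ∃ T : ℝ, 0 < T ∧ Function.Periodic γ T

/-- `Φ s`, `a < s < b`, are parallel periodic trajectories with velocity `v`, where `Φ s` is
obtained from `Φ s'` by moving it orthogonally (to the left) through the distance `s - s'`,
without meeting a vertex on the way. -/
def IsParallelFamily (S : GluedSurface) (v : ℂ) (a b : ℝ) (Φ : ℝ → ℝ → S.Point) : Prop :=
  (∀ s ∈ Ioo a b, S.IsPeriodicTrajectory v (Φ s)) ∧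
    ∀ t : ℝ, S.IsStraightOn (I * v) (fun s => Φ s t) (Ioo a b)

/-- `p` is the core curve of a cylinder: the maximal parallel family of periodic trajectories
around `p` extends equally far, namely through the distance `w`, to both sides of `p`. -/
def IsCoreCurve (S : GluedSurface) (v : ℂ) (p : ℝ → S.Point) : Prop :=
  ∃ w : ℝ, 0 < w ∧
    (∃ Φ : ℝ → ℝ → S.Point, S.IsParallelFamily v (-w) w Φ ∧ Φ 0 = p) ∧
    ∀ (a b : ℝ) (Ψ : ℝ → ℝ → S.Point), a < 0 → 0 < b →
      S.IsParallelFamily v a b Ψ → Ψ 0 = p → -w ≤ a ∧ b ≤ w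

end GluedSurface

/-- The curve `γ` is periodic with smallest period `l`. For a curve of unit speed on a surface, or
a billiard path of unit speed, this is its length. -/
def HasLength {X : Type} (γ : ℝ → X) (l : ℝ) : Prop :=
  IsLeast {T : ℝ | 0 < T ∧ Function.Periodic γ T} l

/-! ### The regular pentagon -/

/-- The fifth roots of unity `exp (2 * π * I * k / 5)`. -/
def zeta (k : ZMod 5) : ℂ := ZMod.stdAddChar k

/-- The (closed) regular pentagon. -/
def pentagon : Set ℂ := convexHull ℝ (range zeta)

/-- The five edges of the regular pentagon. -/
def edge (k : ZMod 5) : Set ℂ := segment ℝ (zeta k) (zeta (k + 1))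

/-- The linear isometries `z ↦ zeta k * z` and `z ↦ -zeta (-k) * conj z` of the plane, an action
of the dihedral group of order ten. It is generated by the reflections of directions in the edges
of the pentagon. -/
def act : DihedralGroup 5 → ℂ → ℂ
  | .r k, z => zeta k * z
  | .sr k, z => -(zeta (-k) * (starRingEnd ℂ) z)

/-- The reflection of directions in the edge `k`: the linear reflection that fixes
`zeta (k + 1) - zeta k` and negates the normal `zeta k + zeta (k + 1)` of the edge. -/
def edgeRefl (k : ZMod 5) : DihedralGroup 5 := .sr (-(2 * k + 1))

/-- The rotation of the pentagon by the angle `2 * π * k / 5`. -/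
def pentagonRotation (k : ZMod 5) (z : ℂ) : ℂ := zeta k * z

/-- The reflection of the pentagon in the perpendicular bisector of the edge `k`. -/
def bisectorReflection (k : ZMod 5) (z : ℂ) : ℂ := zeta (2 * k + 1) * (starRingEnd ℂ) z

/-- Invariance of a subset of the plane under a map. -/
def IsSymmetricUnder (f : ℂ → ℂ) (A : Set ℂ) : Prop := f '' A = A

/-- The direction `v` is parallel to an edge of the pentagon. -/
def ParallelToEdge (v : ℂ) : Prop :=
  ∃ (k : ZMod 5) (c : ℝ), v = (c : ℂ) * (zeta (k + 1) - zeta k)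

/-- Billiard trajectories of unit speed in the regular pentagon that never hit a vertex: around
each time `t` the ball arrives with a velocity `u` and leaves with a velocity `w`, where `w = u`
off the edges and `w` is the mirror image of `u` at an edge. -/
def IsBilliardTrajectory (β : ℝ → ℂ) : Prop :=
  ∀ t : ℝ, β t ∈ pentagon ∧ β t ∉ range zeta ∧
    ∃ (ε : ℝ) (u w : ℂ), 0 < ε ∧ ‖u‖ = 1 ∧
      (∀ s ∈ Icc (-ε) 0, β (t + s) = β t + (s : ℂ) * u) ∧
      (∀ s ∈ Icc 0 ε, β (t + s) = β t + (s : ℂ) * w) ∧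
      ((∀ k, β t ∉ edge k) → w = u) ∧
      ∀ k, β t ∈ edge k → w = act (edgeRefl k) u

/-! ### The double pentagon and the necklace -/

/-- The double pentagon: the regular pentagon (`true`) and its image under `z ↦ -z` (`false`),
opposite parallel edges being identified by translation. -/
def doublePentagon : GluedSurface where
  Piece := Bool
  poly := fun i => if i then pentagon else {z | -z ∈ pentagon}
  vertex := fun i => if i then range zeta else {z | -z ∈ range zeta}
  Glue := fun i z j w => i = true ∧ j = false ∧
    ∃ k : ZMod 5, z ∈ edge k ∧ w = z - (zeta k + zeta (k + 1))

/-- The necklace: the unfolding of the pentagonal billiard table. It consists of ten pentagons, the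
images `act g '' pentagon`; the copy `g` and its mirror image in its edge `act g '' edge k`,
which is the copy `g * edgeRefl k` up to a translation, are identified along that edge. -/
def necklace : GluedSurface where
  Piece := DihedralGroup 5
  poly := fun g => act g '' pentagon
  vertex := fun g => act g '' range zeta
  Glue := fun g z h w => ∃ k : ZMod 5, ∃ x ∈ edge k,
    h = g * edgeRefl k ∧ z = act g x ∧ w = act h x

theorem zeta_add (a b : ZMod 5) : zeta (a + b) = zeta a * zeta b := by
  simp [zeta, AddChar.map_add_eq_mul]

theorem zeta_zero : zeta 0 = 1 := by simp [zeta]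

theorem conj_zeta (a : ZMod 5) : (starRingEnd ℂ) (zeta a) = zeta (-a) := by
  rw [zeta, zeta, AddChar.map_neg_eq_conj]

theorem act_mul (g h : DihedralGroup 5) (z : ℂ) : act (g * h) z = act g (act h z) := by
  rcases g with a | a <;> rcases h with b | b <;>
    simp only [DihedralGroup.r_mul_r, DihedralGroup.r_mul_sr, DihedralGroup.sr_mul_r,
      DihedralGroup.sr_mul_sr, act, map_neg, map_mul, conj_zeta, neg_add, sub_eq_add_neg,
      zeta_add, neg_neg, Complex.conj_conj] <;> ring

theorem act_inv_act (g : DihedralGroup 5) (z : ℂ) : act g⁻¹ (act g z) = z := by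
  rw [← act_mul, inv_mul_cancel]
  change zeta 0 * z = z
  rw [zeta_zero, one_mul]

/-- The real-linear map underlying `act g`. -/
def actLin (g : DihedralGroup 5) : ℂ →ₗ[ℝ] ℂ where
  toFun := act g
  map_add' x y := by cases g <;> simp [act] <;> ring
  map_smul' c x := by cases g <;> simp [act] <;> ring

theorem act_r_vertex (a k : ZMod 5) : act (.r a) (zeta k) = zeta (k + a) := by
  simp [act, zeta_add, mul_comm]

theorem act_sr_vertex (a k : ZMod 5) : act (.sr a) (zeta k) = -zeta (-k - a) := by
  simp [act, conj_zeta, zeta_add, sub_eq_add_neg, mul_comm]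

/-- The copy `g` of the pentagon in the necklace is a translate of the first pentagon of the
double pentagon if `g` is a rotation, and of the second one if `g` is a reflection. -/
def sheet : DihedralGroup 5 → Bool
  | .r _ => true
  | .sr _ => false

theorem act_mem_poly (g : DihedralGroup 5) {x : ℂ} (hx : x ∈ pentagon) :
    act g x ∈ doublePentagon.poly (sheet g) := by
  have key : ∀ L : ℂ →ₗ[ℝ] ℂ, (∀ k, L (zeta k) ∈ range zeta) → L x ∈ pentagon := by
    intro L hL
    have h1 : L x ∈ L '' convexHull ℝ (range zeta) := ⟨x, hx, rfl⟩
    rw [LinearMap.image_convexHull] at h1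
    refine convexHull_mono ?_ h1
    rintro _ ⟨_, ⟨k, rfl⟩, rfl⟩
    exact hL k
  rcases g with a | a
  · exact key (actLin (.r a)) fun k => ⟨k + a, (act_r_vertex a k).symm⟩
  · refine key (-actLin (.sr a)) fun k => ⟨-k - a, ?_⟩
    change _ = -act (.sr a) (zeta k)
    rw [act_sr_vertex, neg_neg]

theorem poly_necklace_subset (g : DihedralGroup 5) {z : ℂ} (hz : z ∈ necklace.poly g) :
    z ∈ doublePentagon.poly (sheet g) := by
  obtain ⟨x, hx, rfl⟩ := hz
  exact act_mem_poly g hx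

theorem act_edgeRefl {k : ZMod 5} {x : ℂ} (hx : x ∈ edge k) :
    act (edgeRefl k) x = x - (zeta k + zeta (k + 1)) := by
  obtain ⟨a, b, -, -, hab, rfl⟩ := hx
  have h1 : act (edgeRefl k) (zeta k) = -zeta (k + 1) := by
    rw [edgeRefl, act_sr_vertex]; congr 2; ring
  have h2 : act (edgeRefl k) (zeta (k + 1)) = -zeta k := by
    rw [edgeRefl, act_sr_vertex]; congr 2; ring
  have h3 : act (edgeRefl k) (a • zeta k + b • zeta (k + 1)) =
      a • act (edgeRefl k) (zeta k) + b • act (edgeRefl k) (zeta (k + 1)) := by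
    have := (actLin (edgeRefl k)).map_add (a • zeta k) (b • zeta (k + 1))
    rw [map_smul, map_smul] at this
    exact this
  have hb : (b : ℂ) = 1 - a := by
    have := congrArg (fun r : ℝ => (r : ℂ)) hab
    push_cast at this
    linear_combination this
  rw [h3, h1, h2]
  simp only [Complex.real_smul, hb]
  ring

theorem act_r_edge (a : ZMod 5) {k : ZMod 5} {x : ℂ} (hx : x ∈ edge k) :
    act (.r a) x ∈ edge (k + a) := by
  have h : actLin (.r a) x ∈ actLin (.r a) '' segment ℝ (zeta k) (zeta (k + 1)) := ⟨x, hx, rfl⟩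
  have h0 := image_segment ℝ (actLin (.r a)).toAffineMap (zeta k) (zeta (k + 1))
  rw [LinearMap.coe_toAffineMap] at h0
  rw [h0] at h
  change act (.r a) x ∈ segment ℝ (act (.r a) (zeta k)) (act (.r a) (zeta (k + 1))) at h
  rw [act_r_vertex, act_r_vertex, add_right_comm] at h
  exact h

/-- Across a glued edge, the projection to the double pentagon respects the identifications. -/
theorem glue_aux (a : ZMod 5) {k : ZMod 5} {x : ℂ} (hx : x ∈ edge k) :
    doublePentagon.Glue true (act (.r a) x) false (act (.r a * edgeRefl k) x) := by
  refine ⟨rfl, rfl, k + a, act_r_edge a hx, ?_⟩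
  rw [act_mul, act_edgeRefl hx]
  have : zeta (k + a + 1) = zeta (k + 1) * zeta a := by
    rw [← zeta_add]; congr 1; ring
  simp only [act, this, zeta_add k a]
  ring

/-- The projection of the necklace to the double pentagon, which translates each of the ten
pentagons to one of the two pentagons. -/
def project : necklace.Point → doublePentagon.Point :=
  Quot.lift
    (fun x => doublePentagon.toPoint (sheet x.1.1) x.1.2 (poly_necklace_subset x.1.1 x.2))
    (by
      rintro ⟨⟨g, z⟩, hz⟩ ⟨⟨h, w⟩, hw⟩ ⟨k, x, hx, hgh, hgz, hhw⟩
      dsimp only at hgh hgz hhw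
      subst hgh hgz hhw
      rcases g with a | a
      · exact Quot.sound (glue_aux a hx)
      · refine (Quot.sound ?_).symm
        have h2 : (DihedralGroup.sr a * edgeRefl k) * edgeRefl k = DihedralGroup.sr a := by
          rw [mul_assoc, edgeRefl, DihedralGroup.sr_mul_self, mul_one]
        have h3 := glue_aux (-(2 * k + 1) - a) hx
        have h4 : DihedralGroup.r (-(2 * k + 1) - a) = DihedralGroup.sr a * edgeRefl k := by
          rw [edgeRefl, DihedralGroup.sr_mul_sr]
        rw [h4, h2] at h3
        exact h3)

/-- Folding the necklace to the billiard table. -/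
def fold : necklace.Point → ℂ :=
  Quot.lift (fun x => act x.1.1⁻¹ x.1.2)
    (by
      rintro ⟨⟨g, z⟩, hz⟩ ⟨⟨h, w⟩, hw⟩ ⟨k, x, hx, hgh, hgz, hhw⟩
      dsimp only at hgh hgz hhw ⊢
      subst hgz hhw
      exact (act_inv_act g x).trans (act_inv_act h x).symm)

theorem midpoint_mem_pentagon (k : ZMod 5) : (zeta k + zeta (k + 1)) / 2 ∈ pentagon := by
  have h : midpoint ℝ (zeta k) (zeta (k + 1)) ∈ pentagon :=
    (convex_convexHull ℝ _).midpoint_mem (subset_convexHull ℝ _ (mem_range_self k))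
      (subset_convexHull ℝ _ (mem_range_self (k + 1)))
  have e : midpoint ℝ (zeta k) (zeta (k + 1)) = (zeta k + zeta (k + 1)) / 2 := by
    rw [midpoint_eq_smul_add, Complex.real_smul]
    simp
    ring
  rwa [e] at h

/-- The midpoints of the five edges of the double pentagon. -/
def edgeMidpoint (k : ZMod 5) : doublePentagon.Point :=
  doublePentagon.toPoint true ((zeta k + zeta (k + 1)) / 2) (midpoint_mem_pentagon k)

end

theorem zeta_injective : Function.Injective zeta := ZMod.injective_stdAddChar

theorem zeta_mul_zeta_neg (a : ZMod 5) : zeta a * zeta (-a) = 1 := by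
  rw [← zeta_add, add_neg_cancel, zeta_zero]

theorem norm_zeta (a : ZMod 5) : ‖zeta a‖ = 1 := by
  have h := congrArg norm (zeta_mul_zeta_neg a)
  rw [← conj_zeta, norm_mul, RCLike.norm_conj, norm_one] at h
  nlinarith [norm_nonneg (zeta a)]

theorem zeta_one_eq : zeta 1 = Complex.exp ((2 * Real.pi / 5 : ℝ) * I) := by
  have h := ZMod.stdAddChar_coe (N := 5) 1
  simp only [Int.cast_one, mul_one] at h
  rw [zeta, h]
  congr 1
  push_cast
  ring

theorem zeta_one_re_pos : 0 < (zeta 1).re := by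
  rw [zeta_one_eq, Complex.exp_ofReal_mul_I_re]
  apply Real.cos_pos_of_mem_Ioo
  constructor <;> linarith [Real.pi_pos]

theorem zeta_one_im_pos : 0 < (zeta 1).im := by
  rw [zeta_one_eq, Complex.exp_ofReal_mul_I_im]
  apply Real.sin_pos_of_pos_of_lt_pi <;> linarith [Real.pi_pos]

theorem zeta_neg_re (a : ZMod 5) : (zeta (-a)).re = (zeta a).re := by
  rw [← conj_zeta, Complex.conj_re]

theorem zeta_neg_im (a : ZMod 5) : (zeta (-a)).im = -(zeta a).im := by
  rw [← conj_zeta, Complex.conj_im]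

theorem zeta_one_sq : (zeta 1).re ^ 2 + (zeta 1).im ^ 2 = 1 := by
  have h := norm_zeta 1
  rw [Complex.norm_def, Real.sqrt_eq_one, Complex.normSq_apply] at h
  linarith

theorem zeta_two_re : (zeta 2).re = 2 * (zeta 1).re ^ 2 - 1 := by
  have h : zeta 2 = zeta 1 * zeta 1 := by rw [← zeta_add]; rfl
  rw [h, Complex.mul_re]
  linarith [zeta_one_sq]

theorem zeta_two_im : (zeta 2).im = 2 * (zeta 1).re * (zeta 1).im := by
  have h : zeta 2 = zeta 1 * zeta 1 := by rw [← zeta_add]; rfl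
  rw [h, Complex.mul_im]
  ring

theorem zeta_one_re_quadratic : 4 * (zeta 1).re ^ 2 + 2 * (zeta 1).re = 1 := by
  have h3 : (zeta 3).re = (zeta 2).re := zeta_neg_re 2
  have h : zeta 3 = zeta 2 * zeta 1 := by rw [← zeta_add]; rfl
  rw [h, Complex.mul_re, zeta_two_re, zeta_two_im] at h3
  have h5 := zeta_one_sq
  have hc := zeta_one_re_pos
  have h6 : (zeta 1).im ^ 2 = 1 - (zeta 1).re ^ 2 := by linarith
  have h7 : ((zeta 1).re - 1) * (4 * (zeta 1).re ^ 2 + 2 * (zeta 1).re - 1) = 0 := by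
    linear_combination h3 + 2 * (zeta 1).re * h6
  rcases mul_eq_zero.1 h7 with h8 | h8
  · exfalso
    have : 0 < (zeta 1).im ^ 2 := by have := zeta_one_im_pos; positivity
    have h9 : (zeta 1).re = 1 := by linarith
    rw [h9] at h6
    linarith
  · linarith

/-- The sum of the endpoints of an edge, which is normal to the edge. -/
noncomputable def edgeSum (k : ZMod 5) : ℂ := zeta k + zeta (k + 1)

/-- The height of `z` in the direction of the outer normal of the edge `k`. -/
noncomputable def height (k : ZMod 5) : ℂ →ₗ[ℝ] ℝ where
  toFun z := (z * (starRingEnd ℂ) (edgeSum k)).re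
  map_add' x y := by rw [add_mul, Complex.add_re]
  map_smul' c x := by simp [mul_assoc]

theorem height_apply (k : ZMod 5) (z : ℂ) :
    height k z = (z * (starRingEnd ℂ) (edgeSum k)).re := rfl

/-- The height of the points of an edge. -/
noncomputable def edgeHeight : ℝ := 1 + (zeta 1).re

theorem edgeHeight_pos : 0 < edgeHeight := by
  have := zeta_one_re_pos
  rw [edgeHeight]
  linarith

theorem height_zeta (m k : ZMod 5) :
    height m (zeta k) = (zeta (k - m)).re + (zeta (k - m - 1)).re := by
  rw [height_apply, edgeSum, map_add, conj_zeta, conj_zeta, mul_add, ← zeta_add, ← zeta_add,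
    Complex.add_re]
  congr 3 <;> ring_nf

theorem height_zeta_self (m : ZMod 5) : height m (zeta m) = edgeHeight := by
  rw [height_zeta, sub_self, zeta_zero, zero_sub, zeta_neg_re]
  rfl

theorem height_zeta_succ (m : ZMod 5) : height m (zeta (m + 1)) = edgeHeight := by
  rw [height_zeta, add_sub_cancel_left, sub_self, zeta_zero, edgeHeight, Complex.one_re, add_comm]

theorem height_zeta_lt {m k : ZMod 5} (h0 : k ≠ m) (h1 : k ≠ m + 1) :
    height m (zeta k) < edgeHeight := by
  rw [height_zeta, edgeHeight]
  obtain ⟨j, hj⟩ : ∃ j, j = k - m := ⟨_, rfl⟩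
  have h2 : j ≠ 0 := by rw [hj]; exact sub_ne_zero.2 h0
  have h3 : j ≠ 1 := by rintro rfl; exact h1 (by rw [hj]; ring)
  rw [← hj]
  have e3 : (zeta 3).re = (zeta 2).re := zeta_neg_re 2
  have e4 : (zeta 4).re = (zeta 1).re := zeta_neg_re 1
  have hc := zeta_one_re_pos
  have hq := zeta_one_re_quadratic
  have h2' := zeta_two_re
  fin_cases j
  · exact absurd rfl h2
  · exact absurd rfl h3
  · change (zeta 2).re + (zeta 1).re < _
    linarith
  · change (zeta 3).re + (zeta 2).re < _
    linarith
  · change (zeta 4).re + (zeta 3).re < _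
    linarith

theorem height_zeta_le (m k : ZMod 5) : height m (zeta k) ≤ edgeHeight := by
  by_cases h0 : k = m
  · rw [h0, height_zeta_self]
  by_cases h1 : k = m + 1
  · rw [h1, height_zeta_succ]
  exact (height_zeta_lt h0 h1).le

theorem height_le {z : ℂ} (hz : z ∈ pentagon) (m : ZMod 5) : height m z ≤ edgeHeight := by
  have : pentagon ⊆ {z | height m z ≤ edgeHeight} := by
    apply convexHull_min
    · rintro _ ⟨k, rfl⟩
      exact height_zeta_le m k
    · exact convex_halfSpace_le (height m).isLinear _
  exact this hz

theorem height_edgeSum (m : ZMod 5) : height m (edgeSum m) = 2 * edgeHeight := by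
  rw [edgeSum, map_add, height_zeta_self, height_zeta_succ, two_mul]

theorem edgeSum_ne_zero (m : ZMod 5) : edgeSum m ≠ 0 := by
  intro h
  have := height_edgeSum m
  rw [h, map_zero] at this
  linarith [edgeHeight_pos]

theorem exists_nonneg_combination {k : ZMod 5} {z : ℂ} (h1 : height (k + 1) z ≤ height k z)
    (h2 : height (k - 1) z ≤ height k z) :
    ∃ a b : ℝ, 0 ≤ a ∧ 0 ≤ b ∧ z = a * zeta k + b * zeta (k + 1) := by
  set w : ℂ := z * zeta (-k) with hw
  have hz : z = w * zeta k := by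
    rw [hw, mul_assoc, mul_comm (zeta (-k)), zeta_mul_zeta_neg, mul_one]
  have key : ∀ j : ZMod 5, height (k + j) z =
      w.re * ((zeta j).re + (zeta (j + 1)).re) + w.im * ((zeta j).im + (zeta (j + 1)).im) := by
    intro j
    rw [height_apply, edgeSum, map_add, conj_zeta, conj_zeta, hz]
    have e : w * zeta k * (zeta (-(k + j)) + zeta (-(k + j + 1))) =
        w * (zeta (-j) + zeta (-(j + 1))) := by
      have e1 : zeta (-(k + j)) = zeta (-k) * zeta (-j) := by rw [← zeta_add]; ring_nf
      have e2 : zeta (-(k + j + 1)) = zeta (-k) * zeta (-(j + 1)) := by rw [← zeta_add]; ring_nf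
      rw [e1, e2]
      linear_combination w * (zeta (-j) + zeta (-(j + 1))) * zeta_mul_zeta_neg k
    rw [e, Complex.mul_re, Complex.add_re, Complex.add_im, zeta_neg_re, zeta_neg_re, zeta_neg_im,
      zeta_neg_im]
    ring
  have k0 := key 0
  have k1 := key 1
  have k4 := key (-1)
  rw [add_zero, zero_add, zeta_zero, Complex.one_re, Complex.one_im] at k0
  rw [show (1 : ZMod 5) + 1 = 2 by rfl, zeta_two_re, zeta_two_im] at k1
  rw [neg_add_cancel, zeta_zero, zeta_neg_re, zeta_neg_im, Complex.one_re, Complex.one_im,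
    ← sub_eq_add_neg] at k4
  have hs := zeta_one_im_pos
  have hq := zeta_one_sq
  set c := (zeta 1).re
  set s := (zeta 1).im
  have hb : 0 ≤ w.im * s := by linarith
  have ha : 0 ≤ (w.re * s - w.im * c) * s := by
    have e : (w.re * s - w.im * c) * s = w.re * (1 - c ^ 2) - w.im * c * s := by
      linear_combination w.re * hq
    rw [e]
    linarith
  refine ⟨(w.re * s - w.im * c) / s, w.im / s, ?_, ?_, ?_⟩
  · exact div_nonneg (nonneg_of_mul_nonneg_left ha hs) hs.le
  · exact div_nonneg (nonneg_of_mul_nonneg_left hb hs) hs.le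
  · rw [zeta_add k 1]
    conv_lhs => rw [hz]
    have : w = (((w.re * s - w.im * c) / s : ℝ) : ℂ) + ((w.im / s : ℝ) : ℂ) * zeta 1 := by
      apply Complex.ext
      · rw [Complex.add_re, Complex.re_ofReal_mul, Complex.ofReal_re]
        change _ = _ + _ * c
        field_simp
        ring
      · rw [Complex.add_im, Complex.im_ofReal_mul, Complex.ofReal_im]
        change _ = _ + _ * s
        field_simp
        ring
    linear_combination zeta k * this

theorem mem_edge_of_combination {k : ZMod 5} {a b : ℝ} (ha : 0 ≤ a) (hb : 0 ≤ b) (h : a + b = 1) :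
    (a : ℂ) * zeta k + b * zeta (k + 1) ∈ edge k :=
  ⟨a, b, ha, hb, h, by simp⟩

theorem zeta_mem_pentagon (k : ZMod 5) : zeta k ∈ pentagon :=
  subset_convexHull ℝ _ (mem_range_self k)

theorem edge_subset (k : ZMod 5) : edge k ⊆ pentagon :=
  (convex_convexHull ℝ _).segment_subset (zeta_mem_pentagon k) (zeta_mem_pentagon (k + 1))

theorem height_combination (k : ZMod 5) (a b : ℝ) :
    height k (a * zeta k + b * zeta (k + 1)) = (a + b) * edgeHeight := by
  rw [← Complex.real_smul, ← Complex.real_smul, map_add, map_smul, map_smul, height_zeta_self,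
    height_zeta_succ, smul_eq_mul, smul_eq_mul, add_mul]

theorem zero_mem_pentagon : (0 : ℂ) ∈ pentagon := by
  by_contra h0
  obtain ⟨f, u, h1, h2⟩ := geometric_hahn_banach_point_closed (convex_convexHull ℝ (range zeta))
    (((finite_range zeta).isCompact_convexHull ℝ).isClosed) h0
  have hs : ∑ k : ZMod 5, zeta k = 0 :=
    AddChar.sum_eq_zero_of_ne_one (ψ := (ZMod.stdAddChar : AddChar (ZMod 5) ℂ)) (by
      intro h
      have e : zeta 1 = zeta 0 := by rw [zeta, zeta, h]; rfl
      exact absurd (zeta_injective e) (by decide))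
  have h3 : ∑ k : ZMod 5, f (zeta k) = 0 := by rw [← map_sum, hs, map_zero]
  rw [map_zero] at h1
  have h4 : 0 < ∑ k : ZMod 5, f (zeta k) :=
    Finset.sum_pos (fun k _ => h1.trans (h2 _ (zeta_mem_pentagon k))) Finset.univ_nonempty
  linarith

theorem mem_pentagon_iff {z : ℂ} : z ∈ pentagon ↔ ∀ k, height k z ≤ edgeHeight := by
  refine ⟨fun h k => height_le h k, fun h => ?_⟩
  obtain ⟨k, -, hk⟩ := Finset.exists_max_image Finset.univ (fun k => height k z)
    ⟨0, Finset.mem_univ (0 : ZMod 5)⟩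
  obtain ⟨a, b, ha, hb, hz⟩ := exists_nonneg_combination (hk _ (Finset.mem_univ (k + 1)))
    (hk _ (Finset.mem_univ (k - 1)))
  have h1 := h k
  rw [hz, height_combination] at h1
  have h2 : a + b ≤ 1 := by nlinarith [edgeHeight_pos]
  rcases (add_nonneg ha hb).eq_or_lt with h3 | h3
  · have ha' : a = 0 := by linarith
    have hb' : b = 0 := by linarith
    rw [hz, ha', hb']
    simpa using zero_mem_pentagon
  · have h4 : ((a / (a + b) : ℝ) : ℂ) * zeta k + ((b / (a + b) : ℝ) : ℂ) * zeta (k + 1) ∈ pentagon :=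
      edge_subset k (mem_edge_of_combination (by positivity) (by positivity) (by field_simp))
    have h5 := (convex_convexHull ℝ (range zeta)).smul_mem_of_zero_mem zero_mem_pentagon h4
      (t := a + b) ⟨h3.le, h2⟩
    have h6 : ((a + b : ℝ) : ℂ) ≠ 0 := by exact_mod_cast h3.ne'
    have h7 : (a + b) • (((a / (a + b) : ℝ) : ℂ) * zeta k +
        ((b / (a + b) : ℝ) : ℂ) * zeta (k + 1)) = z := by
      rw [hz, Complex.real_smul]
      push_cast at h6 ⊢
      field_simp
    rwa [h7] at h5

theorem height_edge {k : ZMod 5} {z : ℂ} (hz : z ∈ edge k) : height k z = edgeHeight := by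
  obtain ⟨a, b, -, -, h, rfl⟩ := hz
  rw [Complex.real_smul, Complex.real_smul, height_combination, h, one_mul]

theorem mem_edge_of_height {k : ZMod 5} {z : ℂ} (hz : z ∈ pentagon) (h : edgeHeight ≤ height k z) :
    z ∈ edge k := by
  obtain ⟨a, b, ha, hb, rfl⟩ := exists_nonneg_combination ((height_le hz (k + 1)).trans h)
    ((height_le hz (k - 1)).trans h)
  have h1 := le_antisymm (height_le hz k) h
  rw [height_combination] at h1
  exact mem_edge_of_combination ha hb (by nlinarith [edgeHeight_pos])

theorem mem_edge_of_sub_mem {k : ZMod 5} {z : ℂ} (hz : z ∈ pentagon)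
    (h : edgeSum k - z ∈ pentagon) : z ∈ edge k := by
  apply mem_edge_of_height hz
  have := height_le h k
  rw [map_sub, height_edgeSum] at this
  linarith

theorem edgeSum_sub_mem {k : ZMod 5} {z : ℂ} (hz : z ∈ edge k) : edgeSum k - z ∈ edge k := by
  obtain ⟨a, b, ha, hb, h, rfl⟩ := hz
  refine ⟨b, a, hb, ha, by linarith, ?_⟩
  have h1 : (a : ℂ) + b = 1 := by exact_mod_cast h
  simp only [Complex.real_smul, edgeSum]
  linear_combination (zeta k + zeta (k + 1)) * h1

theorem eq_or_eq_of_zeta_mem_edge {k j : ZMod 5} (h : zeta j ∈ edge k) : j = k ∨ j = k + 1 := by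
  by_contra! h1
  exact (height_zeta_lt h1.1 h1.2).ne (height_edge h)

theorem edgeSum_sub_vertex {k : ZMod 5} {z : ℂ} (hz : z ∈ edge k) (h : z ∈ range zeta) :
    edgeSum k - z ∈ range zeta := by
  obtain ⟨j, rfl⟩ := h
  rcases eq_or_eq_of_zeta_mem_edge hz with rfl | rfl
  · exact ⟨j + 1, by rw [edgeSum]; ring⟩
  · exact ⟨k, by rw [edgeSum]; ring⟩

theorem edge_unique {k j : ZMod 5} {z : ℂ} (hk : z ∈ edge k) (hj : z ∈ edge j)
    (h : z ∉ range zeta) : k = j := by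
  have h1 := height_edge hj
  obtain ⟨a, b, ha, hb, hab, rfl⟩ := hk
  rw [map_add, map_smul, map_smul, smul_eq_mul, smul_eq_mul] at h1
  rcases ha.eq_or_lt with rfl | ha
  · exact absurd ⟨k + 1, by simp [show b = 1 by linarith]⟩ h
  rcases hb.eq_or_lt with rfl | hb
  · exact absurd ⟨k, by simp [show a = 1 by linarith]⟩ h
  have h2 := height_zeta_le j k
  have h3 := height_zeta_le j (k + 1)
  by_contra hne
  have h4 : height j (zeta k) < edgeHeight ∨ height j (zeta (k + 1)) < edgeHeight := by
    by_cases h5 : k = j + 1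
    · right
      refine height_zeta_lt ?_ ?_
      · rw [h5, add_assoc]
        intro h6
        exact absurd (add_eq_left.1 h6) (by decide)
      · rw [h5]
        intro h6
        exact absurd (add_eq_left.1 h6) (by decide)
    · exact Or.inl (height_zeta_lt hne h5)
  have h5 : a * edgeHeight + b * edgeHeight = edgeHeight := by rw [← add_mul, hab, one_mul]
  rcases h4 with h4 | h4 <;> nlinarith

theorem height_lt {k m : ZMod 5} {z : ℂ} (hz : z ∈ edge m) (h : z ∉ range zeta) (hk : k ≠ m) :
    height k z < edgeHeight := by
  refine lt_of_le_of_ne (height_le (edge_subset m hz) k) fun h1 => hk ?_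
  exact edge_unique (mem_edge_of_height (edge_subset m hz) h1.ge) hz h

theorem isCompact_pentagon : IsCompact pentagon := (finite_range zeta).isCompact_convexHull ℝ

theorem continuous_height (k : ZMod 5) : Continuous (height k) :=
  (height k).continuous_of_finiteDimensional

/-- The sign by which a pentagon of the given kind differs from the standard pentagon. -/
noncomputable def sg : Bool → ℂ
  | true => 1
  | false => -1

theorem sg_not (b : Bool) : sg (!b) = -sg b := by cases b <;> simp [sg]

theorem sg_mul_self (b : Bool) : sg b * sg b = 1 := by cases b <;> simp [sg]

theorem sg_mul_cancel (b : Bool) (z : ℂ) : sg b * (sg b * z) = z := by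
  rw [← mul_assoc, sg_mul_self, one_mul]

/-- A surface glued from translates of the pentagon and of its image under the point reflection,
where every edge is identified with the opposite parallel edge of another polygon. -/
class PentagonTiled (S : GluedSurface) where
  side : S.Piece → Bool
  nb : S.Piece → ZMod 5 → S.Piece
  side_nb : ∀ i m, side (nb i m) = !side i
  nb_nb : ∀ i m, nb (nb i m) m = i
  mem_poly : ∀ i z, z ∈ S.poly i ↔ sg (side i) * z ∈ pentagon
  mem_vertex : ∀ i z, z ∈ S.vertex i ↔ sg (side i) * z ∈ range zeta
  of_glue : ∀ {i z j w}, S.Glue i z j w →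
    ∃ m, sg (side i) * z ∈ edge m ∧ j = nb i m ∧ w = z - sg (side i) * edgeSum m
  glue_nb : ∀ {i z m}, sg (side i) * z ∈ edge m →
    S.Glue i z (nb i m) (z - sg (side i) * edgeSum m) ∨
      S.Glue (nb i m) (z - sg (side i) * edgeSum m) i z

theorem eqOn_of_locally_eq {α : Type*} {A : Set ℝ} (hA : IsPreconnected A) {f : ℝ → α}
    (h : ∀ t ∈ A, ∃ ε > 0, ∀ s ∈ A, |s - t| < ε → f s = f t) {a b : ℝ} (ha : a ∈ A) (hb : b ∈ A) :
    f a = f b := by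
  let _ : TopologicalSpace α := ⊥
  have : DiscreteTopology α := ⟨rfl⟩
  refine hA.constant (f := f) (fun t ht => ?_) ha hb
  obtain ⟨ε, hε, h1⟩ := h t ht
  refine tendsto_const_nhds.congr' ?_
  filter_upwards [self_mem_nhdsWithin,
    mem_nhdsWithin_of_mem_nhds (Metric.ball_mem_nhds t hε)] with s hs hs'
  exact (h1 s hs hs').symm

namespace GluedSurface

open PentagonTiled

section Runs

variable {S : GluedSurface} {u : ℂ} {γ γ' : ℝ → S.Point} {t : ℝ} {A B J J' : Set ℝ}

theorem exists_rep (x : S.Point) : ∃ (i : S.Piece) (z : ℂ) (h : z ∈ S.poly i),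
    x = S.toPoint i z h := by
  obtain ⟨⟨⟨i, z⟩, h⟩, rfl⟩ := Quot.exists_rep x
  exact ⟨i, z, h, rfl⟩

theorem toPoint_congr {i : S.Piece} {z w : ℂ} (h : z = w) (hz : z ∈ S.poly i) :
    S.toPoint i z hz = S.toPoint i w (h ▸ hz) := by subst h; rfl

theorem RunsStraight.mono (h : S.RunsStraight u γ t A) (hBA : B ⊆ A) :
    S.RunsStraight u γ t B := by
  obtain ⟨i, z, h⟩ := h
  exact ⟨i, z, fun s hs => h s (hBA hs)⟩

theorem RunsStraight.congr (h : S.RunsStraight u γ t A) (he : ∀ s ∈ A, γ' (t + s) = γ (t + s)) :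
    S.RunsStraight u γ' t A := by
  obtain ⟨i, z, h⟩ := h
  refine ⟨i, z, fun s hs => ?_⟩
  obtain ⟨h1, h2⟩ := h s hs
  exact ⟨h1, (he s hs).trans h2⟩

theorem RunsStraight.shift (h : S.RunsStraight u γ t A) (s : ℝ) (hB : ∀ r ∈ B, s + r ∈ A) :
    S.RunsStraight u γ (t + s) B := by
  obtain ⟨i, z, h⟩ := h
  refine ⟨i, z + s * u, fun r hr => ?_⟩
  obtain ⟨h1, h2⟩ := h _ (hB r hr)
  have e : z + ((s + r : ℝ) : ℂ) * u = z + s * u + r * u := by push_cast; ring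
  refine ⟨e ▸ h1, ?_⟩
  rw [add_assoc, h2, toPoint_congr e]

theorem IsStraightOn.mono (h : S.IsStraightOn u γ J) (hJ : J' ⊆ J) : S.IsStraightOn u γ J' :=
  fun t ht => h t (hJ ht)

theorem IsStraightOn.congr (h : S.IsStraightOn u γ J) (hJ : IsOpen J) (he : EqOn γ' γ J) :
    S.IsStraightOn u γ' J := by
  intro t ht
  obtain ⟨h0, ε, hε, h1, h2⟩ := h t ht
  obtain ⟨δ, hδ, hb⟩ := Metric.isOpen_iff.1 hJ t ht
  refine ⟨he ht ▸ h0, min ε (δ / 2), by positivity, ?_, ?_⟩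
  · refine (h1.mono (Icc_subset_Icc (neg_le_neg (min_le_left _ _)) le_rfl)).congr fun s hs => ?_
    refine he (hb ?_)
    have := min_le_right ε (δ / 2)
    rw [Metric.mem_ball, Real.dist_eq, add_sub_cancel_left, abs_lt]
    constructor <;> linarith [hs.1, hs.2]
  · refine (h2.mono (Icc_subset_Icc le_rfl (min_le_left _ _))).congr fun s hs => ?_
    refine he (hb ?_)
    have := min_le_right ε (δ / 2)
    rw [Metric.mem_ball, Real.dist_eq, add_sub_cancel_left, abs_lt]
    constructor <;> linarith [hs.1, hs.2]

theorem IsStraightOn.union (h : S.IsStraightOn u γ J) (h' : S.IsStraightOn u γ J') :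
    S.IsStraightOn u γ (J ∪ J') := fun t ht => ht.elim (h t) (h' t)

theorem IsStraightOn.comp_add (h : S.IsStraightOn u γ J) (a : ℝ) :
    S.IsStraightOn u (fun t => γ (t + a)) {t | t + a ∈ J} := by
  intro t ht
  obtain ⟨h0, ε, hε, ⟨i, z, h1⟩, ⟨j, w, h2⟩⟩ := h (t + a) ht
  refine ⟨h0, ε, hε, ⟨i, z, fun s hs => ?_⟩, ⟨j, w, fun s hs => ?_⟩⟩
  · have := h1 s hs
    rwa [add_right_comm] at this
  · have := h2 s hs
    rwa [add_right_comm] at this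

theorem IsStraightOn.comp_sub (h : S.IsStraightOn u γ J) (a : ℝ) :
    S.IsStraightOn (-u) (fun t => γ (a - t)) {t | a - t ∈ J} := by
  intro t ht
  obtain ⟨h0, ε, hε, ⟨i, z, h1⟩, ⟨j, w, h2⟩⟩ := h (a - t) ht
  refine ⟨h0, ε, hε, ⟨j, w, fun s hs => ?_⟩, ⟨i, z, fun s hs => ?_⟩⟩
  · have := h2 (-s) ⟨by linarith [hs.2], by linarith [hs.1]⟩
    rwa [Complex.ofReal_neg, neg_mul, ← mul_neg, ← sub_eq_add_neg, sub_sub] at this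
  · have := h1 (-s) ⟨by linarith [hs.2], by linarith [hs.1]⟩
    rwa [Complex.ofReal_neg, neg_mul, ← mul_neg, ← sub_eq_add_neg, sub_sub] at this

theorem isStraightOn_of_runs {ε : ℝ} (h1 : S.RunsStraight u γ t (Icc (-ε) 0))
    (h2 : S.RunsStraight u γ t (Icc 0 ε)) (hn : ∀ s ∈ Ioo (t - ε) (t + ε), γ s ∉ S.singular) :
    S.IsStraightOn u γ (Ioo (t - ε) (t + ε)) := by
  intro r hr
  obtain ⟨s, rfl⟩ : ∃ s, r = t + s := ⟨r - t, by ring⟩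
  have hs1 : -ε < s := by linarith [hr.1]
  have hs2 : s < ε := by linarith [hr.2]
  refine ⟨hn _ hr, ?_⟩
  rcases lt_trichotomy s 0 with h | rfl | h
  · have hm : 0 < min (-s) (ε + s) := lt_min (by linarith) (by linarith)
    have ha := min_le_left (-s) (ε + s)
    have hb := min_le_right (-s) (ε + s)
    refine ⟨_, hm, h1.shift s fun r hr => ?_, h1.shift s fun r hr => ?_⟩ <;>
      constructor <;> linarith [hr.1, hr.2]
  · rw [add_zero]
    exact ⟨ε, by linarith, h1, h2⟩
  · have hm : 0 < min s (ε - s) := lt_min h (by linarith)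
    have ha := min_le_left s (ε - s)
    have hb := min_le_right s (ε - s)
    refine ⟨_, hm, h2.shift s fun r hr => ?_, h2.shift s fun r hr => ?_⟩ <;>
      constructor <;> linarith [hr.1, hr.2]

end Runs

section Tiled

variable {S : GluedSurface} [PentagonTiled S]

/-- The boundary point `z` of the polygon `i` is identified with the boundary point `w` of the
neighbour `j`. -/
def Adj (i : S.Piece) (z : ℂ) (j : S.Piece) (w : ℂ) : Prop :=
  ∃ m, sg (side i) * z ∈ edge m ∧ j = nb i m ∧ w = z - sg (side i) * edgeSum m

theorem sg_nb_mul (i : S.Piece) (m : ZMod 5) (z : ℂ) :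
    sg (side (nb i m)) * (z - sg (side i) * edgeSum m) = edgeSum m - sg (side i) * z := by
  rw [side_nb, sg_not]
  linear_combination edgeSum m * sg_mul_self (side i)

variable {i j k : S.Piece} {z w y : ℂ}

theorem Adj.symm (h : Adj i z j w) : Adj j w i z := by
  obtain ⟨m, h1, rfl, rfl⟩ := h
  refine ⟨m, ?_, (nb_nb i m).symm, ?_⟩
  · rw [sg_nb_mul]
    exact edgeSum_sub_mem h1
  · rw [side_nb, sg_not]
    ring

theorem Adj.side_eq (h : Adj i z j w) : side j = !side i := by
  obtain ⟨m, h1, rfl, rfl⟩ := h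
  exact side_nb i m

theorem Adj.mem_vertex (h : Adj i z j w) (hz : z ∈ S.vertex i) : w ∈ S.vertex j := by
  obtain ⟨m, h1, rfl, rfl⟩ := h
  rw [PentagonTiled.mem_vertex, sg_nb_mul]
  exact edgeSum_sub_vertex h1 ((PentagonTiled.mem_vertex i z).1 hz)

theorem Adj.trans_eq (h : Adj i z j w) (h' : Adj j w k y) (hz : z ∉ S.vertex i) :
    i = k ∧ z = y := by
  have hw : w ∉ S.vertex j := fun hw => hz (h.symm.mem_vertex hw)
  obtain ⟨m, h1, rfl, rfl⟩ := h.symm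
  obtain ⟨n, h2, rfl, rfl⟩ := h'
  rw [PentagonTiled.mem_vertex] at hw
  rw [edge_unique h1 h2 hw]
  exact ⟨rfl, rfl⟩

theorem Adj.toPoint_eq (h : Adj i z j w) (hz : z ∈ S.poly i) (hw : w ∈ S.poly j) :
    S.toPoint i z hz = S.toPoint j w hw := by
  obtain ⟨m, h1, rfl, rfl⟩ := h
  rcases glue_nb h1 with h2 | h2
  · exact Quot.sound h2
  · exact (Quot.sound h2).symm

theorem mem_poly_of_nb {m : ZMod 5} (h : sg (side i) * z ∈ edge m) :
    z - sg (side i) * edgeSum m ∈ S.poly (nb i m) := by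
  rw [mem_poly, sg_nb_mul]
  exact edge_subset m (edgeSum_sub_mem h)

theorem toPoint_nb_eq {m : ZMod 5} (hz : z ∈ S.poly i)
    (hw : z - sg (side i) * edgeSum m ∈ S.poly (nb i m)) :
    S.toPoint i z hz = S.toPoint (nb i m) (z - sg (side i) * edgeSum m) hw := by
  have h1 := (mem_poly _ _).1 hz
  have h2 := (mem_poly _ _).1 hw
  rw [sg_nb_mul] at h2
  exact Adj.toPoint_eq ⟨m, mem_edge_of_sub_mem h1 h2, rfl, rfl⟩ hz hw

theorem toPoint_eq_cases' {x y : S.Pre}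
    (h : Relation.EqvGen (fun x y : S.Pre => S.Glue x.1.1 x.1.2 y.1.1 y.1.2) x y) :
    (x.1.1 = y.1.1 ∧ x.1.2 = y.1.2) ∨ Adj x.1.1 x.1.2 y.1.1 y.1.2 ∨
      (x.1.2 ∈ S.vertex x.1.1 ∧ y.1.2 ∈ S.vertex y.1.1) := by
  induction h with
  | rel x y h => exact Or.inr (Or.inl (of_glue h))
  | refl x => exact Or.inl ⟨rfl, rfl⟩
  | symm x y _ h =>
    rcases h with h | h | h
    · exact Or.inl ⟨h.1.symm, h.2.symm⟩
    · exact Or.inr (Or.inl h.symm)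
    · exact Or.inr (Or.inr h.symm)
  | trans x y z _ _ h h' =>
    obtain ⟨⟨i, a⟩, ha⟩ := x
    obtain ⟨⟨j, b⟩, hb⟩ := y
    obtain ⟨⟨k, c⟩, hc⟩ := z
    dsimp only at h h' ⊢
    rcases h with ⟨rfl, rfl⟩ | h | h
    · exact h'
    · rcases h' with ⟨rfl, rfl⟩ | h' | h'
      · exact Or.inr (Or.inl h)
      · by_cases hv : a ∈ S.vertex i
        · exact Or.inr (Or.inr ⟨hv, h'.mem_vertex (h.mem_vertex hv)⟩)
        · exact Or.inl (h.trans_eq h' hv)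
      · exact Or.inr (Or.inr ⟨h.symm.mem_vertex h'.1, h'.2⟩)
    · rcases h' with ⟨rfl, rfl⟩ | h' | h'
      · exact Or.inr (Or.inr h)
      · exact Or.inr (Or.inr ⟨h.1, h'.mem_vertex h.2⟩)
      · exact Or.inr (Or.inr ⟨h.1, h'.2⟩)

theorem toPoint_not_mem_singular_iff (hz : z ∈ S.poly i) :
    S.toPoint i z hz ∉ S.singular ↔ z ∉ S.vertex i := by
  refine ⟨fun h h1 => h ⟨i, z, hz, h1, rfl⟩, fun h => ?_⟩
  rintro ⟨j, w, hw, h1, h2⟩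
  rcases toPoint_eq_cases' (Quot.eqvGen_exact h2) with ⟨h3, h4⟩ | h3 | h3
  · dsimp only at h3 h4
    subst h3 h4
    exact h h1
  · exact h (h3.symm.mem_vertex h1)
  · exact h h3.1

theorem toPoint_eq_cases {hz : z ∈ S.poly i} {hw : w ∈ S.poly j}
    (h : S.toPoint i z hz = S.toPoint j w hw) (hn : S.toPoint i z hz ∉ S.singular) :
    (i = j ∧ z = w) ∨ Adj i z j w := by
  rcases toPoint_eq_cases' (Quot.eqvGen_exact h) with h3 | h3 | h3
  · exact Or.inl h3
  · exact Or.inr h3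
  · exact absurd h3.1 ((toPoint_not_mem_singular_iff hz).1 hn)

theorem toPoint_add_eq {hz : z ∈ S.poly i} {hw : w ∈ S.poly j}
    (h : S.toPoint i z hz = S.toPoint j w hw) (hn : S.toPoint i z hz ∉ S.singular)
    (h1 : z + y ∈ S.poly i) (h2 : w + y ∈ S.poly j) :
    S.toPoint i (z + y) h1 = S.toPoint j (w + y) h2 := by
  rcases toPoint_eq_cases h hn with ⟨rfl, rfl⟩ | ⟨m, h3, rfl, rfl⟩
  · rfl
  · have e : z - sg (side i) * edgeSum m + y = z + y - sg (side i) * edgeSum m := by ring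
    rw [toPoint_congr e h2]
    exact toPoint_nb_eq h1 _

variable {u : ℂ} {γ γ' : ℝ → S.Point} {t : ℝ} {A J : Set ℝ}

theorem toPoint_line_eq {s r : ℝ} {hz : z + s * u ∈ S.poly i} {hw : w + s * u ∈ S.poly j}
    (h : S.toPoint i _ hz = S.toPoint j _ hw) (hn : S.toPoint i _ hz ∉ S.singular)
    (h1 : z + r * u ∈ S.poly i) (h2 : w + r * u ∈ S.poly j) :
    S.toPoint i (z + r * u) h1 = S.toPoint j (w + r * u) h2 := by
  have e1 : z + r * u = z + s * u + (r - s) * u := by ring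
  have e2 : w + r * u = w + s * u + (r - s) * u := by ring
  rw [toPoint_congr e1, toPoint_congr e2]
  exact toPoint_add_eq h hn _ _

theorem RunsStraight.eq (h : S.RunsStraight u γ t A) (h' : S.RunsStraight u γ' t A) {s r : ℝ}
    (hs : s ∈ A) (hr : r ∈ A) (he : γ (t + s) = γ' (t + s)) (hn : γ (t + s) ∉ S.singular) :
    γ (t + r) = γ' (t + r) := by
  obtain ⟨i, z, h⟩ := h
  obtain ⟨j, w, h'⟩ := h'
  obtain ⟨h1, h2⟩ := h s hs
  obtain ⟨h3, h4⟩ := h' s hs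
  obtain ⟨h5, h6⟩ := h r hr
  obtain ⟨h7, h8⟩ := h' r hr
  rw [h6, h8]
  exact toPoint_line_eq (h2.symm.trans (he.trans h4)) (h2 ▸ hn) h5 h7

theorem IsStraightOn.eqOn (h : S.IsStraightOn u γ J) (h' : S.IsStraightOn u γ' J)
    (hJ : IsPreconnected J) {a : ℝ} (ha : a ∈ J) (he : γ a = γ' a) : EqOn γ γ' J := by
  intro b hb
  refine (eqOn_of_locally_eq (f := fun s => γ s = γ' s) hJ (fun t ht => ?_) ha hb).mp he
  obtain ⟨h0, ε, hε, h1, h2⟩ := h t ht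
  obtain ⟨h0', ε', hε', h1', h2'⟩ := h' t ht
  refine ⟨min ε ε', lt_min hε hε', fun s hs hst => ?_⟩
  obtain ⟨r, rfl⟩ : ∃ r, s = t + r := ⟨s - t, by ring⟩
  rw [add_sub_cancel_left, abs_lt] at hst
  have ha := min_le_left ε ε'
  have hb := min_le_right ε ε'
  apply propext
  obtain ⟨B, hB, hr, hB1, hB2⟩ : ∃ B : Set ℝ, (0 : ℝ) ∈ B ∧ r ∈ B ∧ S.RunsStraight u γ t B ∧
      S.RunsStraight u γ' t B := by
    rcases le_total r 0 with hr | hr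
    · refine ⟨Icc (-min ε ε') 0, ⟨by linarith, le_rfl⟩, ⟨hst.1.le, hr⟩, h1.mono ?_, h1'.mono ?_⟩ <;>
        apply Icc_subset_Icc <;> linarith
    · refine ⟨Icc 0 (min ε ε'), ⟨le_rfl, by linarith⟩, ⟨hr, hst.2.le⟩, h2.mono ?_, h2'.mono ?_⟩ <;>
        apply Icc_subset_Icc <;> linarith
  constructor
  · intro he
    have := hB1.eq hB2 hr hB he (h _ hs).1
    rwa [add_zero] at this
  · intro he
    refine hB1.eq hB2 hB hr ?_ ?_ <;> rwa [add_zero]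

theorem IsStraightOn.eq_toPoint (h : S.IsStraightOn u γ J) (hA : IsPreconnected A)
    (hJ : ∀ s ∈ A, t + s ∈ J) (hp : ∀ s ∈ A, z + s * u ∈ S.poly i) {a : ℝ} (ha : a ∈ A)
    (he : γ (t + a) = S.toPoint i _ (hp a ha)) {b : ℝ} (hb : b ∈ A) :
    γ (t + b) = S.toPoint i _ (hp b hb) := by
  have key := eqOn_of_locally_eq
    (f := fun s => ∃ h : z + s * u ∈ S.poly i, γ (t + s) = S.toPoint i _ h) hA ?_ ha hb
  · obtain ⟨h1, h2⟩ := key.mp ⟨_, he⟩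
    exact h2
  intro s hs
  obtain ⟨h0, ε, hε, h1, h2⟩ := h (t + s) (hJ s hs)
  refine ⟨ε, hε, fun s' hs' hss => ?_⟩
  obtain ⟨r, rfl⟩ : ∃ r, s' = s + r := ⟨s' - s, by ring⟩
  rw [add_sub_cancel_left, abs_lt] at hss
  obtain ⟨B, hB, hr, j, w, hB1⟩ : ∃ B : Set ℝ, (0 : ℝ) ∈ B ∧ r ∈ B ∧
      S.RunsStraight u γ (t + s) B := by
    rcases le_total r 0 with hr | hr
    · exact ⟨Icc (-ε) 0, ⟨by linarith, le_rfl⟩, ⟨hss.1.le, hr⟩, h1⟩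
    · exact ⟨Icc 0 ε, ⟨le_rfl, by linarith⟩, ⟨hr, hss.2.le⟩, h2⟩
  have e0 : t + s + 0 = t + s := by ring
  have er : t + s + r = t + (s + r) := by ring
  obtain ⟨m1, m2⟩ := hB1 0 hB
  obtain ⟨m3, m4⟩ := hB1 r hr
  rw [e0] at m2
  rw [er] at m4
  have f0 : z + s * u = z + s * u + (0 : ℝ) * u := by simp
  have fr : z + (s + r : ℝ) * u = z + s * u + r * u := by push_cast; ring
  apply propext
  constructor
  · rintro ⟨h3, h4⟩
    refine ⟨hp s hs, ?_⟩
    rw [m2, toPoint_congr f0]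
    rw [m4, toPoint_congr fr] at h4
    refine toPoint_line_eq h4 ?_ _ _
    rw [← m4]
    exact (h _ (hJ _ hs')).1
  · rintro ⟨h3, h4⟩
    refine ⟨hp _ hs', ?_⟩
    rw [m4, toPoint_congr fr]
    rw [m2, toPoint_congr f0] at h4
    refine toPoint_line_eq h4 ?_ _ _
    rw [← m2]
    exact h0

end Tiled

end GluedSurface

theorem mul_conj_edgeSum (m : ZMod 5) :
    (zeta (m + 1) - zeta m) * (starRingEnd ℂ) (edgeSum m) = 2 * (zeta 1).im * I := by
  rw [edgeSum, map_add, conj_zeta, conj_zeta]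
  have h1 : zeta (m + 1) = zeta m * zeta 1 := zeta_add m 1
  have h2 : zeta (-(m + 1)) = zeta (-m) * zeta (-1) := by rw [← zeta_add]; ring_nf
  have h3 := zeta_mul_zeta_neg m
  have h4 := zeta_mul_zeta_neg 1
  have h5 : zeta 1 - zeta (-1) = 2 * (zeta 1).im * I := by
    rw [← conj_zeta, Complex.sub_conj]
    push_cast
    ring
  rw [h1, h2, ← h5]
  linear_combination (zeta 1 - zeta (-1) - 1 + zeta 1 * zeta (-1)) * h3 + h4

theorem eq_smul_of_height_eq_zero {m : ZMod 5} {u : ℂ} (h : height m u = 0) :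
    ∃ r : ℝ, u = r * (zeta (m + 1) - zeta m) := by
  have hs := zeta_one_im_pos
  refine ⟨(u * (starRingEnd ℂ) (edgeSum m)).im / (2 * (zeta 1).im), ?_⟩
  have h0 : (starRingEnd ℂ) (edgeSum m) ≠ 0 := (map_ne_zero _).2 (edgeSum_ne_zero m)
  apply mul_right_cancel₀ h0
  rw [mul_assoc, mul_conj_edgeSum]
  have hs' : ((zeta 1).im : ℂ) ≠ 0 := by exact_mod_cast hs.ne'
  rw [height_apply] at h
  conv_lhs => rw [← Complex.re_add_im (u * (starRingEnd ℂ) (edgeSum m)), h]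
  push_cast
  field_simp
  simp

theorem height_edge_direction (m : ZMod 5) (c : ℝ) :
    height m (c * (zeta (m + 1) - zeta m)) = 0 := by
  rw [← Complex.real_smul, map_smul, map_sub, height_zeta_self, height_zeta_succ, sub_self,
    smul_zero]

theorem height_sg (b : Bool) (m : ZMod 5) (u : ℂ) : height m (sg b * u) = 0 ↔ height m u = 0 := by
  cases b <;> simp [sg]

namespace GluedSurface

open PentagonTiled

variable {S : GluedSurface} [PentagonTiled S] {i j k : S.Piece} {z w y : ℂ}
  {u : ℂ} {γ γ' : ℝ → S.Point} {t : ℝ} {A J : Set ℝ}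

theorem convex_poly (i : S.Piece) : Convex ℝ (S.poly i) := by
  have : S.poly i = LinearMap.mulLeft ℝ (sg (side i)) ⁻¹' pentagon := by
    ext z
    exact mem_poly i z
  rw [this]
  exact (convex_convexHull ℝ _).linear_preimage _

theorem convex_line_poly (i : S.Piece) (z u : ℂ) : Convex ℝ {s : ℝ | z + s * u ∈ S.poly i} := by
  have h := (convex_poly i).affine_preimage (AffineMap.lineMap (k := ℝ) z (z + u))
  have e : {s : ℝ | z + s * u ∈ S.poly i} = AffineMap.lineMap (k := ℝ) z (z + u) ⁻¹' S.poly i := by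
    ext s
    rw [mem_preimage, AffineMap.lineMap_apply]
    simp [add_comm]
  rwa [e]

theorem IsStraightOn.eq_toPoint_of_mem (h : S.IsStraightOn u γ univ) {hz : z ∈ S.poly i}
    (he : γ t = S.toPoint i z hz) {s : ℝ} (hs : z + s * u ∈ S.poly i) :
    γ (t + s) = S.toPoint i (z + s * u) hs := by
  have h0 : z = z + (0 : ℝ) * u := by simp
  refine h.eq_toPoint (A := {s : ℝ | z + s * u ∈ S.poly i}) (convex_line_poly i z u).isPreconnected
    (fun _ _ => mem_univ _) (fun _ h => h) (a := 0) ?_ ?_ hs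
  · change z + (0 : ℝ) * u ∈ S.poly i
    rwa [← h0]
  · rw [add_zero, he, toPoint_congr h0]

theorem IsStraightOn.not_mem_vertex (h : S.IsStraightOn u γ univ) {hz : z ∈ S.poly i}
    (he : γ t = S.toPoint i z hz) {s : ℝ} (hs : z + s * u ∈ S.poly i) :
    z + s * u ∉ S.vertex i := by
  rw [← toPoint_not_mem_singular_iff hs, ← h.eq_toPoint_of_mem he hs]
  exact (h _ (mem_univ _)).1

theorem IsStraightOn.height_ne_zero (h : S.IsStraightOn u γ univ) (hu : u ≠ 0) {hz : z ∈ S.poly i}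
    (he : γ t = S.toPoint i z hz) {m : ZMod 5} (hm : sg (side i) * z ∈ edge m) :
    height m u ≠ 0 := by
  intro h0
  rw [← height_sg (side i)] at h0
  obtain ⟨r, hr⟩ := eq_smul_of_height_eq_zero h0
  have hr0 : (r : ℂ) ≠ 0 := by
    intro h1
    rw [h1, zero_mul] at hr
    have := congrArg (fun x => sg (side i) * x) hr
    simp only [sg_mul_cancel, mul_zero] at this
    exact hu this
  obtain ⟨a, b, ha, hb, hab, h2⟩ := hm
  have hab' : (a : ℂ) + b = 1 := by exact_mod_cast hab
  have e : sg (side i) * (z + (-b / r : ℝ) * u) = zeta m := by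
    have : sg (side i) * (z + (-b / r : ℝ) * u) = sg (side i) * z + (-b / r : ℝ) *
      (sg (side i) * u) := by ring
    rw [this, ← h2, hr, Complex.real_smul, Complex.real_smul]
    push_cast
    field_simp
    linear_combination zeta m * hab'
  refine h.not_mem_vertex he (s := -b / r) ?_ ?_
  · rw [mem_poly, e]
    exact zeta_mem_pentagon m
  · rw [mem_vertex, e]
    exact mem_range_self m

theorem IsStraightOn.exists_not_mem_edge (h : S.IsStraightOn u γ univ) (hu : u ≠ 0) :
    ∃ (t : ℝ) (i : S.Piece) (z : ℂ) (hz : z ∈ S.poly i), γ t = S.toPoint i z hz ∧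
      ∀ m, sg (side i) * z ∉ edge m := by
  by_contra! hcon
  obtain ⟨-, ε, hε, -, i, z, hr⟩ := h 0 (mem_univ _)
  have key : ∀ s : Icc 0 ε, ∃ m, sg (side i) * (z + s.1 * u) ∈ edge m := fun s => by
    obtain ⟨h1, h2⟩ := hr s.1 s.2
    exact hcon _ _ _ h1 h2
  choose f hf using key
  have : Infinite (Icc (0 : ℝ) ε) := (Icc_infinite hε).to_subtype
  obtain ⟨s, r, hsr, he⟩ := Finite.exists_ne_map_eq_of_infinite f
  obtain ⟨h1, h2⟩ := hr s.1 s.2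
  refine h.height_ne_zero hu h2 (hf s) ?_
  have h3 := height_edge (hf s)
  have h4 := height_edge (hf r)
  rw [← he] at h4
  have h5 : sg (side i) * (z + s.1 * u) - sg (side i) * (z + r.1 * u) =
      ((s.1 - r.1 : ℝ) : ℂ) * (sg (side i) * u) := by push_cast; ring
  have h6 := congrArg (height (f s)) h5
  rw [map_sub, h3, h4, sub_self, ← Complex.real_smul, map_smul, smul_eq_mul, eq_comm,
    mul_eq_zero, height_sg] at h6
  exact h6.resolve_left (sub_ne_zero.2 fun h => hsr (Subtype.ext h))

theorem IsStraightOn.map {S S' : GluedSurface} {u : ℂ} {γ : ℝ → S.Point} {J : Set ℝ}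
    (h : S.IsStraightOn u γ J) {f : S.Point → S'.Point} {φ : S.Piece → S'.Piece}
    {L : ℂ →ₗ[ℝ] ℂ} (hf : ∀ i z hz, ∃ h', f (S.toPoint i z hz) = S'.toPoint (φ i) (L z) h')
    (hs : ∀ x, x ∉ S.singular → f x ∉ S'.singular) :
    S'.IsStraightOn (L u) (f ∘ γ) J := by
  have key : ∀ t A, S.RunsStraight u γ t A → S'.RunsStraight (L u) (f ∘ γ) t A := by
    rintro t A ⟨i, z, h⟩
    refine ⟨φ i, L z, fun s hs => ?_⟩
    obtain ⟨h1, h2⟩ := h s hs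
    obtain ⟨h3, h4⟩ := hf _ _ h1
    have e : L z + s * L u = L (z + s * u) := by
      rw [map_add, ← Complex.real_smul, ← Complex.real_smul, map_smul]
    refine ⟨e ▸ h3, ?_⟩
    rw [Function.comp_apply, h2, h4, toPoint_congr e]
  intro t ht
  obtain ⟨h0, ε, hε, h1, h2⟩ := h t ht
  exact ⟨hs _ h0, ε, hε, key _ _ h1, key _ _ h2⟩

/-- A map of the polygons that respects the neighbours, and preserves the two kinds of pentagons or
exchanges them. -/
structure TileMap (S S' : GluedSurface) [PentagonTiled S] [PentagonTiled S'] where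
  piece : S.Piece → S'.Piece
  kind : Bool
  sg_piece : ∀ i, sg (side (piece i)) = sg kind * sg (side i)
  piece_nb : ∀ i m, piece (nb i m) = nb (piece i) m

namespace TileMap

variable {S' : GluedSurface} [PentagonTiled S'] (f : TileMap S S')

theorem sg_mul (i : S.Piece) (z : ℂ) :
    sg (side (f.piece i)) * (sg f.kind * z) = sg (side i) * z := by
  rw [f.sg_piece]
  linear_combination sg (side i) * z * sg_mul_self f.kind

theorem mem_poly {i : S.Piece} {z : ℂ} (hz : z ∈ S.poly i) :
    sg f.kind * z ∈ S'.poly (f.piece i) := by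
  rw [PentagonTiled.mem_poly, f.sg_mul]
  exact (PentagonTiled.mem_poly i z).1 hz

/-- The map of surfaces given by a map of the polygons. -/
noncomputable def map : S.Point → S'.Point :=
  Quot.lift (fun x => S'.toPoint (f.piece x.1.1) (sg f.kind * x.1.2) (f.mem_poly x.2)) (by
    rintro ⟨⟨i, z⟩, hz⟩ ⟨⟨j, w⟩, hw⟩ h
    obtain ⟨m, h1, h2, h3⟩ := of_glue h
    dsimp only at h1 h2 h3 ⊢
    subst h2 h3
    refine Adj.toPoint_eq ⟨m, ?_, f.piece_nb i m, ?_⟩ _ _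
    · rwa [f.sg_mul]
    · rw [f.sg_piece]
      ring)

theorem map_toPoint {i : S.Piece} {z : ℂ} (hz : z ∈ S.poly i) :
    f.map (S.toPoint i z hz) = S'.toPoint (f.piece i) (sg f.kind * z) (f.mem_poly hz) := rfl

theorem map_not_mem_singular {x : S.Point} (hx : x ∉ S.singular) : f.map x ∉ S'.singular := by
  obtain ⟨i, z, hz, rfl⟩ := exists_rep x
  rw [toPoint_not_mem_singular_iff, mem_vertex] at hx
  rwa [map_toPoint, toPoint_not_mem_singular_iff, mem_vertex, f.sg_mul]

theorem map_isStraightOn (h : S.IsStraightOn u γ J) :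
    S'.IsStraightOn (sg f.kind * u) (f.map ∘ γ) J :=
  h.map (φ := f.piece) (L := LinearMap.mulLeft ℝ (sg f.kind))
    (fun _ _ hz => ⟨_, f.map_toPoint hz⟩) fun _ => f.map_not_mem_singular

end TileMap

end GluedSurface

open GluedSurface PentagonTiled DihedralGroup

theorem edgeSum_eq (k : ZMod 5) : zeta k + zeta (k + 1) = edgeSum k := rfl

noncomputable instance : PentagonTiled doublePentagon where
  side i := i
  nb i _ := !i
  side_nb _ _ := rfl
  nb_nb i _ := Bool.not_not i
  mem_poly i z := by cases i <;> simp [doublePentagon, sg]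
  mem_vertex i z := by cases i <;> simp [doublePentagon, sg]
  of_glue := by
    rintro i z j w ⟨hi, hj, k, h1, h2⟩
    have hi' : i = true := hi
    have hj' : j = false := hj
    subst hi' hj' h2
    exact ⟨k, by simpa [sg] using h1, rfl, by rw [sg, one_mul]; rfl⟩
  glue_nb := by
    rintro i z m h
    have : i = true ∨ i = false := by cases i; exacts [Or.inr rfl, Or.inl rfl]
    rcases this with rfl | rfl
    · left
      exact ⟨rfl, rfl, m, by simpa [sg] using h, by rw [sg, one_mul]; rfl⟩
    · right
      refine ⟨rfl, rfl, m, ?_, ?_⟩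
      · convert edgeSum_sub_mem h using 1
        simp only [sg]
        ring
      · rw [edgeSum_eq]
        simp only [sg]
        ring

theorem act_one (z : ℂ) : act 1 z = z := by
  change zeta 0 * z = z
  rw [zeta_zero, one_mul]

theorem act_act_inv (g : DihedralGroup 5) (z : ℂ) : act g (act g⁻¹ z) = z := by
  rw [← act_mul, mul_inv_cancel, act_one]

theorem act_smul_add (g : DihedralGroup 5) (z u : ℂ) (s : ℝ) :
    act g (z + s * u) = act g z + s * act g u := by
  have := (actLin g).map_add z (s • u)
  rw [map_smul, Complex.real_smul, Complex.real_smul] at this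
  exact this

theorem act_sg_mul (g : DihedralGroup 5) (b : Bool) (z : ℂ) : act g (sg b * z) = sg b * act g z := by
  rcases g with a | a <;> cases b <;> simp [act, sg]

theorem sheet_inv (g : DihedralGroup 5) : sheet g⁻¹ = sheet g := by cases g <;> rfl

theorem act_mem_pentagon_iff (g : DihedralGroup 5) (x : ℂ) :
    sg (sheet g) * act g x ∈ pentagon ↔ x ∈ pentagon := by
  have h1 : ∀ g : DihedralGroup 5, ∀ x ∈ pentagon, sg (sheet g) * act g x ∈ pentagon := by
    intro g x hx
    exact (mem_poly (S := doublePentagon) (sheet g) _).1 (act_mem_poly g hx)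
  refine ⟨fun h => ?_, h1 g x⟩
  have h2 := h1 g⁻¹ _ h
  rwa [act_sg_mul, sheet_inv, sg_mul_cancel, act_inv_act] at h2

/-- The edge of a pentagon in the necklace, named after the parallel edge of the pentagon. -/
def namedEdge : DihedralGroup 5 → ZMod 5 → ZMod 5
  | .r a, k => k + a
  | .sr b, k => -k - b - 1

theorem act_mem_edge {g : DihedralGroup 5} {k : ZMod 5} {x : ℂ} (hx : x ∈ edge k) :
    sg (sheet g) * act g x ∈ edge (namedEdge g k) := by
  rcases g with a | b
  · rw [sheet, sg, one_mul]
    exact act_r_edge a hx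
  · obtain ⟨s, t, hs, ht, hst, rfl⟩ := hx
    refine ⟨t, s, ht, hs, by linarith, ?_⟩
    have h1 := act_smul_add (.sr b) (s * zeta k) (zeta (k + 1)) t
    have h2 := act_smul_add (.sr b) 0 (zeta k) s
    rw [zero_add, show act (.sr b) 0 = 0 by simp [act], zero_add] at h2
    simp only [Complex.real_smul, namedEdge, sheet, sg]
    rw [h1, h2, act_sr_vertex, act_sr_vertex]
    have e1 : -k - b - 1 + 1 = -k - b := by ring
    have e2 : -(k + 1) - b = -k - b - 1 := by ring
    rw [e1, e2]
    ring

theorem act_edgeSum (g : DihedralGroup 5) (k : ZMod 5) :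
    sg (sheet g) * act g (edgeSum k) = edgeSum (namedEdge g k) := by
  have h := act_smul_add g (zeta k) (zeta (k + 1)) 1
  rw [Complex.ofReal_one, one_mul, one_mul] at h
  rw [edgeSum, h, edgeSum]
  rcases g with a | b
  · rw [act_r_vertex, act_r_vertex]
    simp only [namedEdge, sheet, sg, one_mul]
    congr 2
    ring
  · rw [act_sr_vertex, act_sr_vertex]
    simp only [namedEdge, sheet, sg]
    have e1 : -k - b - 1 + 1 = -k - b := by ring
    have e2 : -(k + 1) - b = -k - b - 1 := by ring
    rw [e1, e2]
    ring

/-- The neighbours of the pentagons of the necklace. -/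
def necklaceNb : DihedralGroup 5 → ZMod 5 → DihedralGroup 5
  | .r a, m => .sr (a - (2 * m + 1))
  | .sr b, m => .r (b + (2 * m + 1))

theorem mul_edgeRefl (g : DihedralGroup 5) (k : ZMod 5) :
    g * edgeRefl k = necklaceNb g (namedEdge g k) := by
  rcases g with a | b
  · rw [edgeRefl, r_mul_sr, namedEdge, necklaceNb]
    congr 1
    ring
  · rw [edgeRefl, sr_mul_sr, namedEdge, necklaceNb]
    congr 1
    have h5 : (5 : ZMod 5) = 0 := rfl
    linear_combination 0 * h5

theorem namedEdge_surjective (g : DihedralGroup 5) (m : ZMod 5) : ∃ k, namedEdge g k = m := by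
  rcases g with a | b
  · exact ⟨m - a, by rw [namedEdge]; ring⟩
  · exact ⟨-m - b - 1, by rw [namedEdge]; ring⟩

theorem sheet_nb (g : DihedralGroup 5) (m : ZMod 5) : sheet (necklaceNb g m) = !sheet g := by
  cases g <;> rfl

theorem act_mul_edgeRefl {g : DihedralGroup 5} {k : ZMod 5} {x : ℂ} (hx : x ∈ edge k) :
    act (g * edgeRefl k) x = act g x - sg (sheet g) * edgeSum (namedEdge g k) := by
  rw [act_mul, act_edgeRefl hx, ← act_edgeSum, sg_mul_cancel, edgeSum_eq]
  have := act_smul_add g x (edgeSum k) (-1)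
  simp only [Complex.ofReal_neg, Complex.ofReal_one, neg_one_mul] at this
  rw [sub_eq_add_neg, this, sub_eq_add_neg]

theorem exists_of_mem_edge {g : DihedralGroup 5} {m : ZMod 5} {z : ℂ}
    (h : sg (sheet g) * z ∈ edge m) : ∃ k, namedEdge g k = m ∧ act g⁻¹ z ∈ edge k := by
  obtain ⟨k, rfl⟩ := namedEdge_surjective g m
  refine ⟨k, rfl, ?_⟩
  have h1 := act_mem_edge (g := g⁻¹) h
  have h5 : namedEdge g⁻¹ (namedEdge g k) = k := by
    rcases g with a | b
    · rw [inv_r, namedEdge, namedEdge]; ring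
    · rw [inv_sr, namedEdge, namedEdge]; ring
  rwa [act_sg_mul, sheet_inv, sg_mul_cancel, h5] at h1

theorem mem_necklace_poly (g : DihedralGroup 5) (z : ℂ) :
    z ∈ act g '' pentagon ↔ sg (sheet g) * z ∈ pentagon := by
  constructor
  · rintro ⟨x, hx, rfl⟩
    exact (act_mem_pentagon_iff g x).2 hx
  · intro h
    rw [← act_act_inv g z, act_mem_pentagon_iff] at h
    exact ⟨_, h, act_act_inv g z⟩

theorem mem_necklace_vertex (g : DihedralGroup 5) (z : ℂ) :
    z ∈ act g '' range zeta ↔ sg (sheet g) * z ∈ range zeta := by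
  have key : ∀ g : DihedralGroup 5, ∀ k, ∃ j, zeta j = sg (sheet g) * act g (zeta k) := by
    rintro (a | b) k
    · exact ⟨k + a, by rw [act_r_vertex, sheet, sg, one_mul]⟩
    · exact ⟨-k - b, by rw [act_sr_vertex, sheet, sg, neg_one_mul, neg_neg]⟩
  constructor
  · rintro ⟨_, ⟨k, rfl⟩, rfl⟩
    exact key g k
  · rintro ⟨k, hk⟩
    obtain ⟨j, hj⟩ := key g⁻¹ k
    refine ⟨_, ⟨j, rfl⟩, ?_⟩
    rw [hj, hk, act_sg_mul, sheet_inv, act_sg_mul, act_sg_mul, act_act_inv, sg_mul_cancel]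

theorem necklaceNb_necklaceNb (g : DihedralGroup 5) (m : ZMod 5) :
    necklaceNb (necklaceNb g m) m = g := by
  rcases g with a | b
  · rw [necklaceNb, necklaceNb, sub_add_cancel]
  · rw [necklaceNb, necklaceNb, add_sub_cancel_right]

theorem of_necklace_glue {g h : DihedralGroup 5} {z w : ℂ} (H : necklace.Glue g z h w) :
    ∃ m, sg (sheet g) * z ∈ edge m ∧ h = necklaceNb g m ∧ w = z - sg (sheet g) * edgeSum m := by
  obtain ⟨k, x, hx, h1, h2, h3⟩ := H
  subst h1 h2 h3
  exact ⟨namedEdge g k, act_mem_edge hx, mul_edgeRefl g k, act_mul_edgeRefl hx⟩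

theorem necklace_glue {g : DihedralGroup 5} {z : ℂ} {m : ZMod 5} (h : sg (sheet g) * z ∈ edge m) :
    necklace.Glue g z (necklaceNb g m) (z - sg (sheet g) * edgeSum m) := by
  obtain ⟨k, rfl, hx⟩ := exists_of_mem_edge h
  refine ⟨k, _, hx, (mul_edgeRefl g k).symm, (act_act_inv g z).symm, ?_⟩
  rw [← mul_edgeRefl, act_mul_edgeRefl hx, act_act_inv]

noncomputable instance : PentagonTiled necklace where
  side := sheet
  nb := necklaceNb
  side_nb := sheet_nb
  nb_nb := necklaceNb_necklaceNb
  mem_poly := mem_necklace_poly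
  mem_vertex := mem_necklace_vertex
  of_glue := of_necklace_glue
  glue_nb h := Or.inl (necklace_glue h)

theorem exists_necklace_rep (x : necklace.Point) :
    ∃ (g : DihedralGroup 5) (z : ℂ) (hz : z ∈ necklace.poly g), x = necklace.toPoint g z hz :=
  exists_rep x

theorem necklace_toPoint_congr {g h : DihedralGroup 5} {z w : ℂ} (h1 : g = h) (h2 : z = w)
    {hz : z ∈ necklace.poly g} {hw : w ∈ necklace.poly h} :
    necklace.toPoint g z hz = necklace.toPoint h w hw := by
  subst h1 h2
  rfl

theorem project_toPoint {g : DihedralGroup 5} {z : ℂ} (hz : z ∈ necklace.poly g) :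
    project (necklace.toPoint g z hz) =
      doublePentagon.toPoint (sheet g) z (poly_necklace_subset g hz) := rfl

theorem fold_toPoint {g : DihedralGroup 5} {z : ℂ} (hz : z ∈ necklace.poly g) :
    fold (necklace.toPoint g z hz) = act g⁻¹ z := rfl

theorem necklace_not_mem_singular_iff {g : DihedralGroup 5} {z : ℂ} (hz : z ∈ necklace.poly g) :
    necklace.toPoint g z hz ∉ necklace.singular ↔ sg (sheet g) * z ∉ range zeta :=
  (toPoint_not_mem_singular_iff hz).trans (not_congr (mem_vertex (S := necklace) g z))

theorem double_not_mem_singular_iff {i : Bool} {z : ℂ} (hz : z ∈ doublePentagon.poly i) :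
    doublePentagon.toPoint i z hz ∉ doublePentagon.singular ↔ sg i * z ∉ range zeta :=
  (toPoint_not_mem_singular_iff hz).trans (not_congr (mem_vertex (S := doublePentagon) i z))

theorem project_not_mem_singular_iff {x : necklace.Point} :
    project x ∉ doublePentagon.singular ↔ x ∉ necklace.singular := by
  obtain ⟨g, z, hz, rfl⟩ := exists_necklace_rep x
  rw [project_toPoint, double_not_mem_singular_iff, necklace_not_mem_singular_iff]

theorem sg_true (z : ℂ) : sg true * z = z := one_mul z

theorem sg_false (z : ℂ) : sg false * z = -z := neg_one_mul z

/-- The tile map of the hyperelliptic involution of the double pentagon. -/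
def involTile : TileMap doublePentagon doublePentagon where
  piece i := Bool.not i
  kind := false
  sg_piece i := by cases i <;> simp [side, sg]
  piece_nb _ _ := rfl

/-- The hyperelliptic involution of the double pentagon. -/
noncomputable abbrev invol : doublePentagon.Point → doublePentagon.Point := involTile.map

/-- Translation of the indices of the pentagons of the necklace. -/
def deckPiece (c : ZMod 5) : DihedralGroup 5 → DihedralGroup 5
  | .r a => .r (a + c)
  | .sr b => .sr (b + c)

/-- Reflection of the indices of the pentagons of the necklace. -/
def turnPiece (c : ZMod 5) : DihedralGroup 5 → DihedralGroup 5
  | .r a => .sr (c - a)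
  | .sr b => .r (c - b)

theorem sheet_deckPiece (c : ZMod 5) (g : DihedralGroup 5) : sheet (deckPiece c g) = sheet g := by
  cases g <;> rfl

theorem sheet_turnPiece (c : ZMod 5) (g : DihedralGroup 5) :
    sheet (turnPiece c g) = !sheet g := by
  cases g <;> rfl

theorem deckPiece_nb (c : ZMod 5) (g : DihedralGroup 5) (m : ZMod 5) :
    deckPiece c (necklaceNb g m) = necklaceNb (deckPiece c g) m := by
  rcases g with a | b <;> simp only [deckPiece, necklaceNb] <;> congr 1 <;> ring

theorem turnPiece_nb (c : ZMod 5) (g : DihedralGroup 5) (m : ZMod 5) :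
    turnPiece c (necklaceNb g m) = necklaceNb (turnPiece c g) m := by
  rcases g with a | b <;> simp only [turnPiece, necklaceNb] <;> congr 1 <;> ring

/-- The tile maps of the deck transformations. -/
def deckTile (c : ZMod 5) : TileMap necklace necklace where
  piece := deckPiece c
  kind := true
  sg_piece g := by
    rw [sg_true]
    exact congrArg sg (sheet_deckPiece c g)
  piece_nb := deckPiece_nb c

/-- The tile maps of the lifts of the hyperelliptic involution. -/
def turnTile (c : ZMod 5) : TileMap necklace necklace where
  piece := turnPiece c
  kind := false
  sg_piece g := by
    rw [sg_false, ← sg_not]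
    exact congrArg sg (sheet_turnPiece c g)
  piece_nb := turnPiece_nb c

/-- The deck transformations of the necklace over the double pentagon. -/
noncomputable def deck (c : ZMod 5) : necklace.Point → necklace.Point := (deckTile c).map

/-- The lifts of the hyperelliptic involution to the necklace. -/
noncomputable def turn (c : ZMod 5) : necklace.Point → necklace.Point := (turnTile c).map

theorem deck_isStraightOn (c : ZMod 5) {u : ℂ} {γ : ℝ → necklace.Point} {J : Set ℝ}
    (h : necklace.IsStraightOn u γ J) : necklace.IsStraightOn u (deck c ∘ γ) J := by
  have := (deckTile c).map_isStraightOn h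
  rwa [show (deckTile c).kind = true from rfl, sg_true] at this

theorem turn_isStraightOn (c : ZMod 5) {u : ℂ} {γ : ℝ → necklace.Point} {J : Set ℝ}
    (h : necklace.IsStraightOn u γ J) : necklace.IsStraightOn (-u) (turn c ∘ γ) J := by
  have := (turnTile c).map_isStraightOn h
  rwa [show (turnTile c).kind = false from rfl, sg_false] at this

theorem invol_isStraightOn {u : ℂ} {γ : ℝ → doublePentagon.Point} {J : Set ℝ}
    (h : doublePentagon.IsStraightOn u γ J) : doublePentagon.IsStraightOn (-u) (invol ∘ γ) J := by
  have := involTile.map_isStraightOn h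
  rwa [show involTile.kind = false from rfl, sg_false] at this

theorem double_toPoint_congr {i j : Bool} {z w : ℂ} (h1 : i = j) (h2 : z = w)
    {hz : z ∈ doublePentagon.poly i} {hw : w ∈ doublePentagon.poly j} :
    doublePentagon.toPoint i z hz = doublePentagon.toPoint j w hw := by
  subst h1 h2
  rfl

theorem exists_double_rep (x : doublePentagon.Point) :
    ∃ (i : Bool) (z : ℂ) (hz : z ∈ doublePentagon.poly i), x = doublePentagon.toPoint i z hz :=
  exists_rep x

theorem mem_poly_invol {i : Bool} {z : ℂ} (hz : z ∈ doublePentagon.poly i) :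
    -z ∈ doublePentagon.poly (!i) := sg_false z ▸ involTile.mem_poly hz

theorem invol_toPoint {i : Bool} {z : ℂ} (hz : z ∈ doublePentagon.poly i) :
    invol (doublePentagon.toPoint i z hz) =
      doublePentagon.toPoint (!i) (-z) (mem_poly_invol hz) :=
  double_toPoint_congr rfl (sg_false z)

theorem invol_invol (x : doublePentagon.Point) : invol (invol x) = x := by
  obtain ⟨i, z, hz, rfl⟩ := exists_double_rep x
  rw [invol_toPoint, invol_toPoint]
  exact double_toPoint_congr (Bool.not_not i) (neg_neg z)

theorem mem_poly_deck (c : ZMod 5) {g : DihedralGroup 5} {z : ℂ} (hz : z ∈ necklace.poly g) :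
    z ∈ necklace.poly (deckPiece c g) := sg_true z ▸ (deckTile c).mem_poly hz

theorem mem_poly_turn (c : ZMod 5) {g : DihedralGroup 5} {z : ℂ} (hz : z ∈ necklace.poly g) :
    -z ∈ necklace.poly (turnPiece c g) := sg_false z ▸ (turnTile c).mem_poly hz

theorem deck_toPoint (c : ZMod 5) {g : DihedralGroup 5} {z : ℂ} (hz : z ∈ necklace.poly g) :
    deck c (necklace.toPoint g z hz) =
      necklace.toPoint (deckPiece c g) z (mem_poly_deck c hz) :=
  necklace_toPoint_congr rfl (sg_true z)

theorem turn_toPoint (c : ZMod 5) {g : DihedralGroup 5} {z : ℂ} (hz : z ∈ necklace.poly g) :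
    turn c (necklace.toPoint g z hz) =
      necklace.toPoint (turnPiece c g) (-z) (mem_poly_turn c hz) :=
  necklace_toPoint_congr rfl (sg_false z)

theorem project_deck (c : ZMod 5) (x : necklace.Point) : project (deck c x) = project x := by
  obtain ⟨g, z, hz, rfl⟩ := exists_necklace_rep x
  rw [deck_toPoint, project_toPoint, project_toPoint]
  exact double_toPoint_congr (sheet_deckPiece c g) rfl

theorem deck_deck (c d : ZMod 5) (x : necklace.Point) : deck c (deck d x) = deck (d + c) x := by
  obtain ⟨g, z, hz, rfl⟩ := exists_necklace_rep x
  rw [deck_toPoint, deck_toPoint, deck_toPoint]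
  refine necklace_toPoint_congr ?_ rfl
  cases g <;> simp only [deckPiece, add_assoc]

theorem deck_zero (x : necklace.Point) : deck 0 x = x := by
  obtain ⟨g, z, hz, rfl⟩ := exists_necklace_rep x
  rw [deck_toPoint]
  refine necklace_toPoint_congr ?_ rfl
  cases g <;> simp only [deckPiece, add_zero]

/-- Two representatives of a regular point of the necklace. -/
theorem necklace_toPoint_eq_cases {g h : DihedralGroup 5} {z w : ℂ} {hz : z ∈ necklace.poly g}
    {hw : w ∈ necklace.poly h} (he : necklace.toPoint g z hz = necklace.toPoint h w hw)
    (hn : necklace.toPoint g z hz ∉ necklace.singular) :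
    (g = h ∧ z = w) ∨ ∃ m, sg (sheet g) * z ∈ edge m ∧ h = necklaceNb g m ∧
      w = z - sg (sheet g) * edgeSum m :=
  toPoint_eq_cases he hn

theorem eq_zero_of_deck_eq {c : ZMod 5} {x : necklace.Point} (hx : x ∉ necklace.singular)
    (h : deck c x = x) : c = 0 := by
  obtain ⟨g, z, hz, rfl⟩ := exists_necklace_rep x
  rw [deck_toPoint] at h
  rcases necklace_toPoint_eq_cases h.symm hx with ⟨h1, -⟩ | ⟨m, -, h1, -⟩
  · rcases g with a | b
    · exact add_eq_left.1 (DihedralGroup.r.inj h1).symm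
    · exact add_eq_left.1 (DihedralGroup.sr.inj h1).symm
  · have := congrArg sheet h1
    rw [sheet_deckPiece, sheet_nb] at this
    cases h : sheet g <;> simp [h] at this

theorem exists_deckPiece_eq {g h : DihedralGroup 5} (hs : sheet g = sheet h) :
    ∃ c, deckPiece c g = h := by
  rcases g with a | a <;> rcases h with b | b
  · exact ⟨b - a, by rw [deckPiece, add_sub_cancel]⟩
  · exact absurd hs (by simp [sheet])
  · exact absurd hs (by simp [sheet])
  · exact ⟨b - a, by rw [deckPiece, add_sub_cancel]⟩

/-- The fibre of the projection over a regular point meets the polygons over any polygon that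
contains the point. -/
theorem exists_rep_of_project {x : necklace.Point} {i : Bool} {z : ℂ}
    {hz : z ∈ doublePentagon.poly i} (h : project x = doublePentagon.toPoint i z hz)
    (hn : x ∉ necklace.singular) : ∃ (g : DihedralGroup 5) (hz' : z ∈ necklace.poly g),
      sheet g = i ∧ x = necklace.toPoint g z hz' := by
  obtain ⟨g, w, hw, rfl⟩ := exists_necklace_rep x
  have hn' := project_not_mem_singular_iff.2 hn
  rw [project_toPoint] at h hn'
  rcases toPoint_eq_cases h hn' with ⟨h1, rfl⟩ | ⟨m, h1, h2, rfl⟩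
  · exact ⟨g, hw, h1, rfl⟩
  · have h3 := mem_poly_of_nb (S := necklace) (i := g) h1
    refine ⟨necklaceNb g m, h3, ?_, toPoint_nb_eq (S := necklace) hw h3⟩
    rw [sheet_nb]
    exact h2.symm

theorem exists_deck_eq {x y : necklace.Point} (hx : x ∉ necklace.singular)
    (h : project x = project y) : ∃ c, x = deck c y := by
  obtain ⟨h0, w, hw, rfl⟩ := exists_necklace_rep y
  obtain ⟨g, hz, h1, rfl⟩ := exists_rep_of_project h hx
  obtain ⟨c, hc⟩ := exists_deckPiece_eq h1.symm
  refine ⟨c, ?_⟩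
  rw [deck_toPoint]
  exact necklace_toPoint_congr hc.symm rfl

theorem mem_poly_leftMul (k : DihedralGroup 5) {g : DihedralGroup 5} {z : ℂ}
    (hz : z ∈ necklace.poly g) : act k z ∈ necklace.poly (k * g) := by
  obtain ⟨y, hy, he⟩ := hz
  exact ⟨y, hy, by rw [← he]; exact act_mul k g y⟩

theorem leftMul_glue (k : DihedralGroup 5) {g h : DihedralGroup 5} {z w : ℂ}
    (H : necklace.Glue g z h w) : necklace.Glue (k * g) (act k z) (k * h) (act k w) := by
  obtain ⟨m, x, hx, h1, h2, h3⟩ := H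
  refine ⟨m, x, hx, ?_, ?_, ?_⟩
  · rw [h1]
    exact (mul_assoc k g (edgeRefl m)).symm
  · rw [h2]
    exact (act_mul k g x).symm
  · rw [h3]
    exact (act_mul k h x).symm

/-- The isometries of the necklace that permute the pentagons over every point of the table. -/
noncomputable def leftMul (k : DihedralGroup 5) : necklace.Point → necklace.Point :=
  Quot.lift (fun x => necklace.toPoint (HMul.hMul (α := DihedralGroup 5) (β := DihedralGroup 5) k x.1.1)
    (act k x.1.2) (mem_poly_leftMul k x.2)) (by
    rintro ⟨⟨g, z⟩, hz⟩ ⟨⟨h, w⟩, hw⟩ H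
    exact Quot.sound (leftMul_glue k H))

theorem leftMul_toPoint (k : DihedralGroup 5) {g : DihedralGroup 5} {z : ℂ}
    (hz : z ∈ necklace.poly g) : leftMul k (necklace.toPoint g z hz) =
      necklace.toPoint (k * g) (act k z) (mem_poly_leftMul k hz) := rfl

theorem fold_leftMul (k : DihedralGroup 5) (x : necklace.Point) : fold (leftMul k x) = fold x := by
  obtain ⟨g, z, hz, rfl⟩ := exists_necklace_rep x
  rw [leftMul_toPoint, fold_toPoint, fold_toPoint, mul_inv_rev, act_mul, act_inv_act]

theorem leftMul_leftMul (k l : DihedralGroup 5) (x : necklace.Point) :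
    leftMul k (leftMul l x) = leftMul (k * l) x := by
  obtain ⟨g, z, hz, rfl⟩ := exists_necklace_rep x
  rw [leftMul_toPoint, leftMul_toPoint, leftMul_toPoint]
  exact necklace_toPoint_congr (mul_assoc k l g).symm (act_mul k l z).symm

theorem leftMul_one (x : necklace.Point) : leftMul 1 x = x := by
  obtain ⟨g, z, hz, rfl⟩ := exists_necklace_rep x
  rw [leftMul_toPoint]
  exact necklace_toPoint_congr (one_mul g) (act_one z)

theorem leftMul_not_mem_singular {k : DihedralGroup 5} {x : necklace.Point}
    (hx : x ∉ necklace.singular) : leftMul k x ∉ necklace.singular := by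
  obtain ⟨g, z, hz, rfl⟩ := exists_necklace_rep x
  replace hx := (toPoint_not_mem_singular_iff hz).1 hx
  refine (toPoint_not_mem_singular_iff (mem_poly_leftMul k hz)).2 ?_
  rintro ⟨y, hy, he⟩
  refine hx ⟨y, hy, ?_⟩
  have he' : act k (act g y) = act k z := (act_mul k g y).symm.trans he
  rw [← act_inv_act k z, ← he', act_inv_act]

theorem leftMul_isStraightOn (k : DihedralGroup 5) {u : ℂ} {γ : ℝ → necklace.Point} {J : Set ℝ}
    (h : necklace.IsStraightOn u γ J) : necklace.IsStraightOn (act k u) (leftMul k ∘ γ) J :=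
  h.map (S' := necklace) (φ := fun g : DihedralGroup 5 => (k * g : DihedralGroup 5))
    (L := actLin k) (fun _ _ hz => ⟨_, leftMul_toPoint k hz⟩) fun _ => leftMul_not_mem_singular

/-- Points of the necklace over the same point of the table differ by an isometry. -/
theorem eq_leftMul_of_act_eq {g h : DihedralGroup 5} {z w : ℂ} {hz : z ∈ necklace.poly g}
    {hw : w ∈ necklace.poly h} (he : act h⁻¹ w = act g⁻¹ z) :
    necklace.toPoint h w hw = leftMul (h * g⁻¹) (necklace.toPoint g z hz) := by
  rw [leftMul_toPoint]
  refine necklace_toPoint_congr (by group) ?_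
  rw [act_mul, ← he, act_act_inv]

theorem fold_deck (c : ZMod 5) (x : necklace.Point) : fold (deck c x) = zeta (-c) * fold x := by
  obtain ⟨g, z, hz, rfl⟩ := exists_necklace_rep x
  rw [deck_toPoint, fold_toPoint, fold_toPoint]
  rcases g with a | b
  · change zeta (-(a + c)) * z = zeta (-c) * (zeta (-a) * z)
    rw [neg_add, zeta_add]
    ring
  · change -(zeta (-(b + c)) * _) = zeta (-c) * (-(zeta (-b) * _))
    rw [neg_add, zeta_add]
    ring

theorem fold_turn (c : ZMod 5) (x : necklace.Point) :
    fold (turn c x) = zeta (-c) * (starRingEnd ℂ) (fold x) := by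
  obtain ⟨g, z, hz, rfl⟩ := exists_necklace_rep x
  rw [turn_toPoint, fold_toPoint, fold_toPoint]
  rcases g with a | b
  · change -(zeta (-(c - a)) * (starRingEnd ℂ) (-z)) =
      zeta (-c) * (starRingEnd ℂ) (zeta (-a) * z)
    rw [map_neg, map_mul, conj_zeta, neg_neg, neg_sub, sub_eq_neg_add, zeta_add]
    ring
  · change zeta (-(c - b)) * (-z) =
      zeta (-c) * (starRingEnd ℂ) (-(zeta (-b) * (starRingEnd ℂ) z))
    rw [map_neg, map_mul, conj_zeta, Complex.conj_conj, neg_neg, neg_sub, sub_eq_neg_add,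
      zeta_add]
    ring

theorem turn_turn (c d : ZMod 5) (x : necklace.Point) : turn c (turn d x) = deck (c - d) x := by
  obtain ⟨g, z, hz, rfl⟩ := exists_necklace_rep x
  rw [turn_toPoint, turn_toPoint, deck_toPoint]
  refine necklace_toPoint_congr ?_ (neg_neg z)
  rcases g with a | b <;> simp only [turnPiece, deckPiece] <;> congr 1 <;> ring

namespace GluedSurface

open PentagonTiled

section Glue

variable {S : GluedSurface} [PentagonTiled S] {u : ℂ} {γ γ' : ℝ → S.Point}

/-- The curve that follows `γ` before the time `b` and `γ'` from then on. -/
noncomputable def concatAt {X : Type*} (b : ℝ) (γ γ' : ℝ → X) (s : ℝ) : X :=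
  if s < b then γ s else γ' s

theorem eqOn_concatAt {a b c d r : ℝ} (h : S.IsStraightOn u γ (Ioo a b))
    (h' : S.IsStraightOn u γ' (Ioo c d)) (hr : r ∈ Ioo a b) (hr' : r ∈ Ioo c d)
    (he : γ r = γ' r) (hac : a ≤ c) (hbd : b ≤ d) :
    EqOn (concatAt b γ γ') γ (Ioo a b) ∧ EqOn (concatAt b γ γ') γ' (Ioo c d) := by
  refine ⟨fun s hs => if_pos hs.2, fun s hs => ?_⟩
  by_cases hsb : s < b
  · rw [concatAt, if_pos hsb]
    exact (h.mono (Ioo_subset_Ioo_left hac)).eqOn (h'.mono (Ioo_subset_Ioo_right hbd))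
      isPreconnected_Ioo ⟨hr'.1, hr.2⟩ he ⟨hs.1, hsb⟩
  · exact if_neg hsb

theorem concatAt_isStraightOn {a b c d r : ℝ} (h : S.IsStraightOn u γ (Ioo a b))
    (h' : S.IsStraightOn u γ' (Ioo c d)) (hr : r ∈ Ioo a b) (hr' : r ∈ Ioo c d)
    (he : γ r = γ' r) (hac : a ≤ c) (hbd : b ≤ d) :
    S.IsStraightOn u (concatAt b γ γ') (Ioo a d) := by
  obtain ⟨h1, h2⟩ := eqOn_concatAt h h' hr hr' he hac hbd
  refine ((h.congr isOpen_Ioo h1).union (h'.congr isOpen_Ioo h2)).mono fun s hs => ?_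
  rcases lt_or_ge s b with hsb | hsb
  · exact Or.inl ⟨hs.1, hsb⟩
  · exact Or.inr ⟨(hr'.1.trans hr.2).trans_le hsb, hs.2⟩

end Glue

section Periods

variable {S : GluedSurface} [PentagonTiled S] {u : ℂ} {γ γ' : ℝ → S.Point}

theorem IsStraightOn.translate_eq (h : S.IsStraightOn u γ univ) (h' : S.IsStraightOn u γ' univ)
    {a b : ℝ} (he : γ a = γ' b) (s : ℝ) : γ (s + a) = γ' (s + b) := by
  have h1 := (h.comp_add a).eqOn (h'.comp_add b) (J := univ) isPreconnected_univ (a := 0)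
    (mem_univ _)
  simp only [zero_add] at h1
  exact h1 he (mem_univ s)

theorem IsStraightOn.reflect_eq (h : S.IsStraightOn u γ univ) (h' : S.IsStraightOn (-u) γ' univ)
    {a b : ℝ} (he : γ a = γ' b) (s : ℝ) : γ (a + s) = γ' (b - s) := by
  have h2 := h'.comp_sub (a + b)
  rw [neg_neg] at h2
  have h1 := h.eqOn h2 (J := univ) isPreconnected_univ (a := a) (mem_univ _)
    (by simpa using he) (mem_univ (a + s))
  rw [h1]
  change γ' (a + b - (a + s)) = _
  congr 1
  ring

theorem IsStraightOn.periodic_of_eq (h : S.IsStraightOn u γ univ) {a b : ℝ} (he : γ a = γ b) :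
    Function.Periodic γ (b - a) := by
  intro t
  have := h.translate_eq h he (t - a)
  rw [sub_add_cancel] at this
  rw [this]
  congr 1
  ring

theorem _root_.HasLength.exists_int {X : Type} {γ : ℝ → X} {l T : ℝ} (h : HasLength γ l)
    (hT : Function.Periodic γ T) : ∃ n : ℤ, T = n * l := by
  have hl : 0 < l := h.1.1
  refine ⟨⌊T / l⌋, ?_⟩
  by_contra hne
  have h1 : Function.Periodic γ (T - ⌊T / l⌋ * l) := by
    have := hT.sub_period (h.1.2.int_mul ⌊T / l⌋)
    exact this
  have h2 : (⌊T / l⌋ : ℝ) * l ≤ T := by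
    rw [← le_div_iff₀ hl]
    exact Int.floor_le _
  have h3 : T < (⌊T / l⌋ + 1 : ℝ) * l := by
    rw [← div_lt_iff₀ hl]
    exact Int.lt_floor_add_one _
  have h4 : 0 < T - ⌊T / l⌋ * l := lt_of_le_of_ne (by linarith) fun h => hne (by linarith)
  have := h.2 ⟨h4, h1⟩
  linarith

theorem IsPeriodicTrajectory.exists_length (h : S.IsPeriodicTrajectory u γ) (hu : u ≠ 0) :
    ∃ l, HasLength γ l := by
  obtain ⟨hs, T, hT, hP⟩ := h
  let H : AddSubgroup ℝ :=
    { carrier := {T | Function.Periodic γ T}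
      add_mem' := fun h h' => h.add_period h'
      zero_mem' := fun t => by rw [add_zero]
      neg_mem' := fun h => h.neg }
  obtain ⟨h0, ε, hε, -, i, z, hr⟩ := hs 0 (mem_univ _)
  have hne : H ≠ ⊥ := by
    intro h
    have : T ∈ H := hP
    rw [h, AddSubgroup.mem_bot] at this
    exact hT.ne' this
  have hd : Disjoint (H : Set ℝ) (Ioo 0 ε) := by
    rw [Set.disjoint_left]
    intro r hr1 hr2
    have hr1 : Function.Periodic γ r := hr1
    obtain ⟨h1, h2⟩ := hr 0 ⟨le_rfl, hε.le⟩
    obtain ⟨h3, h4⟩ := hr r ⟨hr2.1.le, hr2.2.le⟩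
    rw [add_zero] at h2
    rw [hr1 0, h2] at h4
    rcases toPoint_eq_cases h4 (h2 ▸ h0) with ⟨-, h5⟩ | h5
    · rw [Complex.ofReal_zero, zero_mul] at h5
      have h6 : (r : ℂ) * u = 0 := (add_right_inj z).1 h5.symm
      rcases mul_eq_zero.1 h6 with h7 | h7
      · exact hr2.1.ne' (by exact_mod_cast h7)
      · exact hu h7
    · have := h5.side_eq
      simp at this
  obtain ⟨l, hl⟩ := AddSubgroup.exists_isLeast_pos hne hε hd
  refine ⟨l, ⟨hl.1.2, hl.1.1⟩, fun r hr => hl.2 ⟨hr.2, hr.1⟩⟩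

theorem _root_.HasLength.exists_int_of_eq {l : ℝ} (h : HasLength γ l) (hs : S.IsStraightOn u γ univ)
    {a b : ℝ} (he : γ a = γ b) : ∃ n : ℤ, b = a + n * l := by
  obtain ⟨n, hn⟩ := h.exists_int (hs.periodic_of_eq he)
  exact ⟨n, by linarith⟩

end Periods

end GluedSurface

theorem norm_sg_mul (b : Bool) (z : ℂ) : ‖sg b * z‖ = ‖z‖ := by cases b <;> simp [sg]

/-- Near a point of the pentagon that is not a vertex, at most one edge matters. -/
theorem exists_local_edge {z : ℂ} (hz : z ∈ pentagon) (hv : z ∉ range zeta) :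
    ∃ r > 0, ∃ m, ∀ y, dist y z < r → (height m y ≤ edgeHeight → y ∈ pentagon) ∧
      (edgeHeight ≤ height m y → edgeSum m - y ∈ pentagon) ∧ y ∉ range zeta ∧
      (edgeHeight ≤ height m y → edgeSum m - y ∉ range zeta) := by
  have hcl : IsClosed (range zeta) := (finite_range zeta).isClosed
  by_cases h : ∃ m, z ∈ edge m
  · obtain ⟨m, hm⟩ := h
    have hv' : edgeSum m - z ∉ range zeta := by
      intro h
      have := edgeSum_sub_vertex (edgeSum_sub_mem hm) h
      rw [sub_sub_cancel] at this
      exact hv this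
    have ev : ∀ᶠ y in nhds z, y ∉ range zeta ∧ edgeSum m - y ∉ range zeta ∧
        ∀ k, k ≠ m → height k y < edgeHeight ∧ height k (edgeSum m - y) < edgeHeight := by
      have hev : ∀ᶠ y in nhds z, y ∉ range zeta := hcl.isOpen_compl.mem_nhds hv
      refine hev.and (Filter.Eventually.and ?_ ?_)
      · exact (continuous_const.sub continuous_id :
          Continuous fun y => edgeSum m - y).continuousAt (hcl.isOpen_compl.mem_nhds hv')
      · refine Filter.eventually_all.2 fun k => ?_
        by_cases hk : k = m
        · simp [hk]
        · have h1 := (continuous_height k).continuousAt.eventually_lt continuousAt_const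
            (height_lt hm hv hk)
          have h2 := ((continuous_height k).comp
            (continuous_const.sub continuous_id : Continuous fun y => edgeSum m - y)).continuousAt
            |>.eventually_lt continuousAt_const (height_lt (edgeSum_sub_mem hm) hv' hk)
          filter_upwards [h1, h2] with y h1 h2 _
          exact ⟨h1, h2⟩
    obtain ⟨r, hr, h1⟩ := Metric.eventually_nhds_iff.1 ev
    refine ⟨r, hr, m, fun y hy => ⟨fun h2 => ?_, fun h2 => ?_, (h1 hy).1, fun _ => (h1 hy).2.1⟩⟩
    · refine mem_pentagon_iff.2 fun k => ?_
      by_cases hk : k = m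
      · rwa [hk]
      · exact ((h1 hy).2.2 k hk).1.le
    · refine mem_pentagon_iff.2 fun k => ?_
      by_cases hk : k = m
      · rw [hk, map_sub, height_edgeSum]
        linarith
      · exact ((h1 hy).2.2 k hk).2.le
  · push Not at h
    have h0 : ∀ k, height k z < edgeHeight := fun k => by
      by_contra! h1
      exact h k (mem_edge_of_height hz h1)
    have ev : ∀ᶠ y in nhds z, y ∉ range zeta ∧ ∀ k, height k y < edgeHeight := by
      have hev : ∀ᶠ y in nhds z, y ∉ range zeta := hcl.isOpen_compl.mem_nhds hv
      refine hev.and (Filter.eventually_all.2 fun k => ?_)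
      exact (continuous_height k).continuousAt.eventually_lt continuousAt_const (h0 k)
    obtain ⟨r, hr, h1⟩ := Metric.eventually_nhds_iff.1 ev
    exact ⟨r, hr, 0, fun y hy => ⟨fun _ => mem_pentagon_iff.2 fun k => ((h1 hy).2 k).le,
      fun h2 => absurd h2 ((h1 hy).2 0).not_ge, (h1 hy).1,
      fun h2 => absurd h2 ((h1 hy).2 0).not_ge⟩⟩

theorem exists_uniform_edge {d : ℝ} (hd : 0 < d) : ∃ r > 0, ∀ z ∈ pentagon,
    (∀ k, d ≤ dist z (zeta k)) → ∃ m, ∀ y, dist y z < r →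
      (height m y ≤ edgeHeight → y ∈ pentagon) ∧
      (edgeHeight ≤ height m y → edgeSum m - y ∈ pentagon) ∧ y ∉ range zeta ∧
      (edgeHeight ≤ height m y → edgeSum m - y ∉ range zeta) := by
  set K : Set ℂ := pentagon ∩ ⋂ k, {z | d ≤ dist z (zeta k)} with hK
  have hKc : IsCompact K := isCompact_pentagon.inter_right
    (isClosed_iInter fun k => isClosed_le continuous_const (continuous_id.dist continuous_const))
  have key : ∀ z : K, ∃ r > 0, ∃ m, ∀ y, dist y z.1 < r →
      (height m y ≤ edgeHeight → y ∈ pentagon) ∧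
      (edgeHeight ≤ height m y → edgeSum m - y ∈ pentagon) ∧ y ∉ range zeta ∧
      (edgeHeight ≤ height m y → edgeSum m - y ∉ range zeta) := by
    rintro ⟨z, hz, hz'⟩
    refine exists_local_edge hz ?_
    rintro ⟨k, rfl⟩
    have := mem_iInter.1 hz' k
    change d ≤ dist (zeta k) (zeta k) at this
    rw [dist_self] at this
    linarith
  choose r hr m hm using key
  obtain ⟨δ, hδ, h⟩ := lebesgue_number_lemma_of_metric hKc (c := fun z : K => Metric.ball z.1 (r z))
    (fun _ => Metric.isOpen_ball) fun z hz => mem_iUnion.2 ⟨⟨z, hz⟩, Metric.mem_ball_self (hr _)⟩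
  refine ⟨δ, hδ, fun z hz hz' => ?_⟩
  obtain ⟨z', h'⟩ := h z ⟨hz, mem_iInter.2 hz'⟩
  exact ⟨m z', fun y hy => hm z' y (h' hy)⟩

theorem exists_const_sign (a b : ℝ) : ∃ ε > 0, (∀ s ∈ Icc 0 ε, a + s * b ≤ 0) ∨
    ∀ s ∈ Icc 0 ε, 0 ≤ a + s * b := by
  have hb : 0 < |b| + 1 := by positivity
  have key : ∀ s, 0 ≤ s → s ≤ |a| / (|b| + 1) → |s * b| ≤ |a| := by
    intro s h1 h2
    rw [le_div_iff₀ hb] at h2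
    rw [abs_mul, abs_of_nonneg h1]
    nlinarith
  rcases lt_trichotomy a 0 with ha | rfl | ha
  · refine ⟨|a| / (|b| + 1), div_pos (abs_pos.2 ha.ne) hb, Or.inl fun s hs => ?_⟩
    have := key s hs.1 hs.2
    rw [abs_of_neg ha] at this
    linarith [le_abs_self (s * b)]
  · rcases le_total b 0 with hb | hb
    · exact ⟨1, one_pos, Or.inl fun s hs => by nlinarith [hs.1]⟩
    · exact ⟨1, one_pos, Or.inr fun s hs => by nlinarith [hs.1]⟩
  · refine ⟨|a| / (|b| + 1), div_pos (abs_pos.2 ha.ne') hb, Or.inr fun s hs => ?_⟩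
    have := key s hs.1 hs.2
    rw [abs_of_pos ha] at this
    linarith [neg_abs_le (s * b)]

namespace GluedSurface

open PentagonTiled

variable {S : GluedSurface} [PentagonTiled S]

/-- Points that stay away from the vertices have flat charts of uniform size. -/
theorem exists_chart (S : GluedSurface) [PentagonTiled S] {d : ℝ} (hd : 0 < d) :
    ∃ r > 0, ∀ (i : S.Piece) (z : ℂ) (hz : z ∈ S.poly i),
      (∀ k, d ≤ dist (sg (side i) * z) (zeta k)) → ∃ D : ℂ → S.Point, D 0 = S.toPoint i z hz ∧
        ∀ a u : ℂ, S.IsStraightOn u (fun s : ℝ => D (a + s * u)) {s : ℝ | ‖a + s * u‖ < r} := by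
  obtain ⟨r, hr, h⟩ := exists_uniform_edge hd
  refine ⟨r, hr, fun i z hz hzd => ?_⟩
  obtain ⟨m, hm⟩ := h _ ((mem_poly i z).1 hz) hzd
  classical
  let D (y : ℂ) : S.Point :=
    if h : z + y ∈ S.poly i then S.toPoint i (z + y) h else
      if h : z + y - sg (side i) * edgeSum m ∈ S.poly (nb i m) then S.toPoint (nb i m) _ h else
        S.toPoint i z hz
  have hdist : ∀ y, dist (sg (side i) * (z + y)) (sg (side i) * z) = ‖y‖ := by
    intro y
    rw [dist_eq_norm, ← mul_sub, add_sub_cancel_left, norm_sg_mul]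
  have below : ∀ y, ‖y‖ < r → height m (sg (side i) * (z + y)) ≤ edgeHeight →
      ∃ h : z + y ∈ S.poly i, D y = S.toPoint i (z + y) h := by
    intro y hy hh
    have h1 : z + y ∈ S.poly i := (mem_poly i _).2 ((hm _ ((hdist y).trans_lt hy)).1 hh)
    exact ⟨h1, dif_pos h1⟩
  have above : ∀ y, ‖y‖ < r → edgeHeight ≤ height m (sg (side i) * (z + y)) →
      ∃ h : z + y - sg (side i) * edgeSum m ∈ S.poly (nb i m), D y = S.toPoint (nb i m) _ h := by
    intro y hy hh
    have h1 : z + y - sg (side i) * edgeSum m ∈ S.poly (nb i m) := by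
      rw [mem_poly, sg_nb_mul]
      exact (hm _ ((hdist y).trans_lt hy)).2.1 hh
    refine ⟨h1, ?_⟩
    by_cases h2 : z + y ∈ S.poly i
    · rw [show D y = S.toPoint i (z + y) h2 from dif_pos h2]
      exact toPoint_nb_eq h2 h1
    · rw [show D y = _ from dif_neg h2, dif_pos h1]
  have nonsing : ∀ y, ‖y‖ < r → D y ∉ S.singular := by
    intro y hy
    have h1 := hm _ ((hdist y).trans_lt hy)
    rcases le_total (height m (sg (side i) * (z + y))) edgeHeight with hh | hh
    · obtain ⟨h2, h3⟩ := below y hy hh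
      rw [h3, toPoint_not_mem_singular_iff, mem_vertex]
      exact h1.2.2.1
    · obtain ⟨h2, h3⟩ := above y hy hh
      rw [h3, toPoint_not_mem_singular_iff, mem_vertex, sg_nb_mul]
      exact h1.2.2.2 hh
  refine ⟨D, ?_, fun a u t ht => ⟨nonsing _ ht, ?_⟩⟩
  · have h0 : z + 0 ∈ S.poly i := by rwa [add_zero]
    rw [show D 0 = S.toPoint i (z + 0) h0 from dif_pos h0]
    exact toPoint_congr (add_zero z) _
  have hopen : IsOpen {s : ℝ | ‖a + s * u‖ < r} := isOpen_lt (by fun_prop) continuous_const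
  obtain ⟨ε, hε, hb⟩ := Metric.isOpen_iff.1 hopen t ht
  have hin : ∀ s, |s| < ε → ‖a + ((t + s : ℝ) : ℂ) * u‖ < r := by
    intro s hs
    apply hb
    rwa [Metric.mem_ball, Real.dist_eq, add_sub_cancel_left]
  have hlin : ∀ s : ℝ, height m (sg (side i) * (z + (a + ((t + s : ℝ) : ℂ) * u))) =
      height m (sg (side i) * (z + (a + t * u))) + s * height m (sg (side i) * u) := by
    intro s
    rw [← smul_eq_mul s, ← map_smul, ← map_add, Complex.real_smul]
    congr 1
    push_cast
    ring
  have run : ∀ A : Set ℝ, (∀ s ∈ A, |s| < ε) →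
      ((∀ s ∈ A, height m (sg (side i) * (z + (a + ((t + s : ℝ) : ℂ) * u))) ≤ edgeHeight) ∨
        ∀ s ∈ A, edgeHeight ≤ height m (sg (side i) * (z + (a + ((t + s : ℝ) : ℂ) * u)))) →
      S.RunsStraight u (fun s : ℝ => D (a + s * u)) t A := by
    rintro A hA (h1 | h1)
    · refine ⟨i, z + a + t * u, fun s hs => ?_⟩
      obtain ⟨h2, h3⟩ := below _ (hin s (hA s hs)) (h1 s hs)
      have e : z + (a + ((t + s : ℝ) : ℂ) * u) = z + a + t * u + s * u := by push_cast; ring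
      exact ⟨e ▸ h2, h3.trans (toPoint_congr e _)⟩
    · refine ⟨nb i m, z + a + t * u - sg (side i) * edgeSum m, fun s hs => ?_⟩
      obtain ⟨h2, h3⟩ := above _ (hin s (hA s hs)) (h1 s hs)
      have e : z + (a + ((t + s : ℝ) : ℂ) * u) - sg (side i) * edgeSum m =
          z + a + t * u - sg (side i) * edgeSum m + s * u := by push_cast; ring
      exact ⟨e ▸ h2, h3.trans (toPoint_congr e _)⟩
  set α := height m (sg (side i) * (z + (a + t * u))) - edgeHeight with hα
  set β := height m (sg (side i) * u)
  obtain ⟨ε1, hε1, h1⟩ := exists_const_sign α β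
  obtain ⟨ε2, hε2, h2⟩ := exists_const_sign α (-β)
  have hmin : 0 < min (ε / 2) (min ε1 ε2) := by positivity
  have m1 := min_le_left (ε / 2) (min ε1 ε2)
  have m2 := (min_le_right (ε / 2) (min ε1 ε2)).trans (min_le_left _ _)
  have m3 := (min_le_right (ε / 2) (min ε1 ε2)).trans (min_le_right _ _)
  refine ⟨_, hmin, run _ (fun s hs => ?_) ?_, run _ (fun s hs => ?_) ?_⟩
  · rw [abs_lt]
    constructor <;> linarith [hs.1, hs.2]
  · refine h2.imp (fun h2 s hs => ?_) fun h2 s hs => ?_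
    · have := h2 (-s) ⟨by linarith [hs.2], by linarith [hs.1]⟩
      rw [hlin]
      linarith
    · have := h2 (-s) ⟨by linarith [hs.2], by linarith [hs.1]⟩
      rw [hlin]
      linarith
  · rw [abs_lt]
    constructor <;> linarith [hs.1, hs.2]
  · refine h1.imp (fun h1 s hs => ?_) fun h1 s hs => ?_
    · have := h1 s ⟨hs.1, by linarith [hs.2]⟩
      rw [hlin]
      linarith
    · have := h1 s ⟨hs.1, by linarith [hs.2]⟩
      rw [hlin]
      linarith

theorem norm_I_mul_real {v : ℂ} (hv : ‖v‖ = 1) (s : ℝ) : ‖(s : ℂ) * (I * v)‖ = |s| := by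
  rw [norm_mul, norm_mul, Complex.norm_I, hv, one_mul, mul_one, Complex.norm_real, Real.norm_eq_abs]

/-- A family of trajectories that stays away from the vertices can be continued. -/
theorem IsParallelFamily.exists_extension {v : ℂ} (hv : ‖v‖ = 1) {w : ℝ} (hw : 0 < w)
    {Φ : ℝ → ℝ → S.Point} (hΦ : S.IsParallelFamily v (-w) w Φ) {d : ℝ} (hd : 0 < d)
    (hfar : ∀ s ∈ Ioo 0 w, ∀ t i z (hz : z ∈ S.poly i), Φ s t = S.toPoint i z hz →
      ∀ k, d ≤ dist (sg (side i) * z) (zeta k)) :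
    ∃ b > w, ∃ Ψ, S.IsParallelFamily v (-w) b Ψ ∧ Ψ 0 = Φ 0 := by
  obtain ⟨r, hr, hchart⟩ := exists_chart S hd
  obtain ⟨s₁, hs₁, hs₁w, hs₁r⟩ : ∃ s₁, 0 < s₁ ∧ s₁ < w ∧ w < s₁ + r := by
    have h1 := min_le_left w r
    have h2 := min_le_right w r
    have h3 := lt_min hw hr
    exact ⟨w - min w r / 2, by linarith, by linarith, by linarith⟩
  have key : ∀ t, ∃ D : ℂ → S.Point, D 0 = Φ s₁ t ∧
      ∀ a u : ℂ, S.IsStraightOn u (fun s : ℝ => D (a + s * u)) {s : ℝ | ‖a + s * u‖ < r} := by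
    intro t
    obtain ⟨i, z, hz, he⟩ := exists_rep (Φ s₁ t)
    rw [he]
    exact hchart i z hz (hfar s₁ ⟨hs₁, hs₁w⟩ t i z hz he)
  choose D hD0 hD using key
  have hmem₁ : s₁ ∈ Ioo (-w) w := ⟨by linarith, hs₁w⟩
  have trans2 : ∀ t, S.IsStraightOn (I * v) (fun s : ℝ => D t ((s - s₁ : ℝ) * (I * v)))
      (Ioo (max (-w) (s₁ - r)) (s₁ + r)) := by
    intro t
    have h1 := (hD t 0 (I * v)).comp_add (-s₁)
    have h2 := h1.mono (J' := Ioo (max (-w) (s₁ - r)) (s₁ + r)) fun s hs => by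
      have h3 := (le_max_right (-w) (s₁ - r)).trans_lt hs.1
      change ‖0 + ((s + -s₁ : ℝ) : ℂ) * (I * v)‖ < r
      rw [zero_add, norm_I_mul_real hv, abs_lt]
      constructor <;> linarith [hs.2]
    simpa only [zero_add, sub_eq_add_neg] using h2
  have hr₁ : s₁ ∈ Ioo (max (-w) (s₁ - r)) (s₁ + r) :=
    ⟨max_lt (by linarith) (by linarith), by linarith⟩
  have hag : ∀ t, Φ s₁ t = D t ((s₁ - s₁ : ℝ) * (I * v)) := by
    intro t
    rw [sub_self, Complex.ofReal_zero, zero_mul, hD0]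
  let Ψ (s t : ℝ) : S.Point :=
    concatAt w (fun s => Φ s t) (fun s : ℝ => D t ((s - s₁ : ℝ) * (I * v))) s
  have hΨt : ∀ t, S.IsStraightOn (I * v) (fun s => Ψ s t) (Ioo (-w) (s₁ + r)) := fun t =>
    concatAt_isStraightOn (hΦ.2 t) (trans2 t) hmem₁ hr₁ (hag t) (le_max_left _ _) hs₁r.le
  have hΨ2 : ∀ t, EqOn (fun s => Ψ s t) (fun s : ℝ => D t ((s - s₁ : ℝ) * (I * v)))
      (Ioo (max (-w) (s₁ - r)) (s₁ + r)) := fun t =>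
    (eqOn_concatAt (hΦ.2 t) (trans2 t) hmem₁ hr₁ (hag t) (le_max_left _ _) hs₁r.le).2
  have hΨ1 : ∀ s, s < w → Ψ s = Φ s := fun s hs => funext fun t => if_pos hs
  refine ⟨s₁ + r, hs₁r, Ψ, ⟨fun s hs => ?_, hΨt⟩, hΨ1 0 hw⟩
  rcases lt_or_ge s w with hsw | hsw
  · rw [hΨ1 s hsw]
    exact hΦ.1 s ⟨hs.1, hsw⟩
  have hs2 : s ∈ Ioo (max (-w) (s₁ - r)) (s₁ + r) :=
    ⟨max_lt (by linarith) (by linarith), hs.2⟩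
  have hσ : 0 < s - s₁ := by linarith
  constructor
  · intro t _
    set ρ := r - (s - s₁) with hρ
    have hρ0 : 0 < ρ := by linarith [hs.2]
    have h1 := hD t ((s - s₁ : ℝ) * (I * v) - t * v) v
    have h2 := h1.mono (J' := Ioo (t - ρ) (t + ρ)) fun τ hτ => by
      change ‖((s - s₁ : ℝ) : ℂ) * (I * v) - t * v + τ * v‖ < r
      have e : ((s - s₁ : ℝ) : ℂ) * (I * v) - t * v + τ * v =
          ((s - s₁ : ℝ) : ℂ) * (I * v) + ((τ - t : ℝ) : ℂ) * v := by push_cast; ring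
      have h3 : ‖((τ - t : ℝ) : ℂ) * v‖ < ρ := by
        rw [norm_mul, hv, mul_one, Complex.norm_real, Real.norm_eq_abs, abs_lt]
        constructor <;> linarith [hτ.1, hτ.2]
      rw [e]
      refine (norm_add_le _ _).trans_lt ?_
      rw [norm_I_mul_real hv, abs_of_pos hσ]
      linarith
    refine h2.congr isOpen_Ioo (fun τ hτ => ?_) t ⟨by linarith, by linarith⟩
    have hx : |τ - t| < ρ := by
      rw [abs_lt]
      constructor <;> linarith [hτ.1, hτ.2]
    have base : D t (((τ - t : ℝ) : ℂ) * v) = Φ s₁ τ := by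
      have h3 := hD t 0 v
      have h4 := ((hΦ.1 s₁ hmem₁).1.comp_add t).mono
        (J' := {x : ℝ | ‖(0 : ℂ) + x * v‖ < r}) fun _ _ => mem_univ _
      have hset : {x : ℝ | ‖(0 : ℂ) + x * v‖ < r} = Metric.ball (0 : ℝ) r := by
        ext x
        simp [hv]
      have h5 := h3.eqOn h4 (by rw [hset]; exact (convex_ball _ _).isPreconnected) (a := 0)
        (by rw [hset]; exact Metric.mem_ball_self hr) (by
          simp only [Complex.ofReal_zero, zero_mul, add_zero, zero_add]
          exact hD0 t)
      have h6 := h5 (x := τ - t) (by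
        rw [hset, Metric.mem_ball, Real.dist_eq, sub_zero]
        linarith)
      simpa using h6
    have h3 := (hD τ 0 (I * v)).mono (J' := Ioo (-(r - |τ - t|)) (r - |τ - t|)) fun y hy => by
      change ‖(0 : ℂ) + y * (I * v)‖ < r
      rw [zero_add, norm_I_mul_real hv, abs_lt]
      constructor <;> linarith [hy.1, hy.2, abs_nonneg (τ - t)]
    have h4 := (hD t (((τ - t : ℝ) : ℂ) * v) (I * v)).mono
      (J' := Ioo (-(r - |τ - t|)) (r - |τ - t|)) fun y hy => by
        change ‖((τ - t : ℝ) : ℂ) * v + y * (I * v)‖ < r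
        refine (norm_add_le _ _).trans_lt ?_
        have h5 : |y| < r - |τ - t| := abs_lt.2 hy
        rw [norm_I_mul_real hv, norm_mul, hv, mul_one, Complex.norm_real, Real.norm_eq_abs]
        linarith
    have h5 := h3.eqOn h4 isPreconnected_Ioo (a := 0) ⟨by linarith, by linarith⟩ (by
      simp only [Complex.ofReal_zero, zero_mul, add_zero]
      rw [hD0, base])
    have h6 := h5 (x := s - s₁) ⟨by linarith, by linarith⟩
    change Ψ s τ = D t _
    refine (hΨ2 τ hs2).trans ?_
    change D τ (((s - s₁ : ℝ) : ℂ) * (I * v)) = _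
    simp only [zero_add] at h6
    rw [h6]
    congr 1
    push_cast
    ring
  · obtain ⟨T, hT, hP⟩ := (hΦ.1 s₁ hmem₁).2
    refine ⟨T, hT, fun t => ?_⟩
    refine (hΨt (t + T)).eqOn (hΨt t) isPreconnected_Ioo (a := s₁) ⟨by linarith, by linarith⟩ ?_ hs
    rw [hΨ1 s₁ hs₁w, hP t]

/-- Two families around trajectories at distance `δ` from one another can be joined. -/
theorem IsParallelFamily.exists_join {v : ℂ} {w δ : ℝ} {Φ Φ' : ℝ → ℝ → S.Point}
    (hΦ : S.IsParallelFamily v (-w) w Φ) (hΦ' : S.IsParallelFamily v (-w) w Φ')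
    (hδ : δ ∈ Ioo 0 w) {t t' : ℝ} (he : Φ δ t = Φ' 0 t') :
    ∃ Ψ, S.IsParallelFamily v (-w) (w + δ) Ψ ∧ Ψ 0 = Φ 0 := by
  obtain ⟨hδ0, hδw⟩ := hδ
  have hmem : δ ∈ Ioo (-w) w := ⟨by linarith, hδw⟩
  have h0 : (0 : ℝ) ∈ Ioo (-w) w := ⟨by linarith, by linarith⟩
  have h1 : ∀ x, Φ δ x = Φ' 0 (x + (t' - t)) := by
    intro x
    have := (hΦ.1 δ hmem).1.translate_eq (hΦ'.1 0 h0).1 he (x - t)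
    rw [sub_add_cancel] at this
    rw [this]
    congr 1
    ring
  have tr : ∀ x, S.IsStraightOn (I * v) (fun s => Φ' (s + -δ) (x + (t' - t)))
      (Ioo (δ - w) (w + δ)) := fun x =>
    ((hΦ'.2 (x + (t' - t))).comp_add (-δ)).mono fun s hs =>
      ⟨by linarith [hs.1], by linarith [hs.2]⟩
  let Ψ (s x : ℝ) : S.Point :=
    concatAt w (fun s => Φ s x) (fun s => Φ' (s + -δ) (x + (t' - t))) s
  have hΨ1 : ∀ s, s < w → Ψ s = Φ s := fun s hs => funext fun t => if_pos hs
  refine ⟨Ψ, ⟨fun s hs => ?_, fun x => ?_⟩, hΨ1 0 (by linarith)⟩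
  · rcases lt_or_ge s w with hsw | hsw
    · rw [hΨ1 s hsw]
      exact hΦ.1 s ⟨hs.1, hsw⟩
    · have : Ψ s = fun x => Φ' (s + -δ) (x + (t' - t)) := funext fun x => if_neg hsw.not_gt
      rw [this]
      obtain ⟨h2, T, hT, hP⟩ := hΦ'.1 (s + -δ) ⟨by linarith, by linarith [hs.2]⟩
      refine ⟨h2.comp_add (t' - t), T, hT, fun x => ?_⟩
      change Φ' (s + -δ) (x + T + (t' - t)) = _
      rw [add_right_comm, hP]
  · refine concatAt_isStraightOn (hΦ.2 x) (tr x) hmem ⟨by linarith, by linarith⟩ ?_ (by linarith)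
      (by linarith)
    rw [h1, add_neg_cancel]

end GluedSurface

theorem project_surjective (x : doublePentagon.Point) : ∃ y, project y = x := by
  obtain ⟨i, z, hz, rfl⟩ := exists_double_rep x
  have hz' : sg i * z ∈ pentagon := (mem_poly (S := doublePentagon) i z).1 hz
  cases i
  · exact ⟨necklace.toPoint (sr 0) z ((mem_necklace_poly (sr 0) z).2 hz'), rfl⟩
  · exact ⟨necklace.toPoint (r 0) z ((mem_necklace_poly (r 0) z).2 hz'), rfl⟩

/-- The curve `q` lifts `p` on `J`, and moves with velocity `v`. -/
def IsLiftOn (v : ℂ) (p : ℝ → doublePentagon.Point) (q : ℝ → necklace.Point) (J : Set ℝ) : Prop :=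
  necklace.IsStraightOn v q J ∧ ∀ t ∈ J, project (q t) = p t

/-- On `J` the curve `p` can be lifted through every point above it. -/
def IsLiftable (v : ℂ) (p : ℝ → doublePentagon.Point) (J : Set ℝ) : Prop :=
  ∀ t ∈ J, ∀ x, project x = p t → ∃ q, IsLiftOn v p q J ∧ q t = x

variable {v : ℂ} {p : ℝ → doublePentagon.Point} {q : ℝ → necklace.Point} {J J' : Set ℝ}

theorem IsLiftOn.mono (h : IsLiftOn v p q J) (hJ : J' ⊆ J) : IsLiftOn v p q J' :=
  ⟨h.1.mono hJ, fun t ht => h.2 t (hJ ht)⟩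

theorem IsLiftOn.deck (h : IsLiftOn v p q J) (c : ZMod 5) : IsLiftOn v p (deck c ∘ q) J :=
  ⟨deck_isStraightOn c h.1, fun t ht => (project_deck c _).trans (h.2 t ht)⟩

theorem exists_local_lift (hp : doublePentagon.IsStraightOn v p univ) (t : ℝ) :
    ∃ ε > 0, ∃ q, IsLiftOn v p q (Ioo (t - ε) (t + ε)) := by
  obtain ⟨h0, ε, hε, ⟨i, z, hi⟩, ⟨j, w, hj⟩⟩ := hp t (mem_univ t)
  obtain ⟨x, hx⟩ := project_surjective (p t)
  have hn : x ∉ necklace.singular := project_not_mem_singular_iff.1 (hx ▸ h0)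
  have hi0 := hi 0 ⟨by linarith, le_rfl⟩
  have hj0 := hj 0 ⟨le_rfl, by linarith⟩
  rw [add_zero, Complex.ofReal_zero, zero_mul, add_zero] at hi0 hj0
  obtain ⟨hz, hz'⟩ := hi0
  obtain ⟨hw, hw'⟩ := hj0
  obtain ⟨g, hg, rfl, hxg⟩ := exists_rep_of_project (hx.trans hz') hn
  obtain ⟨h, hh, rfl, hxh⟩ := exists_rep_of_project (hx.trans hw') hn
  classical
  let pt (g : DihedralGroup 5) (z : ℂ) : necklace.Point :=
    if h : z ∈ necklace.poly g then necklace.toPoint g z h else x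
  have hpt : ∀ g z (h : z ∈ necklace.poly g), pt g z = necklace.toPoint g z h :=
    fun g z h => dif_pos h
  let q (s : ℝ) : necklace.Point :=
    if s ≤ t then pt g (z + (s - t : ℝ) * v) else pt h (w + (s - t : ℝ) * v)
  have mem : ∀ (g : DihedralGroup 5) z, z ∈ doublePentagon.poly (sheet g) → z ∈ necklace.poly g :=
    fun g z hz => (mem_necklace_poly g z).2 ((mem_poly (S := doublePentagon) _ z).1 hz)
  have q1 : ∀ s ∈ Icc (-ε) 0, ∃ h' : z + s * v ∈ necklace.poly g,
      q (t + s) = necklace.toPoint g _ h' := by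
    intro s hs
    obtain ⟨h1, -⟩ := hi s hs
    refine ⟨mem _ _ h1, ?_⟩
    have : t + s ≤ t := by linarith [hs.2]
    simp only [q, if_pos this, add_sub_cancel_left]
    exact hpt _ _ _
  have q2 : ∀ s ∈ Icc 0 ε, ∃ h' : w + s * v ∈ necklace.poly h,
      q (t + s) = necklace.toPoint h _ h' := by
    intro s hs
    obtain ⟨h1, -⟩ := hj s hs
    refine ⟨mem _ _ h1, ?_⟩
    rcases hs.1.eq_or_lt with rfl | hs0
    · obtain ⟨h2, h3⟩ := q1 0 ⟨by linarith, le_rfl⟩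
      rw [h3]
      have e : z + (0 : ℝ) * v = z := by simp
      have e' : w + (0 : ℝ) * v = w := by simp
      rw [necklace_toPoint_congr rfl e (hw := hg), necklace_toPoint_congr rfl e' (hw := hh),
        ← hxg, ← hxh]
    · have : ¬ t + s ≤ t := by linarith
      simp only [q, if_neg this, add_sub_cancel_left]
      exact hpt _ _ _
  have hpr : ∀ s ∈ Ioo (t - ε) (t + ε), project (q s) = p s := by
    intro s hs
    obtain ⟨r, rfl⟩ : ∃ r, s = t + r := ⟨s - t, by ring⟩
    rcases le_total r 0 with hr | hr
    · have hr' : r ∈ Icc (-ε) 0 := ⟨by linarith [hs.1], hr⟩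
      obtain ⟨h1, h2⟩ := q1 r hr'
      obtain ⟨h3, h4⟩ := hi r hr'
      rw [h2, h4, project_toPoint]
    · have hr' : r ∈ Icc 0 ε := ⟨hr, by linarith [hs.2]⟩
      obtain ⟨h1, h2⟩ := q2 r hr'
      obtain ⟨h3, h4⟩ := hj r hr'
      rw [h2, h4, project_toPoint]
  refine ⟨ε, hε, q, isStraightOn_of_runs ⟨g, z, q1⟩ ⟨h, w, q2⟩ fun s hs => ?_, hpr⟩
  rw [← project_not_mem_singular_iff, hpr s hs]
  exact (hp s (mem_univ s)).1

theorem IsLiftOn.isLiftable (h : IsLiftOn v p q J) (hp : doublePentagon.IsStraightOn v p univ) :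
    IsLiftable v p J := by
  intro t ht x hx
  have hn : x ∉ necklace.singular :=
    project_not_mem_singular_iff.1 (hx ▸ (hp t (mem_univ t)).1)
  obtain ⟨c, hc⟩ := exists_deck_eq hn (hx.trans (h.2 t ht).symm)
  exact ⟨_, h.deck c, hc.symm⟩

theorem exists_uniform_liftable (hp : doublePentagon.IsPeriodicTrajectory v p) :
    ∃ δ > 0, ∀ t, IsLiftable v p (Ioo (t - δ) (t + δ)) := by
  obtain ⟨hs, T, hT, hP⟩ := hp
  choose ε hε q hq using exists_local_lift hs
  obtain ⟨δ, hδ, h⟩ := lebesgue_number_lemma_of_metric (isCompact_Icc (a := (0 : ℝ)) (b := T))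
    (c := fun t => Ioo (t - ε t) (t + ε t)) (fun _ => isOpen_Ioo)
    fun t _ => mem_iUnion.2 ⟨t, by simp [hε t]⟩
  refine ⟨δ, hδ, fun t => ?_⟩
  have h0 : toIcoMod hT 0 t ∈ Icc 0 T := by
    have := toIcoMod_mem_Ico hT 0 t
    rw [zero_add] at this
    exact ⟨this.1, this.2.le⟩
  obtain ⟨t', ht'⟩ := h _ h0
  rw [Real.ball_eq_Ioo] at ht'
  set n := toIcoDiv hT 0 t
  have hm : toIcoMod hT 0 t = t - n * T := by
    rw [toIcoMod, zsmul_eq_mul]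
  rw [hm] at ht'
  have hper : ∀ s, p (s + -(n * T)) = p s := fun s => by
    rw [← sub_eq_add_neg]
    exact hP.sub_int_mul_eq n
  have key : IsLiftOn v p (fun s => q t' (s + -(n * T))) (Ioo (t - δ) (t + δ)) := by
    have sub : ∀ s ∈ Ioo (t - δ) (t + δ), s + -(n * T) ∈ Ioo (t' - ε t') (t' + ε t') := by
      intro s hs
      apply ht'
      constructor <;> linarith [hs.1, hs.2]
    refine ⟨((hq t').1.comp_add (-(n * T))).mono sub, fun s hs => ?_⟩
    rw [(hq t').2 _ (sub s hs), hper]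
  exact key.isLiftable hs

theorem IsLiftOn.concat {q' : ℝ → necklace.Point} {a b c d r : ℝ} (h : IsLiftOn v p q (Ioo a b))
    (h' : IsLiftOn v p q' (Ioo c d)) (hr : r ∈ Ioo a b) (hr' : r ∈ Ioo c d)
    (he : q r = q' r) (hac : a ≤ c) (hbd : b ≤ d) : IsLiftOn v p (concatAt b q q') (Ioo a d) := by
  refine ⟨concatAt_isStraightOn h.1 h'.1 hr hr' he hac hbd, fun s hs => ?_⟩
  rcases lt_or_ge s b with hsb | hsb
  · rw [concatAt, if_pos hsb]
    exact h.2 s ⟨hs.1, hsb⟩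
  · rw [concatAt, if_neg hsb.not_gt]
    exact h'.2 s ⟨(hr'.1.trans hr.2).trans_le hsb, hs.2⟩

theorem exists_lift_Ioo (hp : doublePentagon.IsPeriodicTrajectory v p) {x : necklace.Point}
    (hx : project x = p 0) (a : ℝ) : ∃ q, IsLiftOn v p q (Ioo (-a) a) ∧ q 0 = x := by
  obtain ⟨δ, hδ, hL⟩ := exists_uniform_liftable hp
  have key : ∀ n : ℕ, ∃ q, IsLiftOn v p q (Ioo (-(δ + n * (δ / 2))) (δ + n * (δ / 2))) ∧
      q 0 = x := by
    intro n
    induction n with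
    | zero =>
      obtain ⟨q, h1, h2⟩ := hL 0 0 ⟨by linarith, by linarith⟩ x hx
      refine ⟨q, ?_, h2⟩
      simpa using h1
    | succ n ih =>
      obtain ⟨q, h1, h2⟩ := ih
      set b := δ + n * (δ / 2) with hb
      have hnb : δ ≤ b := by
        have : 0 ≤ (n : ℝ) * (δ / 2) := by positivity
        linarith
      have hr : b - δ / 2 ∈ Ioo (-b) b := ⟨by linarith, by linarith⟩
      obtain ⟨q1, h3, h4⟩ := hL (b - δ / 2) (b - δ / 2) ⟨by linarith, by linarith⟩ _ (h1.2 _ hr)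
      have h5 := h1.concat h3 hr ⟨by linarith, by linarith⟩ h4.symm (by linarith) (by linarith)
      have e5 : concatAt b q q1 0 = x := by
        rw [concatAt, if_pos (by linarith), h2]
      set Q := concatAt b q q1
      have hr' : -b + δ / 2 ∈ Ioo (-b) (b - δ / 2 + δ) := ⟨by linarith, by linarith⟩
      obtain ⟨q2, h6, h7⟩ := hL (-b + δ / 2) (-b + δ / 2) ⟨by linarith, by linarith⟩ _
        (h5.2 _ hr')
      have h8 := h6.concat h5 ⟨by linarith, by linarith⟩ hr' h7 (by linarith) (by linarith)
      refine ⟨_, h8.mono (Ioo_subset_Ioo ?_ ?_), ?_⟩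
      · push_cast
        linarith
      · push_cast
        linarith
      · by_cases hc : (0 : ℝ) < -b + δ / 2 + δ
        · rw [(eqOn_concatAt h6.1 h5.1 ⟨by linarith, by linarith⟩ hr' h7 (by linarith)
            (by linarith)).2 ⟨by linarith, by linarith⟩, e5]
        · rw [concatAt, if_neg hc, e5]
  obtain ⟨n, hn⟩ := exists_nat_gt (a / (δ / 2))
  obtain ⟨q, h1, h2⟩ := key n
  rw [div_lt_iff₀ (by positivity)] at hn
  exact ⟨q, h1.mono (Ioo_subset_Ioo (by linarith) (by linarith)), h2⟩

/-- Periodic trajectories of the double pentagon lift to the necklace. -/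
theorem exists_lift (hp : doublePentagon.IsPeriodicTrajectory v p) {x : necklace.Point}
    (hx : project x = p 0) :
    ∃ q, necklace.IsStraightOn v q univ ∧ (∀ t, project (q t) = p t) ∧ q 0 = x := by
  have key : ∀ n : ℕ, ∃ q, IsLiftOn v p q (Ioo (-(n + 1 : ℝ)) (n + 1)) ∧ q 0 = x :=
    fun n => exists_lift_Ioo hp hx (n + 1)
  choose Q hQ hQ0 using key
  have agree : ∀ n m : ℕ, n ≤ m → EqOn (Q n) (Q m) (Ioo (-(n + 1 : ℝ)) (n + 1)) := by
    intro n m hnm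
    have h1 : (n : ℝ) ≤ m := by exact_mod_cast hnm
    have h0 : (0 : ℝ) ≤ n := by positivity
    exact (hQ n).1.eqOn ((hQ m).1.mono (Ioo_subset_Ioo (by linarith) (by linarith)))
      isPreconnected_Ioo (a := 0) ⟨by linarith, by linarith⟩ ((hQ0 n).trans (hQ0 m).symm)
  have hmem : ∀ t : ℝ, t ∈ Ioo (-((⌈|t|⌉₊ : ℕ) + 1 : ℝ)) ((⌈|t|⌉₊ : ℕ) + 1) := by
    intro t
    have := Nat.le_ceil |t|
    rw [mem_Ioo, ← abs_lt]
    linarith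
  let q (t : ℝ) := Q ⌈|t|⌉₊ t
  have hq : ∀ n : ℕ, EqOn q (Q n) (Ioo (-(n + 1 : ℝ)) (n + 1)) := by
    intro n t ht
    rcases le_total n ⌈|t|⌉₊ with h | h
    · exact (agree _ _ h ht).symm
    · exact agree _ _ h (hmem t)
  refine ⟨q, fun t _ => ?_, fun t => (hQ _).2 t (hmem t), ?_⟩
  · exact (hQ ⌈|t|⌉₊).1.congr isOpen_Ioo (hq _) t (hmem t)
  · exact hQ0 _

namespace GluedSurface

theorem IsStraightOn.exists_finite_runs {S : GluedSurface} {u : ℂ} {γ : ℝ → S.Point}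
    (h : S.IsStraightOn u γ univ) (T : ℝ) : ∃ R : Set (S.Piece × ℂ), R.Finite ∧
      ∀ t ∈ Icc (0 : ℝ) T, ∃ x ∈ R, ∃ h : x.2 + t * u ∈ S.poly x.1, γ t = S.toPoint x.1 _ h := by
  refine isCompact_Icc.induction_on (p := fun A : Set ℝ => ∃ R : Set (S.Piece × ℂ), R.Finite ∧
      ∀ t : ℝ, t ∈ A → ∃ x ∈ R, ∃ h : x.2 + t * u ∈ S.poly x.1, γ t = S.toPoint x.1 _ h)
    ⟨∅, finite_empty, fun t ht => ht.elim⟩ ?_ ?_ ?_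
  · rintro A B hAB ⟨R, hR, h1⟩
    exact ⟨R, hR, fun t ht => h1 t (hAB ht)⟩
  · rintro A B ⟨R, hR, h1⟩ ⟨R', hR', h2⟩
    refine ⟨R ∪ R', hR.union hR', ?_⟩
    rintro t (ht | ht)
    · obtain ⟨x, hx, h3⟩ := h1 t ht
      exact ⟨x, Or.inl hx, h3⟩
    · obtain ⟨x, hx, h3⟩ := h2 t ht
      exact ⟨x, Or.inr hx, h3⟩
  · intro t _
    obtain ⟨-, ε, hε, ⟨i, z, h1⟩, ⟨j, w, h2⟩⟩ := h t (mem_univ t)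
    refine ⟨Ioo (t - ε) (t + ε), mem_nhdsWithin_of_mem_nhds (Ioo_mem_nhds (by linarith)
      (by linarith)), {(i, z - t * u), (j, w - t * u)}, by simp, fun s hs => ?_⟩
    have e : ∀ z : ℂ, z + (s - t : ℝ) * u = z - t * u + s * u := fun z => by push_cast; ring
    rcases le_total s t with hst | hst
    · obtain ⟨h3, h4⟩ := h1 (s - t) ⟨by linarith [hs.1], by linarith⟩
      rw [add_sub_cancel] at h4
      refine ⟨(i, z - t * u), by simp, (e z) ▸ h3, ?_⟩
      rw [h4, toPoint_congr (e z)]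
    · obtain ⟨h3, h4⟩ := h2 (s - t) ⟨by linarith, by linarith [hs.2]⟩
      rw [add_sub_cancel] at h4
      refine ⟨(j, w - t * u), by simp, (e w) ▸ h3, ?_⟩
      rw [h4, toPoint_congr (e w)]

end GluedSurface

theorem norm_act (g : DihedralGroup 5) (z : ℂ) : ‖act g z‖ = ‖z‖ := by
  cases g <;> simp [act, norm_zeta]

theorem act_neg (g : DihedralGroup 5) (z : ℂ) : act g (-z) = -act g z := by
  cases g <;> simp [act]

theorem act_real_mul (g : DihedralGroup 5) (s : ℝ) (z : ℂ) : act g (s * z) = s * act g z := by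
  have h : act g 0 = 0 := by cases g <;> simp [act]
  have := act_smul_add g 0 z s
  rwa [zero_add, h, zero_add] at this

theorem edgeRefl_inv (k : ZMod 5) : (edgeRefl k)⁻¹ = edgeRefl k := inv_sr _

theorem act_edgeRefl_direction (k : ZMod 5) (c : ℝ) :
    act (edgeRefl k) (c * (zeta (k + 1) - zeta k)) = c * (zeta (k + 1) - zeta k) := by
  have h1 := act_smul_add (edgeRefl k) (zeta (k + 1)) (zeta k) (-1)
  have h2 : act (edgeRefl k) (zeta k) = -zeta (k + 1) := by
    rw [edgeRefl, act_sr_vertex]; congr 2; ring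
  have h3 : act (edgeRefl k) (zeta (k + 1)) = -zeta k := by
    rw [edgeRefl, act_sr_vertex]; congr 2; ring
  rw [h2, h3] at h1
  rw [act_real_mul]
  congr 1
  have e : zeta (k + 1) - zeta k = zeta (k + 1) + (-1 : ℝ) * zeta k := by push_cast; ring
  conv_lhs => rw [e, h1]
  push_cast
  ring

theorem act_edgeRefl_of_height {k : ZMod 5} {u : ℂ} (h : height k u = 0) :
    act (edgeRefl k) u = u := by
  obtain ⟨r, rfl⟩ := eq_smul_of_height_eq_zero h
  exact act_edgeRefl_direction k r

theorem isBilliardTrajectory_fold {v : ℂ} (hv : ‖v‖ = 1) {q : ℝ → necklace.Point}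
    (hq : necklace.IsStraightOn v q univ) : IsBilliardTrajectory (fold ∘ q) := by
  intro t
  obtain ⟨h0, ε, hε, ⟨g, z, h1⟩, ⟨h, w, h2⟩⟩ := hq t (mem_univ t)
  have g1 := h1 0 ⟨by linarith, le_rfl⟩
  have g2 := h2 0 ⟨le_rfl, by linarith⟩
  rw [add_zero, Complex.ofReal_zero, zero_mul, add_zero] at g1 g2
  obtain ⟨hz, hz'⟩ := g1
  obtain ⟨hw, hw'⟩ := g2
  change DihedralGroup 5 at g
  change DihedralGroup 5 at h
  have b1 : fold (q t) = act g⁻¹ z := by rw [hz', fold_toPoint]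
  have b2 : fold (q t) = act h⁻¹ w := by rw [hw', fold_toPoint]
  have r1 : ∀ s ∈ Icc (-ε) 0, fold (q (t + s)) = fold (q t) + s * act g⁻¹ v := by
    intro s hs
    obtain ⟨h3, h4⟩ := h1 s hs
    rw [h4, fold_toPoint, act_smul_add, b1]
  have r2 : ∀ s ∈ Icc 0 ε, fold (q (t + s)) = fold (q t) + s * act h⁻¹ v := by
    intro s hs
    obtain ⟨h3, h4⟩ := h2 s hs
    rw [h4, fold_toPoint, act_smul_add, b2]
  have hmem : ∀ s, fold (q s) ∈ pentagon := by
    intro s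
    obtain ⟨g', y, hy, hs⟩ := exists_necklace_rep (q s)
    rw [hs, fold_toPoint]
    obtain ⟨x, hx, rfl⟩ := hy
    exact (act_inv_act g' x).symm ▸ hx
  refine ⟨hmem t, ?_, ε, act g⁻¹ v, act h⁻¹ v, hε, by rw [norm_act, hv], r1, r2, ?_, ?_⟩
  · rintro ⟨k, hk⟩
    refine (toPoint_not_mem_singular_iff hz).1 (hz' ▸ h0) ⟨zeta k, ⟨k, rfl⟩, ?_⟩
    change zeta k = fold (q t) at hk
    rw [hk, b1]
    exact act_act_inv g z
  · intro hk
    rcases necklace_toPoint_eq_cases (hz'.symm.trans hw') (hz' ▸ h0) with ⟨rfl, -⟩ | ⟨m, hm, -, -⟩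
    · rfl
    · obtain ⟨k, -, h3⟩ := exists_of_mem_edge hm
      rw [← b1] at h3
      exact absurd h3 (hk k)
  · intro k hk
    change fold (q t) ∈ edge k at hk
    have hnv : fold (q t) ∉ range zeta := by
      rintro ⟨k, hk⟩
      refine (toPoint_not_mem_singular_iff hz).1 (hz' ▸ h0) ⟨zeta k, ⟨k, rfl⟩, ?_⟩
      rw [hk, b1]
      exact act_act_inv g z
    rcases necklace_toPoint_eq_cases (hz'.symm.trans hw') (hz' ▸ h0) with ⟨rfl, -⟩ | ⟨m, hm, hh, -⟩
    · symm
      apply act_edgeRefl_of_height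
      have e1 := height_le (hmem (t + ε)) k
      have e2 := height_le (hmem (t + -ε)) k
      rw [r2 ε ⟨hε.le, le_rfl⟩, ← Complex.real_smul, map_add, map_smul, height_edge hk,
        smul_eq_mul] at e1
      rw [r1 (-ε) ⟨le_rfl, by linarith⟩, ← Complex.real_smul, map_add, map_smul, height_edge hk,
        smul_eq_mul] at e2
      nlinarith
    · obtain ⟨k', rfl, h3⟩ := exists_of_mem_edge hm
      rw [← b1] at h3
      have hkk := edge_unique h3 hk hnv
      subst hkk
      have hh' : h = g * edgeRefl k' := hh.trans (mul_edgeRefl g k').symm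
      rw [hh', mul_inv_rev, edgeRefl_inv, act_mul]

theorem eq_one_or_of_act_eq {k : DihedralGroup 5} {v : ℂ} (hv : v ≠ 0) (h : act k v = v) :
    k = 1 ∨ ∃ m, k = edgeRefl m ∧ height m v = 0 := by
  rcases k with a | d
  · left
    have h1 : zeta a = zeta 0 := by
      rw [zeta_zero]
      exact mul_right_cancel₀ hv (h.trans (one_mul v).symm)
    rw [zeta_injective h1]
    rfl
  · right
    have hd : -(2 * (2 * d + 2) + 1) = d := by
      have h5 : (5 : ZMod 5) = 0 := rfl
      linear_combination (-d - 1) * h5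
    refine ⟨2 * d + 2, by rw [edgeRefl, hd], ?_⟩
    set m := 2 * d + 2
    have h1 : edgeSum m = zeta (-d) * (starRingEnd ℂ) (edgeSum m) := by
      have hd' : -d = 2 * m + 1 := by rw [← hd, neg_neg]
      rw [hd', edgeSum, map_add, conj_zeta, conj_zeta, mul_add, ← zeta_add, ← zeta_add, add_comm]
      congr 2 <;> ring
    have h2 : -(zeta (-d) * (starRingEnd ℂ) v) = v := h
    have h3 : v * (starRingEnd ℂ) (edgeSum m) =
        -(starRingEnd ℂ) (v * (starRingEnd ℂ) (edgeSum m)) := by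
      rw [map_mul, Complex.conj_conj]
      conv_lhs => rw [← h2]
      conv_rhs => rw [h1]
      ring
    have h4 := congrArg Complex.re h3
    rw [Complex.neg_re, Complex.conj_re] at h4
    rw [height_apply]
    linarith

theorem parallelToEdge_of_height {m : ZMod 5} {v : ℂ} (h : height m v = 0) : ParallelToEdge v := by
  obtain ⟨r, hr⟩ := eq_smul_of_height_eq_zero h
  exact ⟨m, r, hr⟩

section Lifts

variable {v : ℂ} {q q' : ℝ → necklace.Point}

theorem exists_deck_translate (hq : necklace.IsStraightOn v q univ)
    (hq' : necklace.IsStraightOn v q' univ) {a b : ℝ} (h : project (q a) = project (q' b)) :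
    ∃ c, ∀ s, q (s + a) = deck c (q' (s + b)) := by
  obtain ⟨c, hc⟩ := exists_deck_eq (hq a (mem_univ a)).1 h
  exact ⟨c, hq.translate_eq (deck_isStraightOn c hq') hc⟩

theorem exists_leftMul_of_fold_periodic (hq : necklace.IsStraightOn v q univ) {T : ℝ}
    (hT : Function.Periodic (fold ∘ q) T) : ∃ k, act k v = v ∧ q T = leftMul k (q 0) := by
  obtain ⟨-, ε, hε, -, g, z, h1⟩ := hq 0 (mem_univ _)
  obtain ⟨-, ε', hε', -, h, w, h2⟩ := hq T (mem_univ _)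
  change DihedralGroup 5 at g
  change DihedralGroup 5 at h
  have key : ∀ s ∈ Icc 0 (min ε ε'), act h⁻¹ (w + s * v) = act g⁻¹ (z + s * v) := by
    intro s hs
    obtain ⟨h3, h4⟩ := h1 s ⟨hs.1, hs.2.trans (min_le_left _ _)⟩
    obtain ⟨h5, h6⟩ := h2 s ⟨hs.1, hs.2.trans (min_le_right _ _)⟩
    have h7 := hT (0 + s)
    rw [Function.comp_apply, Function.comp_apply, zero_add, add_comm s T, h6] at h7
    rw [zero_add] at h4
    rw [h4, fold_toPoint, fold_toPoint] at h7
    exact h7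
  have hm : 0 < min ε ε' := lt_min hε hε'
  have k0 := key 0 ⟨le_rfl, hm.le⟩
  have k1 := key _ ⟨hm.le, le_rfl⟩
  rw [Complex.ofReal_zero, zero_mul, add_zero, add_zero] at k0
  rw [act_smul_add, act_smul_add, k0] at k1
  have k2 : act h⁻¹ v = act g⁻¹ v :=
    mul_left_cancel₀ (by exact_mod_cast hm.ne') ((add_right_inj _).1 k1)
  refine ⟨h * g⁻¹, by rw [act_mul, ← k2, act_act_inv], ?_⟩
  have g1 := h1 0 ⟨le_rfl, hε.le⟩
  have g2 := h2 0 ⟨le_rfl, hε'.le⟩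
  rw [add_zero, Complex.ofReal_zero, zero_mul, add_zero] at g1 g2
  obtain ⟨m1, m2⟩ := g1
  obtain ⟨m3, m4⟩ := g2
  rw [m2, m4]
  exact eq_leftMul_of_act_eq k0

theorem exists_leftMul_of_fold_mem_range (hv : ‖v‖ = 1) (hq : necklace.IsStraightOn v q univ)
    (hq' : necklace.IsStraightOn v q' univ) {T : ℝ} (hT : 0 < T) (hP : Function.Periodic q' T)
    (h : ∀ t, fold (q t) ∈ range (fold ∘ q')) :
    ∃ k t t', q t = leftMul k (q' t') ∧ (act k v = v ∨ act k v = -v) := by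
  obtain ⟨R, hR, hR'⟩ := hq'.exists_finite_runs T
  obtain ⟨-, ε, hε, -, f, y, h1⟩ := hq 0 (mem_univ _)
  change DihedralGroup 5 at f
  have key : ∀ s : Icc 0 ε, ∃ x : R, ∃ t : ℝ, ∃ h : x.1.2 + t * v ∈ necklace.poly x.1.1,
      q' t = necklace.toPoint x.1.1 _ h ∧ fold (q s) = fold (q' t) := by
    intro s
    obtain ⟨t, ht⟩ := h s
    have h0 := toIcoMod_mem_Ico hT 0 t
    rw [zero_add] at h0
    obtain ⟨x, hx, h2, h3⟩ := hR' _ ⟨h0.1, h0.2.le⟩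
    refine ⟨⟨x, hx⟩, _, h2, h3, ?_⟩
    rw [← ht, toIcoMod, zsmul_eq_mul, hP.sub_int_mul_eq]
    rfl
  choose x t hmem ht hfold using key
  have : Infinite (Icc (0 : ℝ) ε) := (Icc_infinite hε).to_subtype
  have : Finite R := hR
  obtain ⟨s, s', hss, he⟩ := Finite.exists_ne_map_eq_of_infinite x
  obtain ⟨⟨⟨g, z⟩, hx⟩, hg⟩ : ∃ x0 : R, x s = x0 := ⟨_, rfl⟩
  change DihedralGroup 5 at g
  have e1 : ∀ r : Icc 0 ε, x r = ⟨(g, z), hx⟩ → act f⁻¹ (y + (r : ℝ) * v) = act g⁻¹ (z + t r * v) ∧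
      ∃ hw hw', q r = necklace.toPoint f (y + (r : ℝ) * v) hw ∧
        q' (t r) = necklace.toPoint g (z + t r * v) hw' := by
    intro r hr
    obtain ⟨h3, h4⟩ := h1 r r.2
    rw [zero_add] at h4
    have h5 := hmem r
    have h6 := ht r
    have h7 := hfold r
    simp only [hr] at h5 h6
    rw [h4, h6] at h7
    exact ⟨h7, h3, h5, h4, h6⟩
  obtain ⟨f1, hw, hw', f2, f3⟩ := e1 s hg
  obtain ⟨f4, -⟩ := e1 s' (he ▸ hg)
  have hne : ((s : ℝ) - s' : ℝ) ≠ 0 := sub_ne_zero.2 fun h => hss (Subtype.ext h)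
  have hd : (((s : ℝ) - s' : ℝ) : ℂ) * act f⁻¹ v = ((t s - t s' : ℝ) : ℂ) * act g⁻¹ v := by
    rw [act_smul_add, act_smul_add] at f1 f4
    push_cast
    linear_combination f1 - f4
  have habs : |(s : ℝ) - s'| = |t s - t s'| := by
    have := congrArg norm hd
    rwa [norm_mul, norm_mul, norm_act, norm_act, hv, mul_one, mul_one, Complex.norm_real,
      Complex.norm_real] at this
  refine ⟨f * g⁻¹, s, t s, ?_, ?_⟩
  · rw [f2, f3]
    exact eq_leftMul_of_act_eq f1
  · have hne' : (((s : ℝ) - s' : ℝ) : ℂ) ≠ 0 := by exact_mod_cast hne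
    rcases abs_eq_abs.1 habs with h3 | h3
    · left
      rw [← h3] at hd
      rw [act_mul, ← mul_left_cancel₀ hne' hd, act_act_inv]
    · right
      have h4 : t s - t s' = -((s : ℝ) - s') := by linarith
      rw [h4] at hd
      have h5 : act f⁻¹ v = -act g⁻¹ v := by
        apply mul_left_cancel₀ hne'
        rw [hd]
        push_cast
        ring
      have h6 : act g⁻¹ v = -act f⁻¹ v := by rw [h5, neg_neg]
      rw [act_mul, h6, act_neg, act_act_inv]

end Lifts

theorem isSymmetricUnder_of_surjective {f : ℂ → ℂ} {β : ℝ → ℂ} (σ : ℝ → ℝ)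
    (hσ : Function.Surjective σ) (h : ∀ t, f (β t) = β (σ t)) :
    IsSymmetricUnder f (range β) := by
  rw [IsSymmetricUnder, ← range_comp, show f ∘ β = β ∘ σ from funext h, hσ.range_comp]

theorem IsSymmetricUnder.comp {f g : ℂ → ℂ} {A : Set ℂ} (hf : IsSymmetricUnder f A)
    (hg : IsSymmetricUnder g A) : IsSymmetricUnder (f ∘ g) A := by
  rw [IsSymmetricUnder, image_comp, hg, hf]

theorem bisectorReflection_comp (k k' : ZMod 5) :
    bisectorReflection k ∘ bisectorReflection k' = pentagonRotation (2 * (k - k')) := by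
  funext z
  simp only [bisectorReflection, pentagonRotation, Function.comp_apply, map_mul,
    Complex.conj_conj, conj_zeta, ← mul_assoc, ← zeta_add]
  congr 2
  ring

theorem rotation_comp_bisectorReflection (k k' : ZMod 5) :
    pentagonRotation k' ∘ bisectorReflection k = bisectorReflection (k + 3 * k') := by
  funext z
  simp only [bisectorReflection, pentagonRotation, Function.comp_apply, ← mul_assoc, ← zeta_add]
  congr 2
  have h5 : (5 : ZMod 5) = 0 := rfl
  linear_combination -k' * h5

theorem edgeSum_eq_mul_conj (m : ZMod 5) :
    edgeSum m = zeta (2 * m + 1) * (starRingEnd ℂ) (edgeSum m) := by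
  rw [edgeSum, map_add, conj_zeta, conj_zeta, mul_add, ← zeta_add, ← zeta_add, add_comm]
  congr 2 <;> ring

section Lifts

variable {v : ℂ} {p : ℝ → doublePentagon.Point} {q : ℝ → necklace.Point} {l : ℝ} {σ : ZMod 5}

theorem exists_monodromy (hq : necklace.IsStraightOn v q univ) (hpr : ∀ t, project (q t) = p t)
    (hl : Function.Periodic p l) : ∃ σ, ∀ t, q (t + l) = deck σ (q t) := by
  obtain ⟨c, hc⟩ := exists_deck_translate hq hq (a := l) (b := 0) (by
    rw [hpr, hpr]
    simpa using hl 0)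
  exact ⟨c, fun t => by simpa using hc t⟩

theorem monodromy_nat (hσ : ∀ t, q (t + l) = deck σ (q t)) (n : ℕ) (t : ℝ) :
    q (t + n * l) = deck (n * σ) (q t) := by
  induction n with
  | zero => simp [deck_zero]
  | succ n ih =>
    have : t + (n + 1 : ℕ) * l = t + n * l + l := by push_cast; ring
    rw [this, hσ, ih, deck_deck]
    congr 1
    push_cast
    ring

theorem monodromy_int (hσ : ∀ t, q (t + l) = deck σ (q t)) (n : ℤ) (t : ℝ) :
    q (t + n * l) = deck (n * σ) (q t) := by
  rcases Int.eq_nat_or_neg n with ⟨k, rfl | rfl⟩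
  · simpa using monodromy_nat hσ k t
  · have h := monodromy_nat hσ k (t + ((-k : ℤ) : ℝ) * l)
    have e : t + ((-k : ℤ) : ℝ) * l + k * l = t := by push_cast; ring
    rw [e] at h
    rw [h, deck_deck]
    have : (k : ZMod 5) * σ + ((-k : ℤ) : ZMod 5) * σ = 0 := by push_cast; ring
    rw [this, deck_zero]

theorem exists_int_of_project_eq (hp : doublePentagon.IsStraightOn v p univ)
    (hl : HasLength p l) (hσ : ∀ t, q (t + l) = deck σ (q t)) {a b : ℝ} (h : p a = p b) :
    ∃ n : ℤ, b = a + n * l ∧ q b = deck (n * σ) (q a) := by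
  obtain ⟨n, rfl⟩ := hl.exists_int_of_eq hp h
  exact ⟨n, rfl, monodromy_int hσ n a⟩

theorem exists_rep_midpoint (hq : necklace.IsStraightOn v q univ) {t : ℝ} {m : ZMod 5}
    (h : project (q t) = edgeMidpoint m) :
    ∃ (a : ZMod 5) (hz : edgeSum m / 2 ∈ necklace.poly (r a)),
      q t = necklace.toPoint (r a) (edgeSum m / 2) hz := by
  obtain ⟨g, hz, hg, he⟩ := exists_rep_of_project h (hq t (mem_univ t)).1
  rcases g with a | b
  · exact ⟨a, hz, he⟩
  · exact absurd hg (by simp [sheet])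

theorem half_edgeSum_mem_edge (m : ZMod 5) : edgeSum m / 2 ∈ edge m :=
  ⟨1 / 2, 1 / 2, by norm_num, by norm_num, by norm_num, by
    rw [edgeSum, Complex.real_smul, Complex.real_smul]; push_cast; ring⟩

theorem turn_midpoint (a m : ZMod 5) (hz : edgeSum m / 2 ∈ necklace.poly (r a)) :
    turn (2 * a - (2 * m + 1)) (necklace.toPoint (r a) (edgeSum m / 2) hz) =
      necklace.toPoint (r a) (edgeSum m / 2) hz := by
  have h : sg (sheet (r a)) * (edgeSum m / 2) ∈ edge m := by
    rw [sheet, sg_true]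
    exact half_edgeSum_mem_edge m
  have h1 := toPoint_nb_eq (S := necklace) hz (mem_poly_of_nb (S := necklace) (i := r a) h)
  refine (turn_toPoint _ hz).trans (Eq.trans (necklace_toPoint_congr ?_ ?_) h1.symm)
  · change sr (2 * a - (2 * m + 1) - a) = sr (a - (2 * m + 1))
    congr 1
    ring
  · change _ = edgeSum m / 2 - sg true * edgeSum m
    rw [sg_true]
    ring

theorem turn_reflect (hq : necklace.IsStraightOn v q univ) {c : ZMod 5} {t : ℝ}
    (h : turn c (q t) = q t) (s : ℝ) : q (t + s) = turn c (q (t - s)) :=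
  hq.reflect_eq (turn_isStraightOn c hq) (b := t) h.symm s

theorem exists_bisector_symmetry (hq : necklace.IsStraightOn v q univ) {c : ZMod 5} {t : ℝ}
    (h : turn c (q t) = q t) : ∃ k, IsSymmetricUnder (bisectorReflection k) (range (fold ∘ q)) := by
  refine ⟨2 * c + 2, isSymmetricUnder_of_surjective (fun s => 2 * t - s) (fun s =>
    ⟨2 * t - s, by ring⟩) fun s => ?_⟩
  have e1 : t + (t - s) = 2 * t - s := by ring
  have e2 : t - (t - s) = s := by ring
  have h1 := turn_reflect hq h (t - s)
  rw [e1, e2] at h1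
  rw [Function.comp_apply, Function.comp_apply, h1, fold_turn, bisectorReflection]
  congr 2
  have h5 : (5 : ZMod 5) = 0 := rfl
  linear_combination (c + 1) * h5

theorem exists_turn_fixed (hq : necklace.IsStraightOn v q univ) {t : ℝ} {m : ZMod 5}
    (h : project (q t) = edgeMidpoint m) : ∃ c, turn c (q t) = q t := by
  obtain ⟨a, hz, he⟩ := exists_rep_midpoint hq h
  exact ⟨_, by rw [he, turn_midpoint]⟩

theorem hasLength_of_lift (hpr : ∀ t, project (q t) = p t) (hl : HasLength p l)
    (hql : Function.Periodic q l) : HasLength q l :=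
  ⟨⟨hl.1.1, hql⟩, fun T hT => hl.2 ⟨hT.1, fun t => by rw [← hpr, ← hpr, hT.2 t]⟩⟩

theorem hasLength_fold (hv : v ≠ 0) (hpar : ¬ ParallelToEdge v)
    (hq : necklace.IsStraightOn v q univ) (hl : HasLength q l) : HasLength (fold ∘ q) l := by
  refine ⟨⟨hl.1.1, hl.1.2.comp fold⟩, fun T hT => hl.2 ⟨hT.1, ?_⟩⟩
  obtain ⟨k, hk, h⟩ := exists_leftMul_of_fold_periodic hq hT.2
  rcases eq_one_or_of_act_eq hv hk with rfl | ⟨m, -, hm⟩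
  · rw [leftMul_one] at h
    have := hq.periodic_of_eq h.symm
    rwa [sub_zero] at this
  · exact absurd (parallelToEdge_of_height hm) hpar

theorem deck_eq_zero_of_eq_leftMul_sr {k d : ZMod 5} {x : necklace.Point}
    (hx : x ∉ necklace.singular) (h : deck k x = leftMul (sr d) x) : k = 0 := by
  obtain ⟨g, z, hz, rfl⟩ := exists_necklace_rep x
  have hn : deck k (necklace.toPoint g z hz) ∉ necklace.singular :=
    (deckTile k).map_not_mem_singular hx
  rw [deck_toPoint] at h hn
  rw [leftMul_toPoint] at h
  rcases necklace_toPoint_eq_cases h hn with ⟨h1, -⟩ | ⟨m, h1, h2, h3⟩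
  · rcases g with a | b
    · rw [deckPiece, sr_mul_r] at h1
      exact absurd h1 (by simp)
    · rw [deckPiece, sr_mul_sr] at h1
      exact absurd h1 (by simp)
  · rw [sheet_deckPiece] at h3
    have h4 : act (sr d) (act (sr d) z) = z := by
      rw [← act_mul, sr_mul_self, act_one]
    have h5 : act (sr d) (z - sg (sheet g) * edgeSum m) =
        act (sr d) z - sg (sheet g) * act (sr d) (edgeSum m) := by
      rw [← act_sg_mul]
      have := act_smul_add (sr d) z (sg (sheet g) * edgeSum m) (-1)
      push_cast at this
      rw [neg_one_mul, neg_one_mul] at this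
      rw [sub_eq_add_neg, this, sub_eq_add_neg]
    rw [← h3, h4, h3] at h5
    have h6 : act (sr d) (edgeSum m) = -edgeSum m := by
      linear_combination sg (sheet g) * h5 -
        (edgeSum m + act (sr d) (edgeSum m)) * sg_mul_self (sheet g)
    have h7 : -(zeta (-d) * (starRingEnd ℂ) (edgeSum m)) = -edgeSum m := h6
    have h8 : zeta (-d) = zeta (2 * m + 1) := by
      have h0 : (starRingEnd ℂ) (edgeSum m) ≠ 0 := (map_ne_zero _).2 (edgeSum_ne_zero m)
      apply mul_right_cancel₀ h0
      rw [← edgeSum_eq_mul_conj, neg_inj.1 h7]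
    have h9 := zeta_injective h8
    rcases g with a | b
    · rw [deckPiece, sr_mul_r, necklaceNb] at h2
      have := DihedralGroup.sr.inj h2
      linear_combination -this - h9
    · rw [deckPiece, sr_mul_sr, necklaceNb] at h2
      have := DihedralGroup.r.inj h2
      linear_combination -this + h9

theorem exists_eq_sr_of_act_eq_neg {k : DihedralGroup 5} (hv : v ≠ 0) (h : act k v = -v) :
    ∃ d, k = sr d := by
  rcases k with a | d
  · exfalso
    have h1 : zeta a = -1 := mul_right_cancel₀ hv (h.trans (neg_one_mul v).symm)
    have h2 : zeta (a + a) = zeta 0 := by rw [zeta_add, h1, zeta_zero]; norm_num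
    have h3 : ∀ a : ZMod 5, a + a = 0 → a = 0 := by decide
    rw [h3 a (zeta_injective h2), zeta_zero] at h1
    norm_num at h1
  · exact ⟨d, rfl⟩

theorem not_isSymmetricUnder_rotation (hv : ‖v‖ = 1) (hpar : ¬ ParallelToEdge v)
    (hp : doublePentagon.IsStraightOn v p univ) (hq : necklace.IsStraightOn v q univ)
    (hpr : ∀ t, project (q t) = p t) (hl : HasLength p l) (hql : Function.Periodic q l)
    {k : ZMod 5} (hk : k ≠ 0) :
    ¬ IsSymmetricUnder (pentagonRotation k) (range (fold ∘ q)) := by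
  intro hsym
  have hv0 : v ≠ 0 := by
    rintro rfl
    simp at hv
  have h0 := deck_isStraightOn (-k) hq
  obtain ⟨g, t, t', h1, h2⟩ := exists_leftMul_of_fold_mem_range hv h0 hq hl.1.1 hql (by
    intro t
    rw [← hsym]
    refine ⟨_, mem_range_self t, ?_⟩
    rw [Function.comp_apply, Function.comp_apply, fold_deck, neg_neg]
    rfl)
  rcases h2 with h2 | h2
  · rcases eq_one_or_of_act_eq hv0 h2 with rfl | ⟨m, -, hm⟩
    · rw [leftMul_one, Function.comp_apply] at h1
      have h3 : p t = p t' := by rw [← hpr, ← hpr, ← h1, project_deck]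
      obtain ⟨n, hn⟩ := hl.exists_int_of_eq hp h3
      have h4 : q t' = q t := by
        rw [hn]
        exact hql.int_mul n t
      rw [h4] at h1
      exact hk (neg_eq_zero.1 (eq_zero_of_deck_eq (hq t (mem_univ t)).1 h1))
    · exact hpar (parallelToEdge_of_height hm)
  · obtain ⟨d, rfl⟩ := exists_eq_sr_of_act_eq_neg hv0 h2
    have h3 := leftMul_isStraightOn (sr d) hq
    rw [h2] at h3
    have h4 := h0.reflect_eq h3 h1 ((t' - t) / 2)
    have e1 : t + (t' - t) / 2 = (t + t') / 2 := by ring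
    have e2 : t' - (t' - t) / 2 = (t + t') / 2 := by ring
    rw [e1, e2] at h4
    exact hk (neg_eq_zero.1 (deck_eq_zero_of_eq_leftMul_sr (hq _ (mem_univ _)).1 h4))

end Lifts

section Cases

variable {v : ℂ} {p : ℝ → doublePentagon.Point} {q : ℝ → necklace.Point} {l : ℝ} {σ : ZMod 5}

theorem ne_zero_of_norm_eq_one {v : ℂ} (hv : ‖v‖ = 1) : v ≠ 0 := by
  rintro rfl
  simp at hv

theorem height_edgeSum_sub (e m : ZMod 5) : height e (edgeSum (2 * e - m) - edgeSum m) = 0 := by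
  rw [edgeSum, edgeSum, map_sub, map_add, map_add, height_zeta, height_zeta, height_zeta,
    height_zeta]
  have e1 : (zeta (2 * e - m - e)).re = (zeta (m - e)).re := by
    rw [← zeta_neg_re]; congr 2; ring
  have e2 : (zeta (2 * e - m - e - 1)).re = (zeta (m + 1 - e)).re := by
    rw [← zeta_neg_re]; congr 2; ring
  have e3 : (zeta (2 * e - m + 1 - e)).re = (zeta (m - e - 1)).re := by
    rw [← zeta_neg_re]; congr 2; ring
  have e4 : (zeta (2 * e - m + 1 - e - 1)).re = (zeta (m + 1 - e - 1)).re := by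
    rw [← zeta_neg_re]; congr 2; ring
  rw [e1, e2, e3, e4]
  ring

/-- A trajectory parallel to the edge `e` that meets the midpoint of the edge `m` goes on to the
midpoint of the mirror image of that edge. -/
theorem exists_opposite_midpoint (hv : v ≠ 0) (hq : necklace.IsStraightOn v q univ) {e m a : ZMod 5}
    {c t : ℝ} (hve : v = c * (zeta (e + 1) - zeta e)) {hz : edgeSum m / 2 ∈ necklace.poly (r a)}
    (h : q t = necklace.toPoint (r a) (edgeSum m / 2) hz) :
    m ≠ e ∧ ∃ (d : ℝ) (hz' : edgeSum (2 * e - m) / 2 ∈ necklace.poly (r a)),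
      q (t + d) = necklace.toPoint (r a) (edgeSum (2 * e - m) / 2) hz' := by
  constructor
  · rintro rfl
    refine hq.height_ne_zero hv h (m := m) ?_ ?_
    · change sg true * _ ∈ _
      rw [sg_true]
      exact half_edgeSum_mem_edge m
    · rw [hve, height_edge_direction]
  · obtain ⟨b, hb⟩ := eq_smul_of_height_eq_zero (height_edgeSum_sub e m)
    have hc : (c : ℂ) ≠ 0 := by
      intro h0
      rw [h0, zero_mul] at hve
      exact hv hve
    have e1 : edgeSum m / 2 + (b / (2 * c) : ℝ) * v = edgeSum (2 * e - m) / 2 := by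
      rw [hve]
      push_cast
      field_simp
      linear_combination -hb
    have hz' : edgeSum (2 * e - m) / 2 ∈ necklace.poly (r a) := by
      refine (mem_necklace_poly (r a) _).2 ?_
      rw [sheet, sg_true]
      exact edge_subset _ (half_edgeSum_mem_edge _)
    refine ⟨b / (2 * c), hz', ?_⟩
    rw [hq.eq_toPoint_of_mem h (s := b / (2 * c)) (e1.symm ▸ hz')]
    exact necklace_toPoint_congr rfl e1

theorem monodromy_ne_zero_of_parallel (hv : v ≠ 0) (hp : doublePentagon.IsStraightOn v p univ)
    (hq : necklace.IsStraightOn v q univ) (hpr : ∀ t, project (q t) = p t) (hl : HasLength p l)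
    (hσ : ∀ t, q (t + l) = deck σ (q t)) {t : ℝ} {m : ZMod 5} (hm : p t = edgeMidpoint m)
    (hpar : ParallelToEdge v) : σ ≠ 0 := by
  obtain ⟨e, c, hve⟩ := hpar
  obtain ⟨a, hz, he⟩ := exists_rep_midpoint hq ((hpr t).trans hm)
  obtain ⟨hne, d, hz', he'⟩ := exists_opposite_midpoint hv hq hve he
  have h1 := turn_reflect hq (t := t) (by rw [he, turn_midpoint]) (-0)
  have h2 := turn_reflect hq (t := t + d) (by rw [he', turn_midpoint]) d
  rw [add_sub_cancel_right, ← add_zero t] at h2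
  have h3 : turn (2 * a - (2 * m + 1)) (q t) = q t := by rw [he, turn_midpoint]
  rw [add_zero, ← h3, turn_turn] at h2
  rintro rfl
  have h4 : p t = p (t + d + d) := by rw [← hpr, ← hpr, h2, project_deck]
  obtain ⟨n, -, h5⟩ := exists_int_of_project_eq hp hl hσ h4
  rw [h2, mul_zero, deck_zero] at h5
  have h6 := eq_zero_of_deck_eq (hq t (mem_univ t)).1 h5
  have h7 : 4 * (m - e) = 0 := by linear_combination h6
  have h8 : ∀ x : ZMod 5, 4 * x = 0 → x = 0 := by decide
  exact hne (sub_eq_zero.1 (h8 _ h7))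

theorem hasLength_of_monodromy (hpr : ∀ t, project (q t) = p t)
    (hq : necklace.IsStraightOn v q univ) (hl : HasLength p l)
    (hσ : ∀ t, q (t + l) = deck σ (q t)) (hσ0 : σ ≠ 0) : HasLength q (5 * l) := by
  have hl0 := hl.1.1
  refine ⟨⟨by linarith, fun t => ?_⟩, fun T hT => ?_⟩
  · have h := monodromy_nat hσ 5 t
    have h5 : ((5 : ℕ) : ZMod 5) = 0 := rfl
    rw [h5, zero_mul, deck_zero] at h
    exact_mod_cast h
  · have h1 : Function.Periodic p T := fun t => by rw [← hpr, ← hpr, hT.2 t]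
    obtain ⟨n, rfl⟩ := hl.exists_int h1
    have h2 := monodromy_int hσ n 0
    rw [hT.2 0] at h2
    have h3 := eq_zero_of_deck_eq (hq 0 (mem_univ 0)).1 h2.symm
    have h4 : ∀ x y : ZMod 5, x * y = 0 → y ≠ 0 → x = 0 := by decide
    have h5 := (ZMod.intCast_zmod_eq_zero_iff_dvd n 5).1 (h4 _ _ h3 hσ0)
    have h6 : 0 < n := by
      have := pos_of_mul_pos_left hT.1 hl0.le
      exact_mod_cast this
    have h7 : (5 : ℤ) ≤ n := Int.le_of_dvd h6 (by exact_mod_cast h5)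
    have h8 : (5 : ℝ) ≤ n := by exact_mod_cast h7
    nlinarith

/-- In the direction of an edge, the trajectory is invariant under the reflection in that edge,
up to half its length. -/
theorem exists_half_period (hv : v ≠ 0) (hq : necklace.IsStraightOn v q univ)
    (hpr : ∀ t, project (q t) = p t) (hl : HasLength p l)
    (hσ : ∀ t, q (t + l) = deck σ (q t)) {t : ℝ} {m : ZMod 5} (hm : p t = edgeMidpoint m)
    (hσ0 : σ ≠ 0) {e : ZMod 5} {c : ℝ} (hve : v = c * (zeta (e + 1) - zeta e)) :
    ∀ s, leftMul (edgeRefl e) (q s) = q (s + 5 * l / 2) := by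
  obtain ⟨a, hz, he⟩ := exists_rep_midpoint hq ((hpr t).trans hm)
  obtain ⟨hne, d, hz', he'⟩ := exists_opposite_midpoint hv hq hve he
  have hR : act (edgeRefl e) v = v := by rw [hve, act_edgeRefl_direction]
  have hL := leftMul_isStraightOn (edgeRefl e) hq
  rw [hR] at hL
  have h0 : act (edgeRefl e) (edgeSum m / 2) = -(edgeSum (2 * e - m) / 2) := by
    have h1 := act_edgeSum (edgeRefl e) m
    have h2 : namedEdge (edgeRefl e) m = 2 * e - m := by
      rw [edgeRefl, namedEdge]
      ring
    rw [h2] at h1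
    have h3 : sg (sheet (edgeRefl e)) * act (edgeRefl e) (edgeSum m) =
        -act (edgeRefl e) (edgeSum m) := sg_false _
    have h4 := act_real_mul (edgeRefl e) (1 / 2) (edgeSum m)
    have h5 : ((1 / 2 : ℝ) : ℂ) * edgeSum m = edgeSum m / 2 := by push_cast; ring
    rw [h5] at h4
    rw [h4, ← h1, h3]
    push_cast
    ring
  have h1 : project ((leftMul (edgeRefl e) ∘ q) t) = project (q (t + d)) := by
    have hz2 : edgeSum (2 * e - m) / 2 ∈ doublePentagon.poly true := poly_necklace_subset (r a) hz'
    have h2 : sg true * (edgeSum (2 * e - m) / 2) ∈ edge (2 * e - m) := by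
      rw [sg_true]
      exact half_edgeSum_mem_edge _
    have h3 := toPoint_nb_eq (S := doublePentagon) hz2
      (mem_poly_of_nb (S := doublePentagon) (i := true) h2)
    rw [Function.comp_apply, he, he', leftMul_toPoint, project_toPoint, project_toPoint]
    refine Eq.trans ?_ h3.symm
    refine double_toPoint_congr rfl ?_
    rw [h0]
    change _ = edgeSum (2 * e - m) / 2 - sg true * _
    rw [sg_true]
    ring
  obtain ⟨k, hk⟩ := exists_deck_translate hL hq h1
  obtain ⟨n, hn⟩ : ∃ n : ℤ, (n : ZMod 5) * σ = k := by
    have h4 : ∀ x y : ZMod 5, y ≠ 0 → ∃ z, z * y = x := by decide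
    obtain ⟨z, hz⟩ := h4 k σ hσ0
    obtain ⟨n, rfl⟩ := ZMod.intCast_surjective z
    exact ⟨n, hz⟩
  have h2 : ∀ s, leftMul (edgeRefl e) (q s) = q (s + (d + n * l)) := by
    intro s
    have h3 := hk (s - t)
    rw [sub_add_cancel, ← hn, ← monodromy_int hσ] at h3
    rw [show s + (d + n * l) = s - t + (t + d) + n * l by ring, ← h3]
    rfl
  have h3 : Function.Periodic q (2 * (d + n * l)) := by
    intro s
    have h4 := h2 s
    have h5 := h2 (s + (d + n * l))
    rw [← h4, leftMul_leftMul] at h5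
    have h6 : edgeRefl e * edgeRefl e = 1 := sr_mul_self _
    rw [h6, leftMul_one] at h5
    rw [h5]
    congr 1
    ring
  have h5l := hasLength_of_monodromy hpr hq hl hσ hσ0
  obtain ⟨N, hN⟩ := h5l.exists_int h3
  have hd : ∀ k : ℤ, d + n * l ≠ k * (5 * l) := by
    intro k hk
    obtain ⟨s, g, z, hz, hs, hnot⟩ := hq.exists_not_mem_edge hv
    have h6 := h2 s
    rw [hk, h5l.1.2.int_mul k s, hs] at h6
    have h7 := (hq s (mem_univ s)).1
    rw [hs] at h7
    change DihedralGroup 5 at g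
    have h8 := (leftMul_toPoint (edgeRefl e) hz).symm.trans h6
    rcases necklace_toPoint_eq_cases h8.symm h7 with ⟨h9, -⟩ | ⟨j, h9, -⟩
    · have := mul_eq_right.1 h9.symm
      exact Bool.false_ne_true (congrArg sheet this)
    · exact hnot j h9
  intro s
  rw [h2]
  rcases Int.even_or_odd' N with ⟨k, rfl | rfl⟩
  · exfalso
    apply hd k
    push_cast at hN
    linarith
  · have : s + (d + n * l) = s + 5 * l / 2 + k * (5 * l) := by
      push_cast at hN
      linarith
    rw [this]
    exact h5l.1.2.int_mul k _

theorem eq_of_height_eq_zero {v : ℂ} (hv : v ≠ 0) {e m : ZMod 5} (he : height e v = 0)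
    (hm : height m v = 0) : e = m := by
  have h1 := act_edgeRefl_of_height he
  have h2 := act_edgeRefl_of_height hm
  have h3 : act (edgeRefl e * edgeRefl m) v = v := by rw [act_mul, h2, h1]
  rw [edgeRefl, edgeRefl, sr_mul_sr] at h3
  have h4 : zeta (-(2 * m + 1) - -(2 * e + 1)) = zeta 0 := by
    rw [zeta_zero]
    exact mul_right_cancel₀ hv (h3.trans (one_mul v).symm)
  have h5 := zeta_injective h4
  have h6 : ∀ e m : ZMod 5, -(2 * m + 1) - -(2 * e + 1) = 0 → e = m := by decide
  exact h6 e m h5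

theorem hasLength_fold_half (hv : v ≠ 0) (hq : necklace.IsStraightOn v q univ)
    (h5l : HasLength q (5 * l)) {e : ZMod 5} (he : height e v = 0)
    (hR : ∀ s, leftMul (edgeRefl e) (q s) = q (s + 5 * l / 2)) :
    HasLength (fold ∘ q) (5 * l / 2) := by
  have hl0 := h5l.1.1
  refine ⟨⟨by linarith, fun s => ?_⟩, fun T hT => ?_⟩
  · rw [Function.comp_apply, ← hR, fold_leftMul]
    rfl
  · have hT0 := hT.1
    obtain ⟨k, hk, h⟩ := exists_leftMul_of_fold_periodic hq hT.2
    rcases eq_one_or_of_act_eq hv hk with rfl | ⟨m, rfl, hm⟩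
    · rw [leftMul_one] at h
      have := hq.periodic_of_eq h.symm
      rw [sub_zero] at this
      have := h5l.2 ⟨hT0, this⟩
      linarith
    · rw [eq_of_height_eq_zero hv hm he, hR, zero_add] at h
      obtain ⟨n, hn⟩ := h5l.exists_int_of_eq hq h.symm
      have h1 : (-1 : ℤ) < n := by
        by_contra! h2
        have h3 : (n : ℝ) ≤ -1 := by exact_mod_cast h2
        nlinarith
      have h2 : (0 : ℝ) ≤ n := by exact_mod_cast Int.lt_iff_add_one_le.1 h1
      nlinarith

end Cases

theorem isPeriodicTrajectory_of_hasLength {v : ℂ} {q : ℝ → necklace.Point} {l : ℝ}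
    (hq : necklace.IsStraightOn v q univ) (hl : HasLength q l) :
    necklace.IsPeriodicTrajectory v q := ⟨hq, l, hl.1⟩

theorem lift_dichotomy {v : ℂ} (hv : ‖v‖ = 1) {p : ℝ → doublePentagon.Point}
    (hp : doublePentagon.IsPeriodicTrajectory v p)
    (hmid : ∃ (t : ℝ) (k : ZMod 5), p t = edgeMidpoint k) :
    ∃ l : ℝ, HasLength p l ∧
      ((∃ q : ZMod 5 → ℝ → necklace.Point,
          (∀ j, necklace.IsPeriodicTrajectory v (q j)) ∧
          (∀ i j, i ≠ j → Disjoint (Set.range (q i)) (Set.range (q j))) ∧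
          project ⁻¹' Set.range p = ⋃ j, Set.range (q j) ∧
          (∀ j, project ∘ q j = p ∧ Set.BijOn project (Set.range (q j)) (Set.range p) ∧
            HasLength (q j) l) ∧
          ∀ j, IsBilliardTrajectory (fold ∘ q j) ∧ HasLength (fold ∘ q j) l ∧
            (∃! k, IsSymmetricUnder (bisectorReflection k) (Set.range (fold ∘ q j))) ∧
            ∀ k, k ≠ 0 → ¬ IsSymmetricUnder (pentagonRotation k) (Set.range (fold ∘ q j))) ∨
        (∃ q : ℝ → necklace.Point,
          necklace.IsPeriodicTrajectory v q ∧
          project ⁻¹' Set.range p = Set.range q ∧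
          project ∘ q = p ∧
          HasLength q (5 * l) ∧
          IsBilliardTrajectory (fold ∘ q) ∧
          (¬ ParallelToEdge v → HasLength (fold ∘ q) (5 * l)) ∧
          (ParallelToEdge v → HasLength (fold ∘ q) (5 * l / 2)) ∧
          (∀ k, IsSymmetricUnder (bisectorReflection k) (Set.range (fold ∘ q))) ∧
          ∀ k, IsSymmetricUnder (pentagonRotation k) (Set.range (fold ∘ q)))) := by
  have hv0 := ne_zero_of_norm_eq_one hv
  obtain ⟨l, hl⟩ := hp.exists_length hv0
  obtain ⟨t, m, hm⟩ := hmid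
  obtain ⟨x, hx⟩ := project_surjective (p 0)
  obtain ⟨q, hq, hpr, -⟩ := exists_lift hp hx
  obtain ⟨σ, hσ⟩ := exists_monodromy hq hpr hl.1.2
  have hfib : ∀ y, project y ∈ range p → ∃ c s, y = deck c (q s) := by
    rintro y ⟨s, hs⟩
    have hn : y ∉ necklace.singular :=
      project_not_mem_singular_iff.1 (hs ▸ (hp.1 s (mem_univ s)).1)
    obtain ⟨c, hc⟩ := exists_deck_eq hn (hs.symm.trans (hpr s).symm)
    exact ⟨c, s, hc⟩
  refine ⟨l, hl, ?_⟩
  by_cases hσ0 : σ = 0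
  · left
    subst hσ0
    have hpar : ¬ ParallelToEdge v := fun hpar =>
      monodromy_ne_zero_of_parallel hv0 hp.1 hq hpr hl hσ hm hpar rfl
    have hper : Function.Periodic q l := fun s => by rw [hσ, deck_zero]
    have hQ : ∀ j, necklace.IsStraightOn v (deck j ∘ q) univ := fun j => deck_isStraightOn j hq
    have hQpr : ∀ j s, project ((deck j ∘ q) s) = p s := fun j s =>
      (project_deck j _).trans (hpr s)
    have hQper : ∀ j, Function.Periodic (deck j ∘ q) l := fun j => hper.comp _
    have hQl : ∀ j, HasLength (deck j ∘ q) l := fun j => hasLength_of_lift (hQpr j) hl (hQper j)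
    have hinj : ∀ i j s s', (deck i ∘ q) s = (deck j ∘ q) s' → q s = q s' := by
      intro i j s s' h
      have h1 : p s = p s' := by rw [← hQpr i, ← hQpr j, h]
      obtain ⟨n, hn, h2⟩ := exists_int_of_project_eq hp.1 hl hσ h1
      rw [h2, mul_zero, deck_zero]
    refine ⟨fun j => deck j ∘ q, fun j => isPeriodicTrajectory_of_hasLength (hQ j) (hQl j), ?_, ?_,
      fun j => ⟨funext (hQpr j), ⟨?_, ?_, ?_⟩, hQl j⟩, fun j =>
      ⟨isBilliardTrajectory_fold hv (hQ j), hasLength_fold hv0 hpar (hQ j) (hQl j), ?_, ?_⟩⟩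
    · intro i j hij
      rw [Set.disjoint_left]
      rintro _ ⟨s, rfl⟩ ⟨s', hs'⟩
      have h1 := hinj _ _ _ _ hs'
      change deck j (q s') = deck i (q s) at hs'
      rw [h1] at hs'
      have h2 := congrArg (deck (-j)) hs'
      rw [deck_deck, deck_deck, add_neg_cancel, deck_zero] at h2
      have h3 := eq_zero_of_deck_eq (hq s (mem_univ s)).1 h2.symm
      exact hij (by linear_combination h3)
    · ext y
      rw [mem_preimage, mem_iUnion]
      constructor
      · intro hy
        obtain ⟨c, s, rfl⟩ := hfib y hy
        exact ⟨c, s, rfl⟩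
      · rintro ⟨j, s, rfl⟩
        exact ⟨s, (hQpr j s).symm⟩
    · rintro _ ⟨s, rfl⟩
      exact ⟨s, (hQpr j s).symm⟩
    · rintro _ ⟨s, rfl⟩ _ ⟨s', rfl⟩ h
      rw [hQpr, hQpr] at h
      obtain ⟨n, hn⟩ := hl.exists_int_of_eq hp.1 h
      rw [hn]
      exact ((hQper j).int_mul n s).symm
    · rintro _ ⟨s, rfl⟩
      exact ⟨_, ⟨s, rfl⟩, hQpr j s⟩
    · obtain ⟨c, hc⟩ := exists_turn_fixed (hQ j) ((hQpr j t).trans hm)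
      obtain ⟨k, hk⟩ := exists_bisector_symmetry (hQ j) hc
      refine ⟨k, hk, fun k' hk' => ?_⟩
      by_contra hne
      have h1 := hk'.comp hk
      rw [bisectorReflection_comp] at h1
      refine not_isSymmetricUnder_rotation hv hpar hp.1 (hQ j) (hQpr j) hl (hQper j) ?_ h1
      have h2 : ∀ x : ZMod 5, 2 * x = 0 → x = 0 := by decide
      exact fun h => hne (sub_eq_zero.1 (h2 _ h))
    · exact fun k hk => not_isSymmetricUnder_rotation hv hpar hp.1 (hQ j) (hQpr j) hl (hQper j) hk
  · right
    have h5l := hasLength_of_monodromy hpr hq hl hσ hσ0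
    have hdeck : ∀ c, ∃ n : ℤ, ∀ s, deck c (q s) = q (s + n * l) := by
      intro c
      have h4 : ∀ x y : ZMod 5, y ≠ 0 → ∃ z, z * y = x := by decide
      obtain ⟨z, hz⟩ := h4 c σ hσ0
      obtain ⟨n, rfl⟩ := ZMod.intCast_surjective z
      exact ⟨n, fun s => by rw [monodromy_int hσ, hz]⟩
    have hrot : ∀ k, IsSymmetricUnder (pentagonRotation k) (range (fold ∘ q)) := by
      intro k
      obtain ⟨n, hn⟩ := hdeck (-k)
      refine isSymmetricUnder_of_surjective (fun s => s + n * l) (fun s => ⟨s - n * l, by ring⟩)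
        fun s => ?_
      rw [Function.comp_apply, Function.comp_apply, ← hn, fold_deck, neg_neg]
      rfl
    refine ⟨q, isPeriodicTrajectory_of_hasLength hq h5l, ?_, funext hpr, h5l,
      isBilliardTrajectory_fold hv hq, fun hpar => hasLength_fold hv0 hpar hq h5l, ?_, ?_, hrot⟩
    · ext y
      rw [mem_preimage]
      constructor
      · intro hy
        obtain ⟨c, s, rfl⟩ := hfib y hy
        obtain ⟨n, hn⟩ := hdeck c
        exact ⟨_, (hn s).symm⟩
      · rintro ⟨s, rfl⟩
        exact ⟨s, (hpr s).symm⟩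
    · rintro ⟨e, c, hve⟩
      refine hasLength_fold_half hv0 hq h5l ?_ (exists_half_period hv0 hq hpr hl hσ hm hσ0 hve)
      rw [hve, height_edge_direction]
    · intro k
      obtain ⟨c, hc⟩ := exists_turn_fixed hq ((hpr t).trans hm)
      obtain ⟨k0, hk0⟩ := exists_bisector_symmetry hq hc
      have h1 := (hrot (2 * (k - k0))).comp hk0
      rw [rotation_comp_bisectorReflection] at h1
      have h2 : k0 + 3 * (2 * (k - k0)) = k := by
        have h5 : (5 : ZMod 5) = 0 := rfl
        linear_combination (k - k0) * h5
      rwa [h2] at h1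

/-- The coordinate transverse to the direction `v`. -/
noncomputable def crossing (v : ℂ) : ℂ →ₗ[ℝ] ℝ where
  toFun z := (z * (starRingEnd ℂ) v).im
  map_add' x y := by rw [add_mul, Complex.add_im]
  map_smul' c x := by simp [mul_assoc]

theorem crossing_apply (v z : ℂ) : crossing v z = (z * (starRingEnd ℂ) v).im := rfl

theorem mul_conj_of_norm_one {v : ℂ} (hv : ‖v‖ = 1) : v * (starRingEnd ℂ) v = 1 := by
  rw [Complex.mul_conj, Complex.normSq_eq_norm_sq, hv]
  simp

theorem crossing_self (v : ℂ) : crossing v v = 0 := by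
  rw [crossing_apply, Complex.mul_conj, Complex.ofReal_im]

theorem crossing_I_mul {v : ℂ} (hv : ‖v‖ = 1) : crossing v (I * v) = 1 := by
  rw [crossing_apply, mul_assoc, mul_conj_of_norm_one hv, mul_one, Complex.I_im]

theorem crossing_add_mul (v z u : ℂ) (s : ℝ) :
    crossing v (z + s * u) = crossing v z + s * crossing v u := by
  rw [← Complex.real_smul, map_add, map_smul, smul_eq_mul]

theorem abs_crossing_le {v : ℂ} (hv : ‖v‖ = 1) (z : ℂ) : |crossing v z| ≤ ‖z‖ := by
  refine (Complex.abs_im_le_norm _).trans ?_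
  rw [norm_mul, RCLike.norm_conj, hv, mul_one]

theorem exists_eq_add_of_crossing_eq {v z w : ℂ} (hv : ‖v‖ = 1)
    (h : crossing v z = crossing v w) : ∃ r : ℝ, z = w + r * v := by
  have h1 : ((z - w) * (starRingEnd ℂ) v).im = 0 := by
    rw [← crossing_apply, map_sub, h, sub_self]
  refine ⟨((z - w) * (starRingEnd ℂ) v).re, ?_⟩
  have h2 : ((((z - w) * (starRingEnd ℂ) v).re : ℝ) : ℂ) = (z - w) * (starRingEnd ℂ) v :=
    Complex.ext (Complex.ofReal_re _) (by rw [Complex.ofReal_im, h1])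
  rw [h2]
  linear_combination (w - z) * mul_conj_of_norm_one hv

/-- The parity of the number of elements of a finite set of reals that lie below `c`. -/
noncomputable def parityBelow (F : Finset ℝ) (c : ℝ) : ZMod 2 := ∑ y ∈ F, if y < c then 1 else 0

section Parity

variable {F : Finset ℝ}

theorem parityBelow_congr {a b : ℝ} (h : ∀ y ∈ F, y < a ↔ y < b) :
    parityBelow F a = parityBelow F b :=
  Finset.sum_congr rfl fun y hy => by simp only [h y hy]

theorem parityBelow_eq_zero {a : ℝ} (h : ∀ y ∈ F, a ≤ y) : parityBelow F a = 0 :=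
  Finset.sum_eq_zero fun y hy => if_neg (h y hy).not_gt

theorem parityBelow_eq_of_forall_not_mem {a b : ℝ} (h : ∀ y ∈ uIcc a b, y ∉ F) :
    parityBelow F a = parityBelow F b := by
  refine parityBelow_congr fun y hy => ?_
  constructor
  · intro h1
    by_contra! h2
    exact h y (mem_uIcc.2 (Or.inr ⟨h2, h1.le⟩)) hy
  · intro h1
    by_contra! h2
    exact h y (mem_uIcc.2 (Or.inl ⟨h2, h1.le⟩)) hy

theorem exists_isolating (F : Finset ℝ) (x : ℝ) : ∃ ε > 0, ∀ y ∈ F, |y - x| < ε → y = x := by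
  have h : ∀ᶠ z in nhds x, ∀ y ∈ F, z = y → y = x := by
    refine (Filter.eventually_all_finset F).2 fun y _ => ?_
    by_cases hyx : y = x
    · exact Filter.Eventually.of_forall fun _ _ => hyx
    · filter_upwards [isOpen_ne.mem_nhds (Ne.symm hyx)] with z hz hzy
      exact absurd hzy hz
  obtain ⟨ε, hε, h1⟩ := Metric.eventually_nhds_iff.1 h
  exact ⟨ε, hε, fun y hy hyx => h1 (by rwa [Real.dist_eq]) y hy rfl⟩

theorem parityBelow_add {x ε s : ℝ} (hx : x ∈ F) (h : ∀ y ∈ F, |y - x| < ε → y = x)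
    (h0 : 0 < s) (hs : s < ε) : parityBelow F (x + s) = parityBelow F x + 1 := by
  have h1 : (1 : ZMod 2) = ∑ y ∈ F, if y = x then 1 else 0 := by
    rw [Finset.sum_ite_eq' F x, if_pos hx]
  rw [h1, parityBelow, parityBelow, ← Finset.sum_add_distrib]
  refine Finset.sum_congr rfl fun y hy => ?_
  rcases lt_trichotomy y x with h2 | rfl | h2
  · simp [h2, h2.ne, h2.trans (lt_add_of_pos_right x h0)]
  · simp [h0]
  · have h3 : ¬ y < x + s := fun h3 => h2.ne' (h y hy (by
      rw [abs_lt]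
      constructor <;> linarith))
    simp [h2.ne', h2.not_gt, h3]

theorem parityBelow_sub {x ε s : ℝ} (h : ∀ y ∈ F, |y - x| < ε → y = x)
    (h0 : 0 < s) (hs : s < ε) : parityBelow F (x - s) = parityBelow F x := by
  refine parityBelow_congr fun y hy => ⟨fun h1 => by linarith, fun h1 => ?_⟩
  by_contra! h2
  exact h1.ne (h y hy (by rw [abs_lt]; constructor <;> linarith))

/-- Between two points, elements that occur in pairs do not affect the parity. -/
theorem parityBelow_eq_add {a b : ℝ} (hab : a < b) (h : ∀ y ∈ F, a < y → y < b → a + b - y ∈ F)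
    (hmid : (a + b) / 2 ∉ F) : parityBelow F b = parityBelow F a + if a ∈ F then 1 else 0 := by
  have h1 : (if a ∈ F then (1 : ZMod 2) else 0) = ∑ y ∈ F, if y = a then 1 else 0 :=
    (Finset.sum_ite_eq' F a fun _ => (1 : ZMod 2)).symm
  have h2 : ∑ y ∈ F with a < y ∧ y < b, (1 : ZMod 2) = 0 := by
    refine Finset.sum_involution (fun y _ => a + b - y) (fun y _ => by decide) ?_ ?_ ?_
    · intro y hy _ he
      apply hmid
      rw [show (a + b) / 2 = y by linarith]
      exact (Finset.mem_filter.1 hy).1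
    · intro y hy
      rw [Finset.mem_filter] at hy ⊢
      exact ⟨h y hy.1 hy.2.1 hy.2.2, by linarith [hy.2.2], by linarith [hy.2.1]⟩
    · intro y hy
      ring
  rw [Finset.sum_filter] at h2
  suffices h3 : parityBelow F b = parityBelow F a + (∑ y ∈ F, if y = a then 1 else 0) +
      ∑ y ∈ F, if a < y ∧ y < b then 1 else 0 by rw [h3, h2, add_zero, h1]
  rw [parityBelow, parityBelow, ← Finset.sum_add_distrib, ← Finset.sum_add_distrib]
  refine Finset.sum_congr rfl fun y hy => ?_
  rcases lt_trichotomy y a with h3 | rfl | h3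
  · simp [h3, h3.ne, h3.not_gt, h3.trans hab]
  · simp [hab]
  · simp [h3, h3.ne', h3.not_gt]

end Parity

/-- A set of points of the double pentagon that consists of trajectories, is invariant under the
involution and contains no midpoint of an edge. -/
structure IsSymmetricCurve (v : ℂ) (C : Set doublePentagon.Point) : Prop where
  exists_trajectory : ∀ x ∈ C, ∃ (γ : ℝ → doublePentagon.Point) (t : ℝ),
    doublePentagon.IsStraightOn v γ univ ∧ γ t = x ∧ ∀ s, γ s ∈ C
  invol_mem : ∀ x ∈ C, invol x ∈ C
  midpoint_not_mem : ∀ k, edgeMidpoint k ∉ C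

/-- The crossing coordinates of the chords of a set in the first pentagon. -/
def crossings (v : ℂ) (C : Set doublePentagon.Point) : Set ℝ :=
  {x | ∃ (z : ℂ) (hz : z ∈ doublePentagon.poly true), doublePentagon.toPoint true z hz ∈ C ∧
    crossing v z = x}

theorem sg_mul_mem_poly_true {i : Bool} {z : ℂ} (hz : z ∈ doublePentagon.poly i) :
    sg i * z ∈ doublePentagon.poly true := by
  refine (mem_poly (S := doublePentagon) true _).2 ?_
  change sg true * (sg i * z) ∈ pentagon
  rw [sg_true]
  exact (mem_poly (S := doublePentagon) i z).1 hz

theorem mem_poly_true_iff {z : ℂ} : z ∈ doublePentagon.poly true ↔ z ∈ pentagon := by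
  refine (mem_poly (S := doublePentagon) true z).trans ?_
  change sg true * z ∈ pentagon ↔ _
  rw [sg_true]

theorem finite_crossings_range {v : ℂ} {γ : ℝ → doublePentagon.Point}
    (hγ : doublePentagon.IsPeriodicTrajectory v γ) : (crossings v (range γ)).Finite := by
  obtain ⟨hs, T, hT, hP⟩ := hγ
  obtain ⟨R, hR, h⟩ := hs.exists_finite_runs T
  refine ((hR.image fun x => crossing v x.2).union
    (hR.image2 (fun x m => crossing v x.2 + crossing v (edgeSum m))
      (finite_univ : (univ : Set (ZMod 5)).Finite))).subset ?_
  rintro _ ⟨z, hz, ⟨t, ht⟩, rfl⟩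
  obtain ⟨t', ht', he⟩ := hP.exists_mem_Ico₀ hT t
  obtain ⟨x, hx, h1, h2⟩ := h t' ⟨ht'.1, ht'.2.le⟩
  have hn : doublePentagon.toPoint true z hz ∉ doublePentagon.singular :=
    ht ▸ (hs t (mem_univ t)).1
  have h3 : crossing v (x.2 + t' * v) = crossing v x.2 := by
    rw [crossing_add_mul, crossing_self, mul_zero, add_zero]
  rcases toPoint_eq_cases (ht.symm.trans (he.trans h2)) hn with ⟨-, h4⟩ | ⟨m, -, -, h4⟩
  · left
    exact ⟨x, hx, by rw [h4, h3]⟩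
  · right
    refine ⟨x, hx, m, mem_univ m, ?_⟩
    change _ = z - sg true * edgeSum m at h4
    rw [sg_true] at h4
    dsimp only
    rw [← h3, h4, map_sub, sub_add_cancel]

namespace IsSymmetricCurve

variable {v : ℂ} {C : Set doublePentagon.Point}

theorem not_mem_singular (hC : IsSymmetricCurve v C) {x : doublePentagon.Point} (hx : x ∈ C) :
    x ∉ doublePentagon.singular := by
  obtain ⟨γ, t, h1, rfl, -⟩ := hC.exists_trajectory x hx
  exact (h1 t (mem_univ t)).1

theorem toPoint_true_mem_iff (hC : IsSymmetricCurve v C) (hv : ‖v‖ = 1) {z : ℂ}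
    (hz : z ∈ doublePentagon.poly true) :
    doublePentagon.toPoint true z hz ∈ C ↔ crossing v z ∈ crossings v C := by
  refine ⟨fun h => ⟨z, hz, h, rfl⟩, ?_⟩
  rintro ⟨w, hw, h, he⟩
  obtain ⟨r, rfl⟩ := exists_eq_add_of_crossing_eq hv he.symm
  obtain ⟨γ, t, h1, h2, h3⟩ := hC.exists_trajectory _ h
  rw [← h1.eq_toPoint_of_mem h2 hz]
  exact h3 _

theorem toPoint_mem_iff (hC : IsSymmetricCurve v C) (hv : ‖v‖ = 1) {i : Bool} {z : ℂ}
    (hz : z ∈ doublePentagon.poly i) :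
    doublePentagon.toPoint i z hz ∈ C ↔ crossing v (sg i * z) ∈ crossings v C := by
  rw [← hC.toPoint_true_mem_iff hv (sg_mul_mem_poly_true hz)]
  rcases i with _ | _
  · have h : invol (doublePentagon.toPoint false z hz) =
        doublePentagon.toPoint true (sg false * z) (sg_mul_mem_poly_true hz) := by
      rw [invol_toPoint]
      exact double_toPoint_congr rfl (sg_false z).symm
    rw [← h]
    refine ⟨hC.invol_mem _, fun h1 => ?_⟩
    have := hC.invol_mem _ h1
    rwa [invol_invol] at this
  · rw [double_toPoint_congr rfl (sg_true z)]

theorem crossing_zeta_not_mem (hC : IsSymmetricCurve v C) (hv : ‖v‖ = 1) (k : ZMod 5) :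
    crossing v (zeta k) ∉ crossings v C := by
  have hz : zeta k ∈ doublePentagon.poly true := mem_poly_true_iff.2 (zeta_mem_pentagon k)
  rw [← hC.toPoint_true_mem_iff hv hz]
  intro h
  refine hC.not_mem_singular h ⟨true, zeta k, hz, ?_, rfl⟩
  refine (mem_vertex (S := doublePentagon) true _).2 ?_
  change sg true * zeta k ∈ _
  rw [sg_true]
  exact mem_range_self k

theorem crossing_edgeSum_sub_mem (hC : IsSymmetricCurve v C) (hv : ‖v‖ = 1) {m : ZMod 5} {z : ℂ}
    (hz : z ∈ edge m) (h : crossing v z ∈ crossings v C) :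
    crossing v (edgeSum m - z) ∈ crossings v C := by
  have hz1 : z ∈ doublePentagon.poly true := mem_poly_true_iff.2 (edge_subset m hz)
  have hz2 : sg (side (S := doublePentagon) true) * z ∈ edge m := by
    change sg true * z ∈ _
    rwa [sg_true]
  have h1 := sg_nb_mul (S := doublePentagon) true m z
  have h2 := toPoint_nb_eq hz1 (mem_poly_of_nb hz2)
  rw [← hC.toPoint_true_mem_iff hv hz1, h2] at h
  have h3 := (hC.toPoint_mem_iff hv (mem_poly_of_nb hz2)).1 h
  change sg (nb (S := doublePentagon) true m) * _ = _ - sg true * z at h1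
  rw [sg_true] at h1
  rwa [← h1]

theorem crossing_half_edgeSum_not_mem (hC : IsSymmetricCurve v C) (hv : ‖v‖ = 1) (m : ZMod 5) :
    crossing v (edgeSum m / 2) ∉ crossings v C := fun h =>
  hC.midpoint_not_mem m ((hC.toPoint_true_mem_iff hv
    (mem_poly_true_iff.2 (midpoint_mem_pentagon m))).2 h)

theorem parityBelow_edge_of_lt (hC : IsSymmetricCurve v C) (hv : ‖v‖ = 1) {F : Finset ℝ}
    (hF : ∀ x, x ∈ F ↔ x ∈ crossings v C) {m : ZMod 5} {z : ℂ} (hz : z ∈ edge m)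
    (hlt : crossing v z < crossing v (edgeSum m - z)) :
    parityBelow F (crossing v (edgeSum m - z)) =
      parityBelow F (crossing v z) + if crossing v z ∈ F then 1 else 0 := by
  have hsum : crossing v z + crossing v (edgeSum m - z) = crossing v (edgeSum m) := by
    rw [← map_add, add_sub_cancel]
  refine parityBelow_eq_add hlt (fun y hy h1 h2 => ?_) ?_
  · set r : ℝ := (y - crossing v z) / (crossing v (edgeSum m - z) - crossing v z) with hr
    have hd : 0 < crossing v (edgeSum m - z) - crossing v z := sub_pos.2 hlt
    have hr0 : 0 ≤ r := div_nonneg (by linarith) hd.le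
    have hr1 : r ≤ 1 := (div_le_one hd).2 (by linarith)
    have h3 : z + r • (edgeSum m - z - z) ∈ edge m :=
      (convex_segment _ _).add_smul_sub_mem hz (edgeSum_sub_mem hz) ⟨hr0, hr1⟩
    have h4 : crossing v (z + r • (edgeSum m - z - z)) = y := by
      rw [map_add, map_smul, map_sub _ (edgeSum m - z), smul_eq_mul, hr, div_mul_cancel₀ _ hd.ne']
      ring
    have h5 := hC.crossing_edgeSum_sub_mem hv h3 (by rw [h4]; exact (hF y).1 hy)
    rw [map_sub _ (edgeSum m), h4] at h5
    rw [hsum]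
    exact (hF _).2 h5
  · rw [hsum, hF]
    have h3 : crossing v (edgeSum m) / 2 = crossing v (edgeSum m / 2) := by
      have : edgeSum m / 2 = ((1 / 2 : ℝ)) • edgeSum m := by
        rw [Complex.real_smul]
        push_cast
        ring
      rw [this, map_smul, smul_eq_mul]
      ring
    rw [h3]
    exact hC.crossing_half_edgeSum_not_mem hv m

theorem parityBelow_edge (hC : IsSymmetricCurve v C) (hv : ‖v‖ = 1) {F : Finset ℝ}
    (hF : ∀ x, x ∈ F ↔ x ∈ crossings v C) {m : ZMod 5} {z : ℂ} (hz : z ∈ edge m)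
    (hn : crossing v z ∉ F) :
    parityBelow F (crossing v (edgeSum m - z)) = parityBelow F (crossing v z) := by
  rcases lt_trichotomy (crossing v z) (crossing v (edgeSum m - z)) with h | h | h
  · rw [hC.parityBelow_edge_of_lt hv hF hz h, if_neg hn, add_zero]
  · rw [h]
  · have hz' := edgeSum_sub_mem hz
    have h1 : crossing v (edgeSum m - z) ∉ F := by
      rw [hF] at hn ⊢
      intro h2
      have := hC.crossing_edgeSum_sub_mem hv hz' h2
      rw [sub_sub_cancel] at this
      exact hn this
    have h2 := hC.parityBelow_edge_of_lt hv hF hz' (by rwa [sub_sub_cancel])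
    rw [sub_sub_cancel, if_neg h1, add_zero] at h2
    exact h2.symm

/-- Near the vertices the parity is even. -/
theorem exists_parityBelow_zeta (hC : IsSymmetricCurve v C) (hv : ‖v‖ = 1) {F : Finset ℝ}
    (hF : ∀ x, x ∈ F ↔ x ∈ crossings v C) :
    ∃ d > 0, ∀ k z, dist z (zeta k) < d → parityBelow F (crossing v z) = 0 := by
  have hn : ∀ k, crossing v (zeta k) ∉ F := fun k => by
    rw [hF]
    exact hC.crossing_zeta_not_mem hv k
  have hstep : ∀ k, parityBelow F (crossing v (zeta (k + 1))) =
      parityBelow F (crossing v (zeta k)) := by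
    intro k
    have := hC.parityBelow_edge hv hF (left_mem_segment ℝ (zeta k) (zeta (k + 1))) (hn k)
    rwa [edgeSum, add_sub_cancel_left] at this
  have hall : ∀ n : ℕ, parityBelow F (crossing v (zeta n)) =
      parityBelow F (crossing v (zeta 0)) := by
    intro n
    induction n with
    | zero => rw [Nat.cast_zero]
    | succ n ih => rw [Nat.cast_succ, hstep, ih]
  have hall' : ∀ k : ZMod 5, parityBelow F (crossing v (zeta k)) =
      parityBelow F (crossing v (zeta 0)) := fun k => by
    rw [← ZMod.natCast_zmod_val k]
    exact hall _
  obtain ⟨k₀, hk₀⟩ := Finite.exists_min fun k => crossing v (zeta k)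
  have hlow : pentagon ⊆ {z | crossing v (zeta k₀) ≤ crossing v z} := by
    apply convexHull_min
    · rintro _ ⟨k, rfl⟩
      exact hk₀ k
    · exact convex_halfSpace_ge (crossing v).isLinear _
  have hzero : ∀ k, parityBelow F (crossing v (zeta k)) = 0 := by
    intro k
    rw [hall', ← hall' k₀]
    refine parityBelow_eq_zero fun y hy => ?_
    obtain ⟨z, hz, -, rfl⟩ := (hF y).1 hy
    exact hlow (mem_poly_true_iff.1 hz)
  choose ε hε h using fun k => exists_isolating F (crossing v (zeta k))
  obtain ⟨k₁, hk₁⟩ := Finite.exists_min ε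
  refine ⟨ε k₁, hε k₁, fun k z hz => ?_⟩
  rw [← hzero k]
  refine parityBelow_eq_of_forall_not_mem fun y hy hyF => hn k ?_
  rw [← h k y hyF ?_]
  · exact hyF
  have h1 : |crossing v z - crossing v (zeta k)| < ε k := by
    rw [← map_sub]
    refine (abs_crossing_le hv _).trans_lt ?_
    rw [← dist_eq_norm]
    exact hz.trans_le (hk₁ k)
  refine lt_of_le_of_lt ?_ h1
  rw [uIcc_comm] at hy
  exact abs_sub_left_of_mem_uIcc hy

end IsSymmetricCurve

/-- The points in front of which there is an odd number of chords. -/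
def IsOddPoint (v : ℂ) (F : Finset ℝ) (x : doublePentagon.Point) : Prop :=
  ∃ (i : Bool) (z : ℂ) (hz : z ∈ doublePentagon.poly i), x = doublePentagon.toPoint i z hz ∧
    parityBelow F (crossing v (sg i * z)) = 1

namespace IsSymmetricCurve

variable {v : ℂ} {C : Set doublePentagon.Point} {F : Finset ℝ}

theorem isOddPoint_iff (hC : IsSymmetricCurve v C) (hv : ‖v‖ = 1)
    (hF : ∀ x, x ∈ F ↔ x ∈ crossings v C) {i : Bool} {z : ℂ} (hz : z ∈ doublePentagon.poly i)
    (hn : doublePentagon.toPoint i z hz ∉ doublePentagon.singular)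
    (hnC : doublePentagon.toPoint i z hz ∉ C) :
    IsOddPoint v F (doublePentagon.toPoint i z hz) ↔
      parityBelow F (crossing v (sg i * z)) = 1 := by
  refine ⟨?_, fun h => ⟨i, z, hz, rfl, h⟩⟩
  rintro ⟨j, w, hw, he, h⟩
  rcases toPoint_eq_cases he hn with ⟨rfl, rfl⟩ | ⟨m, h1, rfl, rfl⟩
  · exact h
  · have h2 := sg_nb_mul (S := doublePentagon) i m z
    change sg (nb (S := doublePentagon) i m) * (z - sg (side (S := doublePentagon) i) * edgeSum m)
      = edgeSum m - sg i * z at h2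
    rw [h2] at h
    rw [← h]
    refine (hC.parityBelow_edge hv hF h1 ?_).symm
    rw [hC.toPoint_mem_iff hv, ← hF] at hnC
    exact hnC

theorem isOddPoint_run (hC : IsSymmetricCurve v C) (hv : ‖v‖ = 1)
    (hF : ∀ x, x ∈ F ↔ x ∈ crossings v C) {u : ℂ} {γ : ℝ → doublePentagon.Point} {t r : ℝ}
    (h : doublePentagon.RunsStraight u γ t (uIcc 0 r))
    (hn : ∀ s ∈ uIcc 0 r, γ (t + s) ∉ doublePentagon.singular ∧ γ (t + s) ∉ C) :
    IsOddPoint v F (γ (t + r)) ↔ IsOddPoint v F (γ (t + 0)) := by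
  obtain ⟨i, z, h⟩ := h
  have key : ∀ s ∈ uIcc 0 r, crossing v (sg i * (z + s * u)) ∉ F ∧ (IsOddPoint v F (γ (t + s)) ↔
      parityBelow F (crossing v (sg i * (z + s * u))) = 1) := by
    intro s hs
    obtain ⟨h1, h2⟩ := h s hs
    obtain ⟨h3, h4⟩ := hn s hs
    rw [h2] at h3 h4 ⊢
    refine ⟨?_, hC.isOddPoint_iff hv hF h1 h3 h4⟩
    exact fun h5 => h4 ((hC.toPoint_mem_iff hv h1).2 ((hF _).1 h5))
  rw [(key r right_mem_uIcc).2, (key 0 left_mem_uIcc).2]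
  have hc : ContinuousOn (fun s : ℝ => crossing v (sg i * (z + s * u))) (uIcc 0 r) := by
    refine Continuous.continuousOn ?_
    have := (crossing v).continuous_of_finiteDimensional
    fun_prop
  rw [parityBelow_eq_of_forall_not_mem fun y hy => ?_]
  obtain ⟨s, hs, rfl⟩ := intermediate_value_uIcc hc (uIcc_comm (crossing v _) _ ▸ hy)
  exact (key s hs).1

/-- The parity is constant along straight curves that avoid `C`. -/
theorem isOddPoint_eq (hC : IsSymmetricCurve v C) (hv : ‖v‖ = 1)
    (hF : ∀ x, x ∈ F ↔ x ∈ crossings v C) {u : ℂ} {γ : ℝ → doublePentagon.Point} {J : Set ℝ}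
    (h : doublePentagon.IsStraightOn u γ J) (hJ : IsPreconnected J) (hn : ∀ s ∈ J, γ s ∉ C)
    {a b : ℝ} (ha : a ∈ J) (hb : b ∈ J) : IsOddPoint v F (γ a) = IsOddPoint v F (γ b) := by
  refine eqOn_of_locally_eq (f := fun s => IsOddPoint v F (γ s)) hJ (fun t ht => ?_) ha hb
  obtain ⟨h0, ε, hε, h1, h2⟩ := h t ht
  refine ⟨ε, hε, fun s hs hst => propext ?_⟩
  obtain ⟨r, rfl⟩ : ∃ r, s = t + r := ⟨s - t, by ring⟩
  rw [add_sub_cancel_left, abs_lt] at hst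
  have hsub : ∀ x ∈ uIcc 0 r, t + x ∈ J := by
    intro x hx
    refine hJ.ordConnected.uIcc_subset ht hs ?_
    rw [mem_uIcc] at hx ⊢
    rcases hx with hx | hx
    · left; constructor <;> linarith [hx.1, hx.2]
    · right; constructor <;> linarith [hx.1, hx.2]
  have hrun : doublePentagon.RunsStraight u γ t (uIcc 0 r) := by
    rcases le_total r 0 with hr | hr
    · rw [uIcc_of_ge hr]
      exact h1.mono (Icc_subset_Icc hst.1.le le_rfl)
    · rw [uIcc_of_le hr]
      exact h2.mono (Icc_subset_Icc le_rfl hst.2.le)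
  have := hC.isOddPoint_run hv hF hrun fun x hx => ⟨(h _ (hsub x hx)).1, hn _ (hsub x hx)⟩
  rwa [add_zero] at this

/-- To the left of the first chord the parity is odd. -/
theorem exists_isOddPoint (hC : IsSymmetricCurve v C) (hv : ‖v‖ = 1)
    (hF : ∀ x, x ∈ F ↔ x ∈ crossings v C) {x₀ : ℝ} (hx₀ : x₀ ∈ F) (hmin : ∀ y ∈ F, x₀ ≤ y)
    {z₀ : ℂ} {hz₀ : z₀ ∈ doublePentagon.poly true} (he : crossing v z₀ = x₀) {J : Set ℝ}
    {γ : ℝ → doublePentagon.Point} (hγ : doublePentagon.IsStraightOn (I * v) γ J) (h0 : 0 ∈ J)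
    (hγ0 : γ 0 = doublePentagon.toPoint true z₀ hz₀) :
    ∃ ε > 0, ∀ s ∈ Ioo 0 ε, IsOddPoint v F (γ s) := by
  obtain ⟨hn, ε, hε, -, i, z, h⟩ := hγ 0 h0
  obtain ⟨h1, h2⟩ := h 0 ⟨le_rfl, hε.le⟩
  have hzero : parityBelow F x₀ = 0 := parityBelow_eq_zero hmin
  rw [zero_add, hγ0] at h2
  rw [hγ0] at hn
  have hez : z + (0 : ℝ) * (I * v) = z := by simp
  have hcI := crossing_I_mul hv
  suffices H : ∃ δ > 0, ∀ s : ℝ, s ∈ Ioo 0 δ →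
      parityBelow F (crossing v (sg i * (z + s * (I * v)))) = 1 by
    obtain ⟨δ, hδ, H⟩ := H
    refine ⟨min ε δ, lt_min hε hδ, fun s hs => ?_⟩
    obtain ⟨h3, h4⟩ := h s ⟨hs.1.le, hs.2.le.trans (min_le_left _ _)⟩
    rw [zero_add] at h4
    exact ⟨i, _, h3, h4, H s ⟨hs.1, hs.2.trans_le (min_le_right _ _)⟩⟩
  rcases toPoint_eq_cases h2 hn with ⟨rfl, h3⟩ | ⟨m, h3, rfl, h4⟩
  · rw [hez] at h3
    subst h3
    obtain ⟨δ, hδ, h4⟩ := exists_isolating F x₀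
    refine ⟨δ, hδ, fun s hs => ?_⟩
    rw [sg_true, crossing_add_mul, hcI, mul_one, he, parityBelow_add hx₀ h4 hs.1 hs.2, hzero,
      zero_add]
  · rw [hez] at h4
    change sg true * z₀ ∈ edge m at h3
    change z = z₀ - sg true * edgeSum m at h4
    rw [sg_true] at h3 h4
    subst h4
    have h5 : crossing v (edgeSum m - z₀) ∈ F :=
      (hF _).2 (hC.crossing_edgeSum_sub_mem hv h3 (he ▸ (hF x₀).1 hx₀))
    have h6 : x₀ ≠ crossing v (edgeSum m - z₀) := by
      intro h6
      apply hC.crossing_half_edgeSum_not_mem hv m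
      have h7 : edgeSum m / 2 = ((1 / 2 : ℝ)) • (z₀ + (edgeSum m - z₀)) := by
        rw [Complex.real_smul]
        push_cast
        ring
      rw [h7, map_smul, map_add, he, ← h6, smul_eq_mul]
      convert (hF x₀).1 hx₀ using 1
      ring
    have h7 := hC.parityBelow_edge_of_lt hv hF h3
      (by rw [he]; exact lt_of_le_of_ne (hmin _ h5) h6)
    rw [he, hzero, if_pos hx₀, zero_add] at h7
    obtain ⟨δ, hδ, h8⟩ := exists_isolating F (crossing v (edgeSum m - z₀))
    refine ⟨δ, hδ, fun s hs => ?_⟩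
    have h9 : sg (nb (S := doublePentagon) true m) * (z₀ - edgeSum m + s * (I * v)) =
        edgeSum m - z₀ + (-s : ℝ) * (I * v) := by
      change sg false * _ = _
      rw [sg_false]
      push_cast
      ring
    rw [h9, crossing_add_mul, hcI, mul_one, ← sub_eq_add_neg, parityBelow_sub h8 hs.1 hs.2, h7]

/-- A symmetric curve that contains no midpoint is not made of core curves. -/
theorem not_maximal (hC : IsSymmetricCurve v C) (hv : ‖v‖ = 1) (hfin : (crossings v C).Finite)
    (hne : (crossings v C).Nonempty) {w : ℝ} (hw : 0 < w)
    (hfam : ∀ x ∈ C, ∃ Φ t, doublePentagon.IsParallelFamily v (-w) w Φ ∧ Φ 0 t = x) :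
    ∃ Φ t, doublePentagon.IsParallelFamily v (-w) w Φ ∧ Φ 0 t ∈ C ∧
      ∃ b > w, ∃ Ψ, doublePentagon.IsParallelFamily v (-w) b Ψ ∧ Ψ 0 = Φ 0 := by
  obtain ⟨F, hF'⟩ := hfin.exists_finset_coe
  have hF : ∀ x, x ∈ F ↔ x ∈ crossings v C := fun x => by rw [← hF', Finset.mem_coe]
  obtain ⟨x₀, hx₀, hmin⟩ := F.exists_min_image id (by rwa [← Finset.coe_nonempty, hF'])
  obtain ⟨z₀, hz₀, hz₀C, he⟩ := (hF x₀).1 hx₀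
  obtain ⟨Φ, t₀, hΦ, ht₀⟩ := hfam _ hz₀C
  refine ⟨Φ, t₀, hΦ, ht₀ ▸ hz₀C, ?_⟩
  by_cases hhit : ∃ s ∈ Ioo 0 w, ∃ t, Φ s t ∈ C
  · obtain ⟨s, hs, t, ht⟩ := hhit
    obtain ⟨Φ', t', hΦ', ht'⟩ := hfam _ ht
    exact ⟨w + s, by linarith [hs.1], hΦ.exists_join hΦ' hs ht'.symm⟩
  push Not at hhit
  obtain ⟨ε, hε, hodd⟩ := hC.exists_isOddPoint hv hF hx₀ hmin he (hΦ.2 t₀)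
    ⟨by linarith, hw⟩ ht₀
  obtain ⟨d, hd, hvert⟩ := hC.exists_parityBelow_zeta hv hF
  have hodd' : ∀ s ∈ Ioo 0 w, ∀ t, IsOddPoint v F (Φ s t) := by
    intro s hs t
    have hm : 0 < min ε w := lt_min hε hw
    have h1 := hodd (min ε w / 2) ⟨by linarith, by linarith [min_le_left ε w]⟩
    have h2 := hC.isOddPoint_eq hv hF ((hΦ.2 t₀).mono (J' := Ioo 0 w)
      (Ioo_subset_Ioo_left (by linarith))) isPreconnected_Ioo (fun s hs => hhit s hs t₀)
      (a := min ε w / 2) ⟨by linarith, by linarith [min_le_right ε w]⟩ hs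
    rw [h2] at h1
    rwa [hC.isOddPoint_eq hv hF (hΦ.1 s ⟨by linarith [hs.1], hs.2⟩).1 isPreconnected_univ
      (fun t _ => hhit s hs t) (mem_univ t) (mem_univ t₀)]
  refine hΦ.exists_extension hv hw hd fun s hs t i z hz hst k => ?_
  by_contra! hlt
  have h1 := hodd' s hs t
  have h2 := hhit s hs t
  have h3 := ((hΦ.1 s ⟨by linarith [hs.1], hs.2⟩).1 t (mem_univ t)).1
  rw [hst] at h1 h2 h3
  have h4 := (hC.isOddPoint_iff hv hF hz h3 h2).1 h1
  exact absurd ((hvert k _ hlt).symm.trans h4) (by decide)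

end IsSymmetricCurve

theorem invol_edgeMidpoint (k : ZMod 5) : invol (edgeMidpoint k) = edgeMidpoint k := by
  have hz : edgeSum k / 2 ∈ doublePentagon.poly true :=
    mem_poly_true_iff.2 (midpoint_mem_pentagon k)
  have h1 : sg (side (S := doublePentagon) true) * (edgeSum k / 2) ∈ edge k := by
    change sg true * _ ∈ _
    rw [sg_true]
    exact half_edgeSum_mem_edge k
  have h2 := toPoint_nb_eq hz (mem_poly_of_nb h1)
  refine (invol_toPoint (i := true) (midpoint_mem_pentagon k)).trans (Eq.trans ?_ h2.symm)
  refine double_toPoint_congr rfl ?_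
  change _ = edgeSum k / 2 - sg true * edgeSum k
  rw [sg_true, edgeSum]
  ring

/-- The image of a trajectory under the involution, with the time reversed. -/
noncomputable def reversal (γ : ℝ → doublePentagon.Point) (t : ℝ) : doublePentagon.Point :=
  invol (γ (-t))

theorem reversal_reversal (γ : ℝ → doublePentagon.Point) : reversal (reversal γ) = γ := by
  funext t
  rw [reversal, reversal, invol_invol, neg_neg]

theorem reversal_isStraightOn {u : ℂ} {γ : ℝ → doublePentagon.Point} {J : Set ℝ}
    (h : doublePentagon.IsStraightOn u γ J) :
    doublePentagon.IsStraightOn u (reversal γ) {t | -t ∈ J} := by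
  have h1 := invol_isStraightOn (h.comp_sub 0)
  rw [neg_neg] at h1
  simp only [zero_sub] at h1
  exact h1

theorem reversal_isPeriodicTrajectory {u : ℂ} {γ : ℝ → doublePentagon.Point}
    (h : doublePentagon.IsPeriodicTrajectory u γ) :
    doublePentagon.IsPeriodicTrajectory u (reversal γ) := by
  obtain ⟨h1, T, hT, hP⟩ := h
  refine ⟨reversal_isStraightOn h1, T, hT, fun t => ?_⟩
  rw [reversal, reversal, neg_add, ← sub_eq_add_neg, hP.sub_eq]

theorem reversal_isParallelFamily {v : ℂ} {a b : ℝ} {Φ : ℝ → ℝ → doublePentagon.Point}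
    (h : doublePentagon.IsParallelFamily v a b Φ) :
    doublePentagon.IsParallelFamily v (-b) (-a) fun s => reversal (Φ (-s)) := by
  refine ⟨fun s hs => reversal_isPeriodicTrajectory (h.1 (-s) ⟨by linarith [hs.2],
    by linarith [hs.1]⟩), fun t => ?_⟩
  exact (reversal_isStraightOn (h.2 (-t))).mono fun s hs =>
    ⟨by linarith [hs.2], by linarith [hs.1]⟩

/-- A core curve of a cylinder passes through the midpoint of an edge. -/
theorem exists_eq_edgeMidpoint {v : ℂ} (hv : ‖v‖ = 1) {p : ℝ → doublePentagon.Point}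
    (hp : doublePentagon.IsPeriodicTrajectory v p) (hcore : doublePentagon.IsCoreCurve v p) :
    ∃ (t : ℝ) (k : ZMod 5), p t = edgeMidpoint k := by
  by_contra! hno
  obtain ⟨w, hw, ⟨Φ, hΦ, hΦ0⟩, hmax⟩ := hcore
  have hp' := reversal_isPeriodicTrajectory hp
  have hC : IsSymmetricCurve v (range p ∪ range (reversal p)) := by
    refine ⟨?_, ?_, ?_⟩
    · rintro _ (⟨t, rfl⟩ | ⟨t, rfl⟩)
      · exact ⟨p, t, hp.1, rfl, fun s => Or.inl (mem_range_self s)⟩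
      · exact ⟨reversal p, t, hp'.1, rfl, fun s => Or.inr (mem_range_self s)⟩
    · rintro _ (⟨t, rfl⟩ | ⟨t, rfl⟩)
      · exact Or.inr ⟨-t, by rw [reversal, neg_neg]⟩
      · exact Or.inl ⟨-t, by rw [reversal, invol_invol]⟩
    · rintro k (⟨t, ht⟩ | ⟨t, ht⟩)
      · exact hno t k ht
      · refine hno (-t) k ?_
        rw [← invol_edgeMidpoint, ← ht, reversal, invol_invol]
  have hfin : (crossings v (range p ∪ range (reversal p))).Finite := by
    refine ((finite_crossings_range hp).union (finite_crossings_range hp')).subset ?_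
    rintro _ ⟨z, hz, h | h, rfl⟩
    · exact Or.inl ⟨z, hz, h, rfl⟩
    · exact Or.inr ⟨z, hz, h, rfl⟩
  have hne : (crossings v (range p ∪ range (reversal p))).Nonempty := by
    obtain ⟨i, z, hz, h⟩ := exists_double_rep (p 0)
    exact ⟨_, (hC.toPoint_mem_iff hv hz).1 (h ▸ Or.inl (mem_range_self 0))⟩
  have hΦ' := reversal_isParallelFamily hΦ
  rw [neg_neg] at hΦ'
  have hΦ'0 : reversal (Φ (-0)) = reversal p := by rw [neg_zero, hΦ0]
  obtain ⟨Φ₁, t, hΦ₁, ht, b, hb, Ψ, hΨ, hΨ0⟩ := hC.not_maximal hv hfin hne hw (by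
    rintro _ (⟨t, rfl⟩ | ⟨t, rfl⟩)
    · exact ⟨Φ, t, hΦ, by rw [hΦ0]⟩
    · exact ⟨_, t, hΦ', congrFun hΦ'0 t⟩)
  have hgen : ∀ q : ℝ → doublePentagon.Point, doublePentagon.IsStraightOn v q univ →
      (∃ t', q t' = Ψ 0 t) → ∃ Ψ', doublePentagon.IsParallelFamily v (-w) b Ψ' ∧ Ψ' 0 = q := by
    rintro q hq ⟨t', ht'⟩
    refine ⟨fun s x => Ψ s (x + (t - t')), ⟨fun s hs => ?_, fun x => hΨ.2 _⟩, ?_⟩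
    · obtain ⟨h1, T, hT, hP⟩ := hΨ.1 s hs
      refine ⟨h1.comp_add (t - t'), T, hT, fun x => ?_⟩
      dsimp only
      rw [add_right_comm, hP]
    · funext x
      have h1 := hq.translate_eq (hΨ.1 0 ⟨by linarith, by linarith⟩).1 ht' (x - t')
      rw [sub_add_cancel] at h1
      rw [h1]
      change Ψ 0 (x + (t - t')) = _
      congr 1
      ring
  rw [← hΨ0] at ht
  rcases ht with ⟨t', ht'⟩ | ⟨t', ht'⟩
  · obtain ⟨Ψ', h1, h2⟩ := hgen p hp.1 ⟨t', ht'⟩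
    have := (hmax (-w) b Ψ' (by linarith) (by linarith) h1 h2).2
    linarith
  · obtain ⟨Ψ', h1, h2⟩ := hgen _ hp'.1 ⟨t', ht'⟩
    have h3 := reversal_isParallelFamily h1
    rw [neg_neg] at h3
    have := (hmax (-b) w _ (by linarith) hw h3 (by rw [neg_zero, h2, reversal_reversal])).1
    linarith

theorem mainTheorem5 (v : ℂ) (hv : ‖v‖ = 1) (p : ℝ → doublePentagon.Point)
    (hp : doublePentagon.IsPeriodicTrajectory v p) (hcore : doublePentagon.IsCoreCurve v p) :
    (∃ (t : ℝ) (k : ZMod 5), p t = edgeMidpoint k) ∧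
    ∃ l : ℝ, HasLength p l ∧
      ((∃ q : Fin 5 → ℝ → necklace.Point,
          (∀ j, necklace.IsPeriodicTrajectory v (q j)) ∧
          (∀ i j, i ≠ j → Disjoint (Set.range (q i)) (Set.range (q j))) ∧
          project ⁻¹' Set.range p = ⋃ j, Set.range (q j) ∧
          (∀ j, project ∘ q j = p ∧ Set.BijOn project (Set.range (q j)) (Set.range p) ∧
            HasLength (q j) l) ∧
          ∀ j, IsBilliardTrajectory (fold ∘ q j) ∧ HasLength (fold ∘ q j) l ∧
            (∃! k, IsSymmetricUnder (bisectorReflection k) (Set.range (fold ∘ q j))) ∧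
            ∀ k, k ≠ 0 → ¬ IsSymmetricUnder (pentagonRotation k) (Set.range (fold ∘ q j))) ∨
        (∃ q : ℝ → necklace.Point,
          necklace.IsPeriodicTrajectory v q ∧
          project ⁻¹' Set.range p = Set.range q ∧
          project ∘ q = p ∧
          HasLength q (5 * l) ∧
          IsBilliardTrajectory (fold ∘ q) ∧
          (¬ ParallelToEdge v → HasLength (fold ∘ q) (5 * l)) ∧
          (ParallelToEdge v → HasLength (fold ∘ q) (5 * l / 2)) ∧
          (∀ k, IsSymmetricUnder (bisectorReflection k) (Set.range (fold ∘ q))) ∧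
          ∀ k, IsSymmetricUnder (pentagonRotation k) (Set.range (fold ∘ q)))) := by
  have hmid := exists_eq_edgeMidpoint hv hp hcore
  exact ⟨hmid, lift_dichotomy hv hp hmid⟩
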